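/- **Theorem 2.7.** Let $G$ be an étale groupoid: a topological groupoid, not necessarily Hausdorff, whose unit space $G^{(0)}$ is locally compact Hausdorff and whose range map $r\colon G\to G^{(0)}$ is a local homeomorphism. Let $p\colon\mathcal A\to G$ be a Fell bundle over $G$, i.e. an upper semicontinuous bundle of Banach spaces with a continuous associative multiplication $\mathcal A_\gamma\times\mathcal A_\eta\to\mathcal A_{\gamma\eta}$ for composable $\gamma,\eta$, bilinear and with $\|ab\|\le\|a\|\|b\|$, and a continuous conjugate-linear involution $\mathcal A_\gamma\to\mathcal A_{\gamma^{-1}}$ with $(ab)^*=b^*a^*$, $a^{**}=a$, $\|a^*a\|=\|aa^*\|=\|a\|^2$ and $a^*a\ge 0$ in $\mathcal A_{s(p(a))}$. The bundle need not be saturated. Let $\mathrm C_c(G;\mathcal A)$ be the linear span of the sections of $p$ that vanish outside a compact subset of some open Hausdorff set $V\subseteq G$ and are continuous on $V$; it is a $*$-algebra under $(f*g)(\gamma)=\sum_{\alpha\beta=\gamma}f(\alpha)g(\beta)$ and $f^*(\gamma)=f(\gamma^{-1})^*$. Put $$\|f\|_I=\max\Bigl\{\sup_{x\in G^{(0)}}\sum_{r(\gamma)=x}\|f(\gamma)\|,\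 \sup_{x\in G^{(0)}}\sum_{s(\gamma)=x}\|f(\gamma)\|\Bigr\}.$$ The inductive limit topology on $\mathrm C_c(G;\mathcal A)$ is the finest locally convex topology for which, for every open bisection $U$ and compact $K\subseteq U$, the inclusion of the space of those $f\in \mathrm C_c(G;\mathcal A)$ that are continuous on $U$ and vanish outside $K$, with the supremum norm, is continuous. A *representation* is a nondegenerate $*$-homomorphism $\rho\colon\mathrm C_c(G;\mathcal A)\to\mathbb B(\mathcal H)$ for a Hilbert space $\mathcal H$. It is *$I$-norm bounded* if $\|\rho(f)\|\le\|f\|_I$ for all $f$. A *pre-representation* on $\mathcal H$ is a linear subspace $\mathcal H_0\subseteq\mathcal H$ with an algebra homomorphism $L\colon\mathrm C_c(G;\mathcal A)\to\mathrm{Lin}(\mathcal H_0)$ such that, for $\xi,\eta\in\mathcal H_0$, the map $f\mapsto\langle\eta,L(f)\xi\rangle$ is continuous in the inductive limit topology, $\langle\eta,L(f)\xi\rangle=\langle L(f^*)\eta,\xi\rangle$, and $\{L(f)\xi : f\in\mathrm C_c(G;\mathcal A),\ \xi\in\mathcal H_0\}$ spans a dense subspace of $\mathcal H$. A $*$-homomorphism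 $M\colon\mathrm C_c(G;\mathcal A)\to\mathbb B(\mathcal H)$ is *induced* by $(\mathcal H_0,L)$ if $M(f)|_{\mathcal H_0}=L(f)$ for all $f$. Let $\mathcal R_R$, $\mathcal R_H$, $\mathcal R_{\mathrm{In}}$, $\mathcal R_P$ be the collections of, respectively, all representations, the $I$-norm bounded ones, those continuous from the inductive limit topology to the norm topology, and those induced by pre-representations. For $\bullet\in\{R,H,\mathrm{In},P\}$ let $\|f\|_\bullet=\sup_{\rho\in\mathcal R_\bullet}\|\rho(f)\|$. Then: 1. Every pre-representation on $\mathcal H$ induces exactly one $*$-homomorphism $M$, and $M$ is a representation continuous in the inductive limit topology. 2. For every $f\in\mathrm C_c(G;\mathcal A)$, $\|f\|_R=\|f\|_H=\|f\|_{\mathrm{In}}=\|f\|_P<\infty$. 3. $\|\cdot\|:=\|\cdot\|_R$ is a $\mathrm C^*$-norm on $\mathrm C_c(G;\mathcal A)$; hence it has a $\mathrm C^*$-algebra completion $\mathrm C^*(G;\mathcal A)$. 4. Suppose that $G$ is Hausdorff and second countable and $\mathcal A$ is saturated (the span of $\mathcal A_\gamma\mathcal A_\eta$ is dense in $\mathcal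 A_{\gamma\eta}$ for composable $\gamma,\eta$). Then $\mathrm C_c(G;\mathcal A)$ is the set of all compactly supported continuous sections, which is the algebra of Muhly and Williams. Let the Muhly–Williams topology on it be the inductive limit (in the locally convex sense) of the spaces of continuous sections vanishing outside $K$, with the supremum norm, $K\subseteq G$ compact. The supremum of $\|\rho(f)\|$ over the representations that are continuous in this topology, and the supremum over those induced from pre-representations with respect to it, both equal $\|f\|$. Hence the Muhly–Williams full $\mathrm C^*$-algebra, the completion in this norm, agrees with $\mathrm C^*(G;\mathcal A)$: there is exactly one $*$-isomorphism between the two completions that is the identity on $\mathrm C_c(G;\mathcal A)$. -/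

import Mathlib

open Set Filter Topology
open scoped ENNReal

universe u v w

namespace EtaleFell

/-! ### Étale groupoids -/

/-- An (algebraic) groupoid, presented by its set `G` of arrows; a unit is identified with the
identity arrow at it.  The product `a * b` is only meaningful for composable pairs, that is
if `src a = rng b`: no law speaks about its value at any other pair. -/
class ArrowGroupoid (G : Type u) extends Mul G, Inv G where
  /-- the range map -/
  rng : G → G
  /-- the source map -/
  src : G → G
  rng_rng : ∀ a, rng (rng a) = rng a
  src_rng : ∀ a, src (rng a) = rng a
  rng_src : ∀ a, rng (src a) = src a
  src_src : ∀ a, src (src a) = src a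
  rng_mul : ∀ a b, src a = rng b → rng (a * b) = rng a
  src_mul : ∀ a b, src a = rng b → src (a * b) = src b
  assoc : ∀ a b c, src a = rng b → src b = rng c → a * b * c = a * (b * c)
  rng_mul_self : ∀ a, rng a * a = a
  self_mul_src : ∀ a, a * src a = a
  rng_inv : ∀ a, rng a⁻¹ = src a
  src_inv : ∀ a, src a⁻¹ = rng a
  inv_mul_self : ∀ a, a⁻¹ * a = src a
  self_mul_inv : ∀ a, a * a⁻¹ = rng a

open ArrowGroupoid

/-- The space of units `G⁽⁰⁾ ⊆ G`. -/
def unitSpace (G : Type u) [ArrowGroupoid G] : Set G := {x | rng x = x}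

/-- The range map, with codomain the space of units. -/
def toUnit {G : Type u} [ArrowGroupoid G] (a : G) : unitSpace G := ⟨rng a, rng_rng a⟩

/-- An étale groupoid: a topological groupoid (not necessarily Hausdorff) whose space of units is
locally compact and Hausdorff in the subspace topology, and whose range map `G → G⁽⁰⁾` is a local
homeomorphism. -/
class EtaleGroupoid (G : Type u) [TopologicalSpace G] extends ArrowGroupoid G where
  continuous_rng : Continuous rng
  continuous_src : Continuous src
  continuous_inv : Continuous fun a : G => a⁻¹
  continuousOn_mul : ContinuousOn (fun q : G × G => q.1 * q.2) {q | src q.1 = rng q.2}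
  t2Space_units : T2Space (unitSpace G)
  locallyCompactSpace_units : LocallyCompactSpace (unitSpace G)
  isLocalHomeomorph_rng : IsLocalHomeomorph (toUnit : G → unitSpace G)

/-- An open set `U` is a bisection if range and source restrict to homeomorphisms of `U` onto open
subsets of the space of units; as both are local homeomorphisms, this says that they
are injective on `U`. -/
structure IsBisection {G : Type u} [TopologicalSpace G] [EtaleGroupoid G] (U : Set G) : Prop where
  isOpen : IsOpen U
  injOn_rng : InjOn (rng : G → G) U
  injOn_src : InjOn (src : G → G) U

/-! ### Banach bundles and Fell bundles -/

/-- The fibre `p⁻¹(x)` (a separate type, so that it does not inherit the topology of `A`; it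
carries its own norm topology instead). -/
@[ext] structure Fibre {X : Type u} {A : Type v} (p : A → X) (x : X) where
  /-- the underlying point of the total space -/
  pt : A
  proj_pt : p pt = x

/-- An upper semicontinuous bundle of Banach spaces with total space `A` over the base `X`. -/
structure BanachBundle (X : Type u) (A : Type v) [TopologicalSpace X] [TopologicalSpace A] where
  /-- the bundle map -/
  proj : A → X
  continuous_proj : Continuous proj
  isOpenMap_proj : IsOpenMap proj
  [normedAddCommGroup : ∀ x, NormedAddCommGroup (Fibre proj x)]
  [normedSpace : ∀ x, NormedSpace ℂ (Fibre proj x)]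
  [completeSpace : ∀ x, CompleteSpace (Fibre proj x)]
  upperSemicontinuous_norm :
    UpperSemicontinuous fun a : A => ‖(⟨a, rfl⟩ : Fibre proj (proj a))‖
  continuous_add : Continuous fun q : {q : A × A // proj q.1 = proj q.2} =>
    ((⟨q.1.1, q.2⟩ : Fibre proj (proj q.1.2)) + ⟨q.1.2, rfl⟩).pt
  continuous_smul : Continuous fun q : ℂ × A => (q.1 • (⟨q.2, rfl⟩ : Fibre proj (proj q.2))).pt
  /-- If `proj aᵢ → x` and `‖aᵢ‖ → 0`, then `aᵢ` converges to the zero of the fibre over `x`. -/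
  tendsto_zero : ∀ x : X,
    comap proj (𝓝 x) ⊓ comap (fun a : A => ‖(⟨a, rfl⟩ : Fibre proj (proj a))‖) (𝓝 0) ≤
      𝓝 (0 : Fibre proj x).pt

instance {X : Type u} {A : Type v} [TopologicalSpace X] [TopologicalSpace A]
    (B : BanachBundle X A) (x : X) : NormedAddCommGroup (Fibre B.proj x) :=
  B.normedAddCommGroup x

instance {X : Type u} {A : Type v} [TopologicalSpace X] [TopologicalSpace A]
    (B : BanachBundle X A) (x : X) : NormedSpace ℂ (Fibre B.proj x) :=
  B.normedSpace x

instance {X : Type u} {A : Type v} [TopologicalSpace X] [TopologicalSpace A]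
    (B : BanachBundle X A) (x : X) : CompleteSpace (Fibre B.proj x) :=
  B.completeSpace x

/-- A Fell bundle over an étale groupoid, not necessarily saturated.  The product `mul a b` is only
meaningful if `proj a` and `proj b` are composable. -/
structure FellBundle (G : Type u) (A : Type v) [TopologicalSpace G] [EtaleGroupoid G]
    [TopologicalSpace A] extends BanachBundle G A where
  /-- the multiplication of composable elements -/
  mul : A → A → A
  /-- the involution -/
  adj : A → A
  continuousOn_mul :
    ContinuousOn (fun q : A × A => mul q.1 q.2) {q | src (proj q.1) = rng (proj q.2)}
  continuous_adj : Continuous adj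
  proj_mul : ∀ a b, src (proj a) = rng (proj b) → proj (mul a b) = proj a * proj b
  add_mul : ∀ {γ η : G} (h : src γ = rng η) (a a' : Fibre proj γ) (b : Fibre proj η),
    mul (a + a').pt b.pt =
      ((⟨mul a.pt b.pt, by rw [proj_mul, a.2, b.2]; rwa [a.2, b.2]⟩ : Fibre proj (γ * η)) +
        ⟨mul a'.pt b.pt, by rw [proj_mul, a'.2, b.2]; rwa [a'.2, b.2]⟩).pt
  mul_add : ∀ {γ η : G} (h : src γ = rng η) (a : Fibre proj γ) (b b' : Fibre proj η),
    mul a.pt (b + b').pt =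
      ((⟨mul a.pt b.pt, by rw [proj_mul, a.2, b.2]; rwa [a.2, b.2]⟩ : Fibre proj (γ * η)) +
        ⟨mul a.pt b'.pt, by rw [proj_mul, a.2, b'.2]; rwa [a.2, b'.2]⟩).pt
  smul_mul : ∀ {γ η : G} (h : src γ = rng η) (c : ℂ) (a : Fibre proj γ) (b : Fibre proj η),
    mul (c • a).pt b.pt =
      (c • (⟨mul a.pt b.pt, by rw [proj_mul, a.2, b.2]; rwa [a.2, b.2]⟩ :
        Fibre proj (γ * η))).pt
  mul_smul : ∀ {γ η : G} (h : src γ = rng η) (c : ℂ) (a : Fibre proj γ) (b : Fibre proj η),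
    mul a.pt (c • b).pt =
      (c • (⟨mul a.pt b.pt, by rw [proj_mul, a.2, b.2]; rwa [a.2, b.2]⟩ :
        Fibre proj (γ * η))).pt
  mul_assoc : ∀ a b c, src (proj a) = rng (proj b) → src (proj b) = rng (proj c) →
    mul (mul a b) c = mul a (mul b c)
  norm_mul_le : ∀ a b, src (proj a) = rng (proj b) →
    ‖(⟨mul a b, rfl⟩ : Fibre proj (proj (mul a b)))‖ ≤
      ‖(⟨a, rfl⟩ : Fibre proj (proj a))‖ * ‖(⟨b, rfl⟩ : Fibre proj (proj b))‖
  proj_adj : ∀ a, proj (adj a) = (proj a)⁻¹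
  adj_add : ∀ {γ : G} (a b : Fibre proj γ),
    adj (a + b).pt = ((⟨adj a.pt, by rw [proj_adj, a.2]⟩ : Fibre proj γ⁻¹) +
      ⟨adj b.pt, by rw [proj_adj, b.2]⟩).pt
  adj_smul : ∀ {γ : G} (c : ℂ) (a : Fibre proj γ),
    adj (c • a).pt =
      (starRingEnd ℂ c • (⟨adj a.pt, by rw [proj_adj, a.2]⟩ : Fibre proj γ⁻¹)).pt
  adj_adj : ∀ a, adj (adj a) = a
  adj_mul : ∀ a b, src (proj a) = rng (proj b) → adj (mul a b) = mul (adj b) (adj a)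
  norm_adj_mul_self : ∀ a, ‖(⟨mul (adj a) a, rfl⟩ : Fibre proj (proj (mul (adj a) a)))‖ =
    ‖(⟨a, rfl⟩ : Fibre proj (proj a))‖ ^ 2
  norm_self_mul_adj : ∀ a, ‖(⟨mul a (adj a), rfl⟩ : Fibre proj (proj (mul a (adj a))))‖ =
    ‖(⟨a, rfl⟩ : Fibre proj (proj a))‖ ^ 2
  /-- `a* a` is a positive element `b* b` of the C*-algebra that is the fibre over the unit
  `src (proj a)`. -/
  adj_mul_self_nonneg : ∀ a, ∃ b, proj b = src (proj a) ∧ mul (adj a) a = mul (adj b) b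

/-! ### Groupoid identities -/

section ArrowGroupoid

variable {G : Type u} [ArrowGroupoid G]

theorem inv_inv_arrow (a : G) : a⁻¹⁻¹ = a := by
  have h1 : src (a⁻¹)⁻¹ = src a := by rw [src_inv, rng_inv]
  calc a⁻¹⁻¹ = a⁻¹⁻¹ * src a := by rw [← h1, self_mul_src]
    _ = a⁻¹⁻¹ * (a⁻¹ * a) := by rw [inv_mul_self]
    _ = a⁻¹⁻¹ * a⁻¹ * a := by rw [assoc _ _ _ (src_inv _) (src_inv _)]
    _ = a := by rw [inv_mul_self, src_inv, rng_mul_self]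

theorem mul_inv_mul_cancel {a b : G} (h : rng a = rng b) : a * (a⁻¹ * b) = b := by
  rw [← assoc _ _ _ (rng_inv a).symm (by rw [src_inv, h]), self_mul_inv, h, rng_mul_self]

theorem inv_mul_mul_cancel {a b : G} (h : src a = rng b) : a⁻¹ * (a * b) = b := by
  rw [← assoc _ _ _ (src_inv a) h, inv_mul_self, h, rng_mul_self]

theorem mul_mul_inv_cancel {a b : G} (h : src a = rng b) : a * b * b⁻¹ = a := by
  rw [assoc _ _ _ h (rng_inv b).symm, self_mul_inv, ← h, self_mul_src]

theorem mul_inv_cancel_mul {a b : G} (h : src a = src b) : a * b⁻¹ * b = a := by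
  rw [assoc _ _ _ (by rw [rng_inv, h]) (src_inv b), inv_mul_self, ← h, self_mul_src]

theorem mul_inv_rev_arrow {a b : G} (h : src a = rng b) : (a * b)⁻¹ = b⁻¹ * a⁻¹ := by
  have h2 : src b⁻¹ = rng a⁻¹ := by rw [src_inv, rng_inv, h]
  have h3 : src (a * b) = rng (b⁻¹ * a⁻¹) := by rw [rng_mul _ _ h2, src_mul _ _ h, rng_inv]
  have h4 : a * b * (b⁻¹ * a⁻¹) = rng (a * b) := by
    rw [← assoc _ _ _ (by rw [src_mul _ _ h, rng_inv]) h2, mul_mul_inv_cancel h, self_mul_inv,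
      rng_mul _ _ h]
  have h5 := inv_mul_mul_cancel h3
  rw [h4] at h5
  rw [← h5]
  conv_lhs => rw [← self_mul_src (a * b)⁻¹, src_inv]

end ArrowGroupoid

/-! ### Multiplication and involution on fibres -/

namespace FellBundle

variable {G : Type u} {A : Type v} [TopologicalSpace G] [EtaleGroupoid G] [TopologicalSpace A]
  (B : FellBundle G A)

/-- The fibre over `γ`. -/
abbrev Fib (γ : G) : Type v := Fibre B.proj γ

/-- The multiplication `A_γ × A_η → A_ζ` where `ζ = γ η`. -/
def fibMul {γ η ζ : G} (h : src γ = rng η) (hz : γ * η = ζ) (a : B.Fib γ) (b : B.Fib η) :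
    B.Fib ζ :=
  ⟨B.mul a.pt b.pt, by rw [B.proj_mul, a.2, b.2, hz]; rwa [a.2, b.2]⟩

/-- The involution `A_γ → A_η` where `η = γ⁻¹`. -/
def fibAdj {γ η : G} (h : γ⁻¹ = η) (a : B.Fib γ) : B.Fib η :=
  ⟨B.adj a.pt, by rw [B.proj_adj, a.2, h]⟩

section

variable {γ η ζ : G} (h : src γ = rng η) (hz : γ * η = ζ)

theorem add_fibMul (a a' : B.Fib γ) (b : B.Fib η) :
    B.fibMul h hz (a + a') b = B.fibMul h hz a b + B.fibMul h hz a' b := by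
  subst hz; exact Fibre.ext (B.add_mul h a a' b)

theorem fibMul_add (a : B.Fib γ) (b b' : B.Fib η) :
    B.fibMul h hz a (b + b') = B.fibMul h hz a b + B.fibMul h hz a b' := by
  subst hz; exact Fibre.ext (B.mul_add h a b b')

theorem smul_fibMul (c : ℂ) (a : B.Fib γ) (b : B.Fib η) :
    B.fibMul h hz (c • a) b = c • B.fibMul h hz a b := by
  subst hz; exact Fibre.ext (B.smul_mul h c a b)

theorem fibMul_smul (c : ℂ) (a : B.Fib γ) (b : B.Fib η) :
    B.fibMul h hz a (c • b) = c • B.fibMul h hz a b := by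
  subst hz; exact Fibre.ext (B.mul_smul h c a b)

theorem zero_fibMul (b : B.Fib η) : B.fibMul h hz 0 b = 0 := by
  simpa using B.smul_fibMul h hz 0 0 b

theorem fibMul_zero (a : B.Fib γ) : B.fibMul h hz a 0 = 0 := by
  simpa using B.fibMul_smul h hz 0 a 0

end

section

variable {γ η : G} (h : γ⁻¹ = η)

theorem fibAdj_add (a b : B.Fib γ) : B.fibAdj h (a + b) = B.fibAdj h a + B.fibAdj h b := by
  subst h; exact Fibre.ext (B.adj_add a b)

theorem fibAdj_smul (c : ℂ) (a : B.Fib γ) :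
    B.fibAdj h (c • a) = starRingEnd ℂ c • B.fibAdj h a := by
  subst h; exact Fibre.ext (B.adj_smul c a)

theorem fibAdj_zero : B.fibAdj h 0 = 0 := by
  simpa using B.fibAdj_smul h 0 0

end

/-- The vector space of all (not necessarily continuous) sections of the bundle. -/
abbrev Sec : Type max u v := ∀ γ : G, B.Fib γ

/-- The index set of the convolution sum: the composable pairs with product `γ`. -/
abbrev Pairs (γ : G) : Type u := {q : G × G // src q.1 = rng q.2 ∧ q.1 * q.2 = γ}

/-- The convolution `(f * g)(γ) = ∑_{αβ = γ} f(α) g(β)`. -/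
noncomputable def conv (f g : B.Sec) : B.Sec := fun γ =>
  ∑ᶠ q : Pairs γ, B.fibMul q.2.1 q.2.2 (f q.1.1) (g q.1.2)

/-- The involution `f*(γ) = f(γ⁻¹)*`. -/
def secAdj (f : B.Sec) : B.Sec := fun γ => B.fibAdj (inv_inv_arrow γ) (f γ⁻¹)

/-- `f` is continuous on `V` and vanishes outside a compact subset of `V`. -/
structure IsCompactlySupportedOn (V : Set G) (f : B.Sec) : Prop where
  continuousOn : ContinuousOn (fun γ => (f γ).pt) V
  compact : ∃ K ⊆ V, IsCompact K ∧ ∀ γ ∉ K, f γ = 0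

/-- `C_c(G; A)`, in the sense of Connes: the linear span of the sections that are supported on a
compact subset of some open Hausdorff set `V`, and continuous on `V`. -/
def ccSubmodule : Submodule ℂ B.Sec :=
  Submodule.span ℂ {f | ∃ V : Set G, IsOpen V ∧ T2Space V ∧ B.IsCompactlySupportedOn V f}

end FellBundle
/-! ### `C_c(G; A)` is a `*`-algebra -/

section Topology

variable {G : Type u} [TopologicalSpace G] [EtaleGroupoid G]

theorem continuous_toUnit : Continuous (toUnit : G → unitSpace G) :=
  EtaleGroupoid.isLocalHomeomorph_rng.continuous

theorem locallyCompactSpace_etale : LocallyCompactSpace G := by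
  have := EtaleGroupoid.locallyCompactSpace_units (G := G)
  refine ⟨fun x n hn => ?_⟩
  obtain ⟨e, hx, he⟩ := EtaleGroupoid.isLocalHomeomorph_rng (G := G) x
  have hn2 : e.source ∩ n ∈ 𝓝 x := Filter.inter_mem (e.open_source.mem_nhds hx) hn
  have h2 : e '' (e.source ∩ n) ∈ 𝓝 (e x) := e.image_mem_nhds hx hn2
  obtain ⟨K, hK, hKs, hKc⟩ := local_compact_nhds
    (Filter.inter_mem h2 (e.open_target.mem_nhds (e.map_source hx)))
  refine ⟨e.symm '' K, ?_, ?_, ?_⟩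
  · have := e.symm.image_mem_nhds (e.map_source hx) hK
    rwa [e.left_inv hx] at this
  · rintro _ ⟨y, hy, rfl⟩
    obtain ⟨⟨z, ⟨hz, hzn⟩, rfl⟩, -⟩ := hKs hy
    rwa [e.left_inv hz]
  · exact hKc.image_of_continuousOn
      (e.continuousOn_symm.mono fun y hy => (hKs hy).2)

theorem exists_isBisection {V : Set G} (hV : IsOpen V) {x : G} (hx : x ∈ V) :
    ∃ U, IsBisection U ∧ x ∈ U ∧ U ⊆ V := by
  obtain ⟨e, hxe, he⟩ := EtaleGroupoid.isLocalHomeomorph_rng (G := G) x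
  obtain ⟨d, hxd, hd⟩ := EtaleGroupoid.isLocalHomeomorph_rng (G := G) x⁻¹
  refine ⟨V ∩ e.source ∩ (fun a : G => a⁻¹) ⁻¹' d.source,
    ⟨(hV.inter e.open_source).inter (d.open_source.preimage EtaleGroupoid.continuous_inv), ?_, ?_⟩,
    ⟨⟨hx, hxe⟩, hxd⟩, fun y hy => hy.1.1⟩
  · intro a ha b hb hab
    refine e.injOn ha.1.2 hb.1.2 ?_
    rw [← he]; exact Subtype.ext hab
  · intro a ha b hb hab
    have : a⁻¹ = b⁻¹ := by
      refine d.injOn ha.2 hb.2 ?_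
      rw [← hd]; exact Subtype.ext (by simpa [toUnit, rng_inv] using hab)
    exact (inv_inv_arrow a).symm.trans ((congrArg _ this).trans (inv_inv_arrow b))

theorem t2Space_of_injOn_rng {U : Set G} (h : InjOn (rng : G → G) U) : T2Space U := by
  have := EtaleGroupoid.t2Space_units (G := G)
  refine T2Space.of_injective_continuous (f := fun x : U => toUnit x.1) ?_
    (continuous_toUnit.comp continuous_subtype_val)
  intro a b hab
  exact Subtype.ext (h a.2 b.2 (congrArg Subtype.val hab))

theorem isClosed_composable : IsClosed {q : G × G | src q.1 = rng q.2} := by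
  have := EtaleGroupoid.t2Space_units (G := G)
  have h : {q : G × G | src q.1 = rng q.2} =
      {q : G × G | toUnit q.1⁻¹ = toUnit q.2} := by
    ext q
    simp [toUnit, rng_inv, Subtype.ext_iff]
  rw [h]
  exact isClosed_eq (continuous_toUnit.comp (EtaleGroupoid.continuous_inv.comp continuous_fst))
    (continuous_toUnit.comp continuous_snd)

/-- The inverse of the range map on a bisection is continuous. -/
theorem exists_section {U : Set G} (hU : IsBisection U) :
    ∃ σ : G → G, (∀ γ, (∃ α ∈ U, rng α = rng γ) → σ γ ∈ U ∧ rng (σ γ) = rng γ) ∧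
      IsOpen {γ : G | ∃ α ∈ U, rng α = rng γ} ∧
      ContinuousOn σ {γ : G | ∃ α ∈ U, rng α = rng γ} := by
  classical
  have hemb : IsOpenEmbedding (fun x : U => toUnit x.1) := by
    refine IsOpenEmbedding.of_continuous_injective_isOpenMap
      (continuous_toUnit.comp continuous_subtype_val) ?_ ?_
    · intro a b hab
      exact Subtype.ext (hU.injOn_rng a.2 b.2 (congrArg Subtype.val hab))
    · exact EtaleGroupoid.isLocalHomeomorph_rng.isOpenMap.comp hU.isOpen.isOpenMap_subtype_val
  let e := hemb.isEmbedding.toHomeomorph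
  have hr : ∀ γ : G, (∃ α ∈ U, rng α = rng γ) → toUnit γ ∈ range (fun x : U => toUnit x.1) := by
    rintro γ ⟨α, hα, h⟩
    exact ⟨⟨α, hα⟩, Subtype.ext h⟩
  let σ : G → G := fun γ =>
    if h : ∃ α ∈ U, rng α = rng γ then (e.symm ⟨toUnit γ, hr γ h⟩).1 else γ
  have hσ : ∀ γ (h : ∃ α ∈ U, rng α = rng γ), σ γ = (e.symm ⟨toUnit γ, hr γ h⟩).1 :=
    fun γ h => dif_pos h
  refine ⟨σ, fun γ h => ?_, ?_, ?_⟩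
  · rw [hσ γ h]
    refine ⟨(e.symm _).2, ?_⟩
    have := congrArg (fun z => (z.1 : unitSpace G).1) (e.apply_symm_apply ⟨toUnit γ, hr γ h⟩)
    exact this
  · have : {γ : G | ∃ α ∈ U, rng α = rng γ} =
        toUnit ⁻¹' range (fun x : U => toUnit x.1) := by
      ext γ
      refine ⟨hr γ, ?_⟩
      rintro ⟨α, h⟩
      exact ⟨α.1, α.2, congrArg Subtype.val h⟩
    rw [this]
    exact hemb.isOpen_range.preimage continuous_toUnit
  · rw [continuousOn_iff_continuous_domRestrict]
    have : domRestrict {γ : G | ∃ α ∈ U, rng α = rng γ} σ =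
        fun γ => (e.symm ⟨toUnit γ.1, hr γ.1 γ.2⟩).1 := by
      funext γ
      exact hσ γ.1 γ.2
    rw [this]
    exact continuous_subtype_val.comp (e.symm.continuous.comp
      ((continuous_toUnit.comp continuous_subtype_val).subtype_mk _))

end Topology

namespace FellBundle

variable {G : Type u} {A : Type v} [TopologicalSpace G] [EtaleGroupoid G] [TopologicalSpace A]
  (B : FellBundle G A)

theorem ccSubmodule_eq_span : B.ccSubmodule =
    Submodule.span ℂ {f | ∃ U : Set G, IsBisection U ∧ B.IsCompactlySupportedOn U f} := by
  classical
  apply le_antisymm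
  · refine Submodule.span_le.2 ?_
    rintro f ⟨V, hV, hV2, hfc, K, hKV, hK, hf0⟩
    have := hV2
    have := locallyCompactSpace_etale (G := G)
    have : LocallyCompactSpace V := hV.locallyCompactSpace
    choose! W hW hxW hWV using fun (x : G) (hx : x ∈ V) => exists_isBisection hV hx
    obtain ⟨t, hKt⟩ := hK.elim_nhds_subcover' (fun x hx => W x)
      (fun x hx => (hW x (hKV hx)).isOpen.mem_nhds (hxW x (hKV hx)))
    let n := t.card
    let idx : Fin n → K := fun i => (t.equivFin.symm i).1
    let s : Fin n → Set V := fun i => Subtype.val ⁻¹' W (idx i).1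
    have hKV2 : IsCompact (Subtype.val ⁻¹' K : Set V) := by
      rw [Subtype.isCompact_iff, Subtype.image_preimage_coe, inter_eq_right.2 hKV]
      exact hK
    obtain ⟨φ, hφs, hφ1, -, -⟩ := exists_continuous_sum_one_of_isOpen_isCompact (s := s)
      (fun i => (hW _ (hKV (idx i).2)).isOpen.preimage continuous_subtype_val) hKV2 (by
        intro x hx
        obtain ⟨y, hy, hxy⟩ := mem_iUnion₂.1 (hKt hx)
        refine mem_iUnion.2 ⟨t.equivFin ⟨y, hy⟩, ?_⟩
        simpa [s, idx] using hxy)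
    let ψ : Fin n → G → ℂ := fun i γ => if h : γ ∈ V then ((φ i ⟨γ, h⟩ : ℝ) : ℂ) else 0
    have hψ : ∀ i, ContinuousOn (ψ i) V := by
      intro i
      rw [continuousOn_iff_continuous_domRestrict]
      have : domRestrict V (ψ i) = fun x : V => ((φ i x : ℝ) : ℂ) := by
        funext x; simp [ψ, x.2]
      rw [this]
      exact Complex.continuous_ofReal.comp (φ i).continuous
    have hsum : f = ∑ i, (fun γ => ψ i γ • f γ : B.Sec) := by
      funext γ
      rw [Finset.sum_apply, ← Finset.sum_smul]
      by_cases hγ : γ ∈ K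
      · have h1 := hφ1 (x := ⟨γ, hKV hγ⟩) hγ
        have h2 : ∑ i, ψ i γ = 1 := by
          simp only [ψ, dif_pos (hKV hγ)]
          rw [← Complex.ofReal_sum]
          rw [Finset.sum_apply] at h1
          rw [h1]; simp
        rw [h2, one_smul]
      · rw [hf0 γ hγ, smul_zero]
    rw [hsum]
    refine Submodule.sum_mem _ fun i _ => Submodule.subset_span ?_
    have hi := hKV (idx i).2
    refine ⟨W (idx i).1, hW _ hi, ?_, K ∩ Subtype.val '' tsupport (φ i), ?_, ?_, ?_⟩
    · have := B.continuous_smul.comp_continuousOn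
        (((hψ i).prodMk hfc).mono (hWV _ hi))
      refine this.congr fun γ hγ => ?_
      have : ∀ (c : ℂ) (γ η : G) (a : B.Fib γ) (h : γ = η),
          (c • a).pt = (c • (⟨a.pt, by rw [a.2, h]⟩ : B.Fib η)).pt := by
        intro c γ η a h; subst h; rfl
      exact this _ _ _ _ (f γ).2.symm
    · rintro _ ⟨-, x, hx, rfl⟩
      exact hφs i hx
    · have : K ∩ Subtype.val '' tsupport (φ i) =
          Subtype.val '' (Subtype.val ⁻¹' K ∩ tsupport (φ i)) := by
        rw [image_preimage_inter]
      rw [this]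
      exact (hKV2.inter_right (isClosed_tsupport _)).image continuous_subtype_val
    · intro γ hγ
      by_cases hγK : γ ∈ K
      · have h0 : ψ i γ = 0 := by
          simp only [ψ, dif_pos (hKV hγK)]
          have : (⟨γ, hKV hγK⟩ : V) ∉ tsupport (φ i) := fun h => hγ ⟨hγK, _, h, rfl⟩
          rw [image_eq_zero_of_notMem_tsupport this]; simp
        simp only [h0, zero_smul]
      · simp only [hf0 γ hγK, smul_zero]
  · refine Submodule.span_mono ?_
    rintro f ⟨U, hU, hf⟩
    exact ⟨U, hU.isOpen, t2Space_of_injOn_rng hU.injOn_rng, hf⟩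

variable {B}

theorem rng_pairs {γ : G} (q : Pairs γ) : rng q.1.1 = rng γ :=
  (rng_mul _ _ q.2.1).symm.trans (congrArg rng q.2.2)

theorem src_pairs {γ : G} (q : Pairs γ) : src q.1.2 = src γ :=
  (src_mul _ _ q.2.1).symm.trans (congrArg src q.2.2)

theorem IsCompactlySupportedOn.eq_zero {U : Set G} {f : B.Sec}
    (hf : B.IsCompactlySupportedOn U f) {γ : G} (h : γ ∉ U) : f γ = 0 := by
  obtain ⟨K, hK, -, h0⟩ := hf.compact
  exact h0 γ fun hγ => h (hK hγ)

theorem finite_rng_fibre {f : B.Sec} (hf : f ∈ B.ccSubmodule) (x : G) :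
    {γ | rng γ = x ∧ f γ ≠ 0}.Finite := by
  rw [ccSubmodule_eq_span] at hf
  induction hf using Submodule.span_induction with
  | mem f hf =>
    obtain ⟨U, hU, hf⟩ := hf
    refine Set.Subsingleton.finite fun a ha b hb => hU.injOn_rng ?_ ?_ (ha.1.trans hb.1.symm)
    · by_contra h; exact ha.2 (hf.eq_zero h)
    · by_contra h; exact hb.2 (hf.eq_zero h)
  | zero => simp
  | add f g _ _ hf hg =>
    refine (hf.union hg).subset fun γ hγ => ?_
    by_contra h
    simp only [mem_union, mem_ofPred_eq, not_or, not_and, not_not] at h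
    exact hγ.2 (by rw [Pi.add_apply, h.1 hγ.1, h.2 hγ.1, add_zero])
  | smul c f _ hf =>
    refine hf.subset fun γ hγ => ⟨hγ.1, fun h => hγ.2 ?_⟩
    rw [Pi.smul_apply, h, smul_zero]

theorem finite_pairs {f : B.Sec} (hf : f ∈ B.ccSubmodule) (g : B.Sec) (γ : G) :
    (Function.support fun q : Pairs γ =>
      B.fibMul q.2.1 q.2.2 (f q.1.1) (g q.1.2)).Finite := by
  refine Set.Finite.of_finite_image (f := fun q : Pairs γ => q.1.1)
    ((finite_rng_fibre hf (rng γ)).subset ?_) ?_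
  · rintro _ ⟨q, hq, rfl⟩
    refine ⟨?_, fun h => hq ?_⟩
    · exact rng_pairs q
    · simp only [h, zero_fibMul]
  · intro q _ q' _ h
    have h : q.1.1 = q'.1.1 := h
    refine Subtype.ext (Prod.ext h ?_)
    rw [← inv_mul_mul_cancel q.2.1, ← inv_mul_mul_cancel q'.2.1, q.2.2, q'.2.2, h]

theorem add_conv {f f' : B.Sec} (hf : f ∈ B.ccSubmodule) (hf' : f' ∈ B.ccSubmodule)
    (g : B.Sec) : B.conv (f + f') g = B.conv f g + B.conv f' g := by
  funext γ
  simp only [conv, Pi.add_apply, add_fibMul]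
  exact finsum_add_distrib (finite_pairs hf g γ) (finite_pairs hf' g γ)

theorem conv_add {f : B.Sec} (hf : f ∈ B.ccSubmodule) (g g' : B.Sec) :
    B.conv f (g + g') = B.conv f g + B.conv f g' := by
  funext γ
  simp only [conv, Pi.add_apply, fibMul_add]
  exact finsum_add_distrib (finite_pairs hf g γ) (finite_pairs hf g' γ)

theorem smul_conv (c : ℂ) (f g : B.Sec) : B.conv (c • f) g = c • B.conv f g := by
  funext γ
  simp only [conv, Pi.smul_apply, smul_fibMul]
  exact (smul_finsum c _).symm

theorem conv_smul (c : ℂ) (f g : B.Sec) : B.conv f (c • g) = c • B.conv f g := by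
  funext γ
  simp only [conv, Pi.smul_apply, fibMul_smul]
  exact (smul_finsum c _).symm

theorem zero_conv (g : B.Sec) : B.conv 0 g = 0 := by
  simpa using smul_conv (B := B) 0 0 g

theorem conv_zero (f : B.Sec) : B.conv f 0 = 0 := by
  simpa using conv_smul (B := B) 0 f 0

theorem secAdj_add (f g : B.Sec) : B.secAdj (f + g) = B.secAdj f + B.secAdj g :=
  funext fun _ => B.fibAdj_add _ _ _

theorem secAdj_smul (c : ℂ) (f : B.Sec) :
    B.secAdj (c • f) = starRingEnd ℂ c • B.secAdj f :=
  funext fun _ => B.fibAdj_smul _ _ _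

theorem secAdj_secAdj (f : B.Sec) : B.secAdj (B.secAdj f) = f := by
  funext γ
  refine Fibre.ext ?_
  change B.adj (B.adj (f γ⁻¹⁻¹).pt) = _
  rw [B.adj_adj, inv_inv_arrow]

/-- The convolution has at most one term if the left factor is supported on a bisection. -/
theorem conv_eq_left {U : Set G} (hU : InjOn (rng : G → G) U) {f : B.Sec}
    (hf : ∀ γ ∉ U, f γ = 0) (g : B.Sec) {α γ : G} (hα : α ∈ U) (h : rng α = rng γ) :
    (B.conv f g γ).pt = B.mul (f α).pt (g (α⁻¹ * γ)).pt := by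
  have hc : src α = rng (α⁻¹ * γ) := by rw [rng_mul _ _ (by rw [src_inv, h]), rng_inv]
  rw [conv, finsum_eq_single _ (⟨(α, α⁻¹ * γ), hc, mul_inv_mul_cancel h⟩ : Pairs γ)]
  · rfl
  · intro q hq
    have : f q.1.1 = 0 := by
      refine hf _ fun hqU => hq ?_
      have h1 : q.1.1 = α := hU hqU hα ((rng_pairs q).trans h.symm)
      refine Subtype.ext (Prod.ext h1 ?_)
      rw [← inv_mul_mul_cancel q.2.1, q.2.2, h1]
    rw [this, zero_fibMul]

theorem conv_eq_zero_left {U : Set G} {f : B.Sec} (hf : ∀ γ ∉ U, f γ = 0) (g : B.Sec) {γ : G}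
    (h : ¬ ∃ α ∈ U, rng α = rng γ) : B.conv f g γ = 0 := by
  refine finsum_eq_zero_of_forall_eq_zero fun q => ?_
  rw [hf q.1.1 fun hq => h ⟨_, hq, rng_pairs q⟩, zero_fibMul]

theorem conv_eq_right {U : Set G} (hU : InjOn (src : G → G) U) (f : B.Sec) {g : B.Sec}
    (hg : ∀ γ ∉ U, g γ = 0) {β γ : G} (hβ : β ∈ U) (h : src β = src γ) :
    (B.conv f g γ).pt = B.mul (f (γ * β⁻¹)).pt (g β).pt := by
  have hc : src (γ * β⁻¹) = rng β := by rw [src_mul _ _ (by rw [rng_inv, h]), src_inv]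
  rw [conv, finsum_eq_single _
    (⟨(γ * β⁻¹, β), hc, mul_inv_cancel_mul h.symm⟩ : Pairs γ)]
  · rfl
  · intro q hq
    have : g q.1.2 = 0 := by
      refine hg _ fun hqU => hq ?_
      have h1 : q.1.2 = β := hU hqU hβ ((src_pairs q).trans h.symm)
      refine Subtype.ext (Prod.ext ?_ h1)
      rw [← mul_mul_inv_cancel q.2.1, q.2.2, h1]
    rw [this, fibMul_zero]

theorem conv_eq_zero_right {U : Set G} (f : B.Sec) {g : B.Sec} (hg : ∀ γ ∉ U, g γ = 0) {γ : G}
    (h : ¬ ∃ β ∈ U, src β = src γ) : B.conv f g γ = 0 := by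
  refine finsum_eq_zero_of_forall_eq_zero fun q => ?_
  rw [hg q.1.2 fun hq => h ⟨_, hq, src_pairs q⟩, fibMul_zero]

theorem zero_mul_pt {γ η : G} (h : src γ = rng η) (b : B.Fib η) :
    B.mul (0 : B.Fib γ).pt b.pt = (0 : B.Fib (γ * η)).pt :=
  congrArg Fibre.pt (B.zero_fibMul h rfl b)

theorem mul_zero_pt {γ η : G} (h : src γ = rng η) (a : B.Fib γ) :
    B.mul a.pt (0 : B.Fib η).pt = (0 : B.Fib (γ * η)).pt :=
  congrArg Fibre.pt (B.fibMul_zero h rfl a)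

theorem conv_assoc_bisection {U W : Set G} (hU : InjOn (rng : G → G) U)
    (hW : InjOn (src : G → G) W) {f h : B.Sec} (hf : ∀ γ ∉ U, f γ = 0)
    (hh : ∀ γ ∉ W, h γ = 0) (g : B.Sec) :
    B.conv (B.conv f g) h = B.conv f (B.conv g h) := by
  funext γ
  refine Fibre.ext ?_
  by_cases h1 : ∃ α ∈ U, rng α = rng γ
  · obtain ⟨α, hα, hαγ⟩ := h1
    have c1 : src α⁻¹ = rng γ := by rw [src_inv, hαγ]
    have c2 : src α = rng (α⁻¹ * γ) := by rw [rng_mul _ _ c1, rng_inv]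
    rw [conv_eq_left hU hf _ hα hαγ]
    by_cases h2 : ∃ β ∈ W, src β = src γ
    · obtain ⟨β, hβ, hβγ⟩ := h2
      have c3 : src γ = rng β⁻¹ := by rw [rng_inv, hβγ]
      have c4 : src (γ * β⁻¹) = rng β := by rw [src_mul _ _ c3, src_inv]
      have c5 : rng α = rng (γ * β⁻¹) := by rw [rng_mul _ _ c3, hαγ]
      have c6 : src β = src (α⁻¹ * γ) := by rw [src_mul _ _ c1, hβγ]
      rw [conv_eq_right hW _ hh hβ hβγ, conv_eq_left hU hf _ hα c5,
        conv_eq_right hW _ hh hβ c6, assoc _ _ _ c1 c3]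
      refine B.mul_assoc _ _ _ ?_ ?_
      · rw [(f α).2, (g _).2, rng_mul _ _ (by rw [src_inv, c5]), rng_inv]
      · rw [(g _).2, (h β).2, src_mul _ _ (by rw [src_inv, c5]), c4]
    · have h3 : ¬ ∃ β ∈ W, src β = src (α⁻¹ * γ) := by rwa [src_mul _ _ c1]
      rw [conv_eq_zero_right _ hh h2, conv_eq_zero_right _ hh h3, mul_zero_pt c2,
        mul_inv_mul_cancel hαγ]
  · rw [conv_eq_zero_left hf _ h1]
    by_cases h2 : ∃ β ∈ W, src β = src γ
    · obtain ⟨β, hβ, hβγ⟩ := h2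
      have c3 : src γ = rng β⁻¹ := by rw [rng_inv, hβγ]
      have h3 : ¬ ∃ α ∈ U, rng α = rng (γ * β⁻¹) := by rwa [rng_mul _ _ c3]
      rw [conv_eq_right hW _ hh hβ hβγ, conv_eq_zero_left hf _ h3,
        zero_mul_pt (by rw [src_mul _ _ c3, src_inv]), mul_inv_cancel_mul hβγ.symm]
    · rw [conv_eq_zero_right _ hh h2]

theorem secAdj_conv_bisection {U : Set G} (hU : InjOn (rng : G → G) U) {f : B.Sec}
    (hf : ∀ γ ∉ U, f γ = 0) (g : B.Sec) :
    B.secAdj (B.conv f g) = B.conv (B.secAdj g) (B.secAdj f) := by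
  have hU2 : InjOn (src : G → G) ((fun a : G => a⁻¹) ⁻¹' U) := by
    intro a ha b hb hab
    have := hU ha hb (by rw [rng_inv, rng_inv, hab])
    exact (inv_inv_arrow a).symm.trans ((congrArg _ this).trans (inv_inv_arrow b))
  have hf2 : ∀ γ ∉ (fun a : G => a⁻¹) ⁻¹' U, B.secAdj f γ = 0 := by
    intro γ hγ
    rw [secAdj, hf _ hγ, fibAdj_zero]
  funext γ
  by_cases h1 : ∃ α ∈ U, rng α = rng γ⁻¹
  · obtain ⟨α, hα, hαγ⟩ := h1
    refine Fibre.ext ?_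
    have c0 : src α⁻¹ = rng γ⁻¹ := by rw [src_inv, hαγ]
    have c1 : src α⁻¹ = src γ := by rw [c0, rng_inv]
    have hα2 : α⁻¹ ∈ (fun a : G => a⁻¹) ⁻¹' U := by
      rw [mem_preimage, inv_inv_arrow]; exact hα
    rw [conv_eq_right hU2 _ hf2 hα2 c1]
    change B.adj (B.conv f g γ⁻¹).pt = B.mul (B.adj (g _).pt) (B.adj (f α⁻¹⁻¹).pt)
    rw [conv_eq_left hU hf _ hα hαγ, B.adj_mul]
    · rw [mul_inv_rev_arrow (by rw [rng_inv, c1]), inv_inv_arrow α]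
    · rw [(f α).2, (g _).2, rng_mul _ _ c0, rng_inv]
  · have h2 : ¬ ∃ β ∈ (fun a : G => a⁻¹) ⁻¹' U, src β = src γ := by
      rintro ⟨β, hβ, hβγ⟩
      exact h1 ⟨β⁻¹, hβ, by rw [rng_inv, rng_inv, hβγ]⟩
    rw [conv_eq_zero_right _ hf2 h2, secAdj, conv_eq_zero_left hf _ h1, fibAdj_zero]

theorem conv_isCompactlySupportedOn {U V : Set G} (hU : IsBisection U) (hV : IsBisection V)
    {f g : B.Sec} (hf : B.IsCompactlySupportedOn U f) (hg : B.IsCompactlySupportedOn V g) :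
    ∃ W : Set G, IsOpen W ∧ T2Space W ∧ B.IsCompactlySupportedOn W (B.conv f g) := by
  obtain ⟨σ, hσ, hopen, hcont⟩ := exists_section hU
  set D : Set G := {γ : G | ∃ α ∈ U, rng α = rng γ} with hD
  have hΦ : ContinuousOn (fun γ => (σ γ)⁻¹ * γ) D := by
    refine EtaleGroupoid.continuousOn_mul.comp
      ((EtaleGroupoid.continuous_inv.comp_continuousOn hcont).prodMk continuousOn_id) ?_
    intro γ hγ
    exact (src_inv _).trans (hσ γ hγ).2
  let W : Set G := D ∩ (fun γ => (σ γ)⁻¹ * γ) ⁻¹' V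
  have hWopen : IsOpen W := hΦ.isOpen_inter_preimage hopen hV.isOpen
  have hWinj : InjOn (rng : G → G) W := by
    intro a ha b hb hab
    have h1 : σ a = σ b := hU.injOn_rng (hσ a ha.1).1 (hσ b hb.1).1
      (by rw [(hσ a ha.1).2, (hσ b hb.1).2, hab])
    have h2 : (σ a)⁻¹ * a = (σ b)⁻¹ * b := by
      refine hV.injOn_rng ha.2 hb.2 ?_
      rw [rng_mul _ _ (by rw [src_inv, (hσ a ha.1).2]),
        rng_mul _ _ (by rw [src_inv, (hσ b hb.1).2]), h1]
    rw [← mul_inv_mul_cancel (hσ a ha.1).2, h2, h1, mul_inv_mul_cancel (hσ b hb.1).2]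
  have hf0 : ∀ γ ∉ U, f γ = 0 := fun γ hγ => hf.eq_zero hγ
  have hval : ∀ γ ∈ D, (B.conv f g γ).pt = B.mul (f (σ γ)).pt (g ((σ γ)⁻¹ * γ)).pt :=
    fun γ hγ => conv_eq_left hU.injOn_rng hf0 g (hσ γ hγ).1 (hσ γ hγ).2
  refine ⟨W, hWopen, t2Space_of_injOn_rng hWinj, ?_, ?_⟩
  · have h1 : ContinuousOn (fun γ => (f (σ γ)).pt) W :=
      hf.continuousOn.comp (hcont.mono inter_subset_left) fun γ hγ => (hσ γ hγ.1).1
    have h2 : ContinuousOn (fun γ => (g ((σ γ)⁻¹ * γ)).pt) W :=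
      hg.continuousOn.comp (hΦ.mono inter_subset_left) fun γ hγ => hγ.2
    refine (B.continuousOn_mul.comp (h1.prodMk h2) ?_).congr fun γ hγ => hval γ hγ.1
    intro γ hγ
    have h3 := (hσ γ hγ.1).2
    simp only [mem_ofPred_eq, (f _).2, (g _).2]
    rw [rng_mul _ _ (by rw [src_inv, h3]), rng_inv]
  · obtain ⟨K, hKU, hK, hfK⟩ := hf.compact
    obtain ⟨L, hLV, hL, hgL⟩ := hg.compact
    refine ⟨(fun q : G × G => q.1 * q.2) '' (K ×ˢ L ∩ {q : G × G | src q.1 = rng q.2}),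
      ?_, ?_, ?_⟩
    · rintro _ ⟨⟨a, b⟩, ⟨⟨ha, hb⟩, hab⟩, rfl⟩
      have ha : a ∈ K := ha
      have hb : b ∈ L := hb
      have hab : src a = rng b := hab
      have hmem : a * b ∈ D := ⟨a, hKU ha, (rng_mul _ _ hab).symm⟩
      have hσab : σ (a * b) = a :=
        hU.injOn_rng (hσ _ hmem).1 (hKU ha) (by rw [(hσ _ hmem).2, rng_mul _ _ hab])
      refine ⟨hmem, ?_⟩
      change (σ (a * b))⁻¹ * (a * b) ∈ V
      rw [hσab, inv_mul_mul_cancel hab]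
      exact hLV hb
    · exact ((hK.prod hL).inter_right isClosed_composable).image_of_continuousOn
        (EtaleGroupoid.continuousOn_mul.mono inter_subset_right)
    · intro γ hγ
      refine finsum_eq_zero_of_forall_eq_zero fun q => ?_
      by_cases h1 : q.1.1 ∈ K
      · by_cases h2 : q.1.2 ∈ L
        · exact (hγ ⟨q.1, ⟨⟨h1, h2⟩, q.2.1⟩, q.2.2⟩).elim
        · rw [hgL _ h2, fibMul_zero]
      · rw [hfK _ h1, zero_fibMul]

theorem conv_mem {f g : B.Sec} (hf : f ∈ B.ccSubmodule) (hg : g ∈ B.ccSubmodule) :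
    B.conv f g ∈ B.ccSubmodule := by
  have hf' := hf
  rw [ccSubmodule_eq_span] at hf
  induction hf using Submodule.span_induction with
  | mem f hf =>
    obtain ⟨U, hU, hf⟩ := hf
    rw [ccSubmodule_eq_span] at hg
    induction hg using Submodule.span_induction with
    | mem g hg =>
      obtain ⟨V, hV, hg⟩ := hg
      exact Submodule.subset_span (conv_isCompactlySupportedOn hU hV hf hg)
    | zero => rw [conv_zero]; exact zero_mem _
    | add g g' _ _ h1 h2 => rw [conv_add hf']; exact add_mem h1 h2
    | smul c g _ h1 => rw [conv_smul]; exact Submodule.smul_mem _ _ h1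
  | zero => rw [zero_conv]; exact zero_mem _
  | add f f' h h' h1 h2 =>
    rw [← ccSubmodule_eq_span] at h h'
    rw [add_conv h h']; exact add_mem (h1 h) (h2 h')
  | smul c f h h1 =>
    rw [← ccSubmodule_eq_span] at h
    rw [smul_conv]; exact Submodule.smul_mem _ _ (h1 h)

theorem secAdj_mem {f : B.Sec} (hf : f ∈ B.ccSubmodule) : B.secAdj f ∈ B.ccSubmodule := by
  rw [ccSubmodule_eq_span] at hf
  induction hf using Submodule.span_induction with
  | mem f hf =>
    obtain ⟨U, hU, hf⟩ := hf
    have hinj : InjOn (rng : G → G) ((fun a : G => a⁻¹) ⁻¹' U) := by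
      intro a ha b hb hab
      have := hU.injOn_src ha hb (by rw [src_inv, src_inv, hab])
      exact (inv_inv_arrow a).symm.trans ((congrArg _ this).trans (inv_inv_arrow b))
    refine Submodule.subset_span ⟨(fun a : G => a⁻¹) ⁻¹' U, hU.isOpen.preimage EtaleGroupoid.continuous_inv,
      t2Space_of_injOn_rng hinj, ?_, ?_⟩
    · exact B.continuous_adj.comp_continuousOn
        (hf.continuousOn.comp EtaleGroupoid.continuous_inv.continuousOn fun γ hγ => hγ)
    · obtain ⟨K, hKU, hK, hfK⟩ := hf.compact
      refine ⟨(fun a : G => a⁻¹) '' K, ?_, hK.image EtaleGroupoid.continuous_inv, ?_⟩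
      · rintro _ ⟨a, ha, rfl⟩
        change a⁻¹⁻¹ ∈ U
        rw [inv_inv_arrow]; exact hKU ha
      · intro γ hγ
        rw [secAdj, hfK _ fun h => hγ ⟨γ⁻¹, h, inv_inv_arrow γ⟩, fibAdj_zero]
  | zero =>
    have : B.secAdj 0 = 0 := by simpa using secAdj_smul (B := B) 0 0
    rw [this]; exact zero_mem _
  | add f g _ _ h1 h2 => rw [secAdj_add]; exact add_mem h1 h2
  | smul c f _ h1 => rw [secAdj_smul]; exact Submodule.smul_mem _ _ h1

theorem conv_assoc {f g h : B.Sec} (hf : f ∈ B.ccSubmodule) (hg : g ∈ B.ccSubmodule)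
    (hh : h ∈ B.ccSubmodule) : B.conv (B.conv f g) h = B.conv f (B.conv g h) := by
  have hh' := hh
  have hf' := hf
  rw [ccSubmodule_eq_span] at hf
  induction hf using Submodule.span_induction with
  | mem f hf =>
    obtain ⟨U, hU, hf⟩ := hf
    rw [ccSubmodule_eq_span] at hh
    induction hh using Submodule.span_induction with
    | mem h hh =>
      obtain ⟨W, hW, hh⟩ := hh
      exact conv_assoc_bisection hU.injOn_rng hW.injOn_src (fun γ hγ => hf.eq_zero hγ)
        (fun γ hγ => hh.eq_zero hγ) g
    | zero => simp only [conv_zero]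
    | add h k h1 k1 h2 k2 =>
      rw [← ccSubmodule_eq_span] at h1 k1
      rw [conv_add (conv_mem hf' hg), conv_add hg, conv_add hf', h2 h1, k2 k1]
    | smul c h h1 h2 =>
      rw [← ccSubmodule_eq_span] at h1
      rw [conv_smul, conv_smul, conv_smul, h2 h1]
  | zero => simp only [zero_conv]
  | add f k h1 k1 h2 k2 =>
    rw [← ccSubmodule_eq_span] at h1 k1
    rw [add_conv h1 k1, add_conv (conv_mem h1 hg) (conv_mem k1 hg), add_conv h1 k1, h2 h1, k2 k1]
  | smul c f h1 h2 =>
    rw [← ccSubmodule_eq_span] at h1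
    rw [smul_conv, smul_conv, smul_conv, h2 h1]

theorem secAdj_conv {f g : B.Sec} (hf : f ∈ B.ccSubmodule) (hg : g ∈ B.ccSubmodule) :
    B.secAdj (B.conv f g) = B.conv (B.secAdj g) (B.secAdj f) := by
  rw [ccSubmodule_eq_span] at hf
  induction hf using Submodule.span_induction with
  | mem f hf =>
    obtain ⟨U, hU, hf⟩ := hf
    exact secAdj_conv_bisection hU.injOn_rng (fun γ hγ => hf.eq_zero hγ) g
  | zero =>
    have : B.secAdj 0 = 0 := by simpa using secAdj_smul (B := B) 0 0
    rw [zero_conv, this, conv_zero]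
  | add f k h1 k1 h2 k2 =>
    rw [← ccSubmodule_eq_span] at h1 k1
    rw [add_conv h1 k1, secAdj_add, secAdj_add, conv_add (secAdj_mem hg), h2, k2]
  | smul c f h1 h2 => rw [smul_conv, secAdj_smul, secAdj_smul, conv_smul, h2]

end FellBundle
namespace FellBundle

variable {G : Type u} {A : Type v} [TopologicalSpace G] [EtaleGroupoid G] [TopologicalSpace A]
  (B : FellBundle G A)

/-- `C_c(G; A)` as a type of its own. -/
def Cc : Type max u v := B.ccSubmodule

namespace Cc

variable {B}

noncomputable instance : AddCommGroup B.Cc := inferInstanceAs (AddCommGroup B.ccSubmodule)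

noncomputable instance : Module ℂ B.Cc := inferInstanceAs (Module ℂ B.ccSubmodule)

instance : CoeFun B.Cc (fun _ => B.Sec) := ⟨fun f => Subtype.val f⟩

noncomputable instance : Mul B.Cc := ⟨fun f g => ⟨B.conv f g, conv_mem f.2 g.2⟩⟩

noncomputable instance : NonUnitalRing B.Cc where
  left_distrib f g h := Subtype.ext (conv_add f.2 g.1 h.1)
  right_distrib f g h := Subtype.ext (add_conv f.2 g.2 h.1)
  zero_mul f := Subtype.ext (zero_conv f.1)
  mul_zero f := Subtype.ext (conv_zero f.1)
  mul_assoc f g h := Subtype.ext (conv_assoc f.2 g.2 h.2)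

noncomputable instance : StarRing B.Cc where
  star f := ⟨B.secAdj f, secAdj_mem f.2⟩
  star_involutive f := Subtype.ext (secAdj_secAdj f.1)
  star_mul f g := Subtype.ext (secAdj_conv f.2 g.2)
  star_add f g := Subtype.ext (secAdj_add f.1 g.1)

instance : IsScalarTower ℂ B.Cc B.Cc := ⟨fun c f g => Subtype.ext (smul_conv c f.1 g.1)⟩

instance : SMulCommClass ℂ B.Cc B.Cc := ⟨fun c f g => Subtype.ext (conv_smul c f.1 g.1).symm⟩

instance : StarModule ℂ B.Cc := ⟨fun c f => Subtype.ext (secAdj_smul c f.1)⟩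

end Cc

/-- The `I`-norm `max (sup_x ∑_{r(γ) = x} ‖f(γ)‖) (sup_x ∑_{s(γ) = x} ‖f(γ)‖)`. -/
noncomputable def iNorm (f : B.Cc) : ℝ≥0∞ :=
  max (⨆ x : unitSpace G, ∑' γ : {γ : G // rng γ = x}, ‖f γ‖ₑ)
    (⨆ x : unitSpace G, ∑' γ : {γ : G // src γ = x}, ‖f γ‖ₑ)

/-! ### Inductive limit topologies -/

/-- The members of `C_c(G; A)` that are continuous on `U` and vanish outside `K`. -/
def sectionsIn (U K : Set G) : Set B.Cc :=
  {f | ContinuousOn (fun γ => (f γ).pt) U ∧ ∀ γ ∉ K, f γ = 0}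

/-- The finest locally convex vector space topology on `C_c(G; A)` for which the inclusion of each
of the subspaces in the family `F`, with its supremum norm, is continuous (it is
enough to say this at zero, by linearity). -/
abbrev inductiveLimit (F : Set (Set B.Cc)) : TopologicalSpace B.Cc :=
  sInf {t | @IsTopologicalAddGroup B.Cc t _ ∧ @ContinuousSMul ℂ B.Cc _ _ t ∧
    @LocallyConvexSpace ℝ B.Cc _ _ _ _ t ∧
    ∀ P ∈ F, ∀ W ∈ @nhds B.Cc t 0, ∃ ε > (0 : ℝ), ∀ f ∈ P, (∀ γ, ‖f γ‖ ≤ ε) → f ∈ W}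

/-- The inductive limit topology of `C_c(G; A)`: the inductive limit of the spaces of continuous
sections on bisections `U` that vanish outside a compact set `K ⊆ U`. -/
abbrev ilt : TopologicalSpace B.Cc :=
  B.inductiveLimit {P | ∃ U K : Set G, IsBisection U ∧ IsCompact K ∧ K ⊆ U ∧ P = B.sectionsIn U K}

/-! ### Representations and pre-representations -/

/-- A map into the bounded operators on `H` is nondegenerate if the vectors `π(f) ξ` span a dense
subspace of `H`. -/
def IsNondegenerate {H : Type w} [NormedAddCommGroup H] [InnerProductSpace ℂ H]
    (π : B.Cc → H →L[ℂ] H) : Prop :=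
  Dense (Submodule.span ℂ {v : H | ∃ f ξ, v = π f ξ} : Set H)

/-- A representation of `C_c(G; A)`: a nondegenerate `*`-homomorphism into the bounded operators on
a Hilbert space, without any continuity condition. -/
structure Rep where
  /-- the Hilbert space -/
  H : Type max u v
  [normedAddCommGroup : NormedAddCommGroup H]
  [innerProductSpace : InnerProductSpace ℂ H]
  [completeSpace : CompleteSpace H]
  /-- the `*`-homomorphism -/
  π : B.Cc →⋆ₙₐ[ℂ] (H →L[ℂ] H)
  nondegenerate : B.IsNondegenerate π

attribute [instance] Rep.normedAddCommGroup Rep.innerProductSpace Rep.completeSpace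

/-- A pre-representation of `C_c(G; A)` on the Hilbert space `H`, continuity being understood with
respect to the topology `τ` on `C_c(G; A)`. -/
structure PreRep (τ : TopologicalSpace B.Cc) (H : Type w) [NormedAddCommGroup H]
    [InnerProductSpace ℂ H] where
  /-- the representation subspace -/
  H₀ : Submodule ℂ H
  /-- the action of `C_c(G; A)` on it -/
  L : B.Cc →ₙₐ[ℂ] Module.End ℂ H₀
  continuous_inner : ∀ ξ η : H₀, @Continuous B.Cc ℂ τ _ fun f => inner ℂ (η : H) (L f ξ : H)
  adjointable : ∀ (f : B.Cc) (ξ η : H₀),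
    inner ℂ (η : H) (L f ξ : H) = inner ℂ (L (star f) η : H) (ξ : H)
  nondegenerate : Dense (Submodule.span ℂ {v : H | ∃ f ξ, v = L f ξ} : Set H)

/-- The `*`-homomorphism `M` is induced by the pre-representation `P`, that is, it extends it. -/
def PreRep.Induces {B : FellBundle G A} {τ : TopologicalSpace B.Cc} {H : Type w}
    [NormedAddCommGroup H] [InnerProductSpace ℂ H] [CompleteSpace H] (P : B.PreRep τ H)
    (M : B.Cc →⋆ₙₐ[ℂ] (H →L[ℂ] H)) : Prop :=
  ∀ (h : B.Cc) (ξ : P.H₀), M h (ξ : H) = (P.L h ξ : H)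

/-- The collection of the `I`-norm bounded representations. -/
def repsINormBounded : Set B.Rep := {ρ | ∀ f, ‖ρ.π f‖ₑ ≤ B.iNorm f}

/-- The collection of the representations that are continuous for the topology `τ` and the norm
topology. -/
def repsContinuous (τ : TopologicalSpace B.Cc) : Set B.Rep :=
  {ρ | @Continuous B.Cc (ρ.H →L[ℂ] ρ.H) τ _ ρ.π}

/-- The collection of the representations that are induced from pre-representations. -/
def repsInduced (τ : TopologicalSpace B.Cc) : Set B.Rep :=
  {ρ | ∃ P : B.PreRep τ ρ.H, P.Induces ρ.π}

/-- The supremum of `‖ρ(f)‖` over the representations `ρ` in a collection `S`. -/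
noncomputable def supNorm (S : Set B.Rep) (f : B.Cc) : ℝ≥0∞ := ⨆ ρ ∈ S, ‖ρ.π f‖ₑ

/-! ### C*-norms and completions -/

/-- `N` is a C*-norm on the `*`-algebra `C_c(G; A)`. -/
structure IsCStarNorm (N : B.Cc → ℝ) : Prop where
  eq_zero_iff : ∀ f, N f = 0 ↔ f = 0
  add_le : ∀ f g, N (f + g) ≤ N f + N g
  smul : ∀ (c : ℂ) f, N (c • f) = ‖c‖ * N f
  mul_le : ∀ f g, N (f * g) ≤ N f * N g
  star_mul_self : ∀ f, N (star f * f) = N f ^ 2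

/-- The C*-algebra `C` is, by means of `ι`, a completion of `C_c(G; A)` in the norm `N`. -/
structure IsCompletion (N : B.Cc → ℝ) {C : Type w} [NonUnitalCStarAlgebra C]
    (ι : B.Cc →⋆ₙₐ[ℂ] C) : Prop where
  norm_map : ∀ f, ‖ι f‖ = N f
  dense : DenseRange ι

/-- The full norm: the supremum over all representations. -/
noncomputable def fullNorm (f : B.Cc) : ℝ := (B.supNorm univ f).toReal

/-! ### The construction of Muhly and Williams, for saturated bundles over Hausdorff groupoids -/

/-- The bundle is saturated: the span of the products `a b`, with `a` over `γ` and `b` over `η`, is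
dense in the fibre over `γ η`. -/
def IsSaturated : Prop :=
  ∀ γ η : G, src γ = rng η →
    Dense (Submodule.span ℂ {c : B.Fib (γ * η) | ∃ (a : B.Fib γ) (b : B.Fib η),
      c.pt = B.mul a.pt b.pt} : Set (B.Fib (γ * η)))

/-- The continuous sections with compact support. -/
def continuousSections : Set B.Sec := {f | B.IsCompactlySupportedOn univ f}

/-- The inductive limit of the spaces of continuous sections on all of `G` that vanish
outside a compact set. -/
abbrev mwIlt : TopologicalSpace B.Cc :=
  B.inductiveLimit {P | ∃ K : Set G, IsCompact K ∧ P = B.sectionsIn univ K}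

/-- The norm by which the full C*-algebra of a saturated Fell bundle over a Hausdorff groupoid is
classically defined: the supremum over the representations that are continuous in the inductive
limit topology. -/
noncomputable def mwNorm (f : B.Cc) : ℝ := (B.supNorm (B.repsContinuous B.mwIlt) f).toReal

end FellBundle

end EtaleFell

/-!
# The full C*-algebra of a Fell bundle over an étale groupoid

The point of the proof is that every representation is automatically well behaved, so that all the
suprema in question run over the same collection.

*Sections over units are a C*-algebra.* For an open set `V` of units and a compact `K ⊆ V` the
continuous sections on `V` that vanish outside `K` form a C*-algebra with pointwise operations and
the supremum norm (`unitSections`). A `*`-homomorphism between C*-algebras is contractive, and if `f`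
is supported on a bisection, then `f* f` is supported on the units and has supremum norm `‖f‖²`. Hence
every `*`-homomorphism from `C_c(G; A)` to a C*-algebra is contractive on sections supported on
bisections (`norm_map_le`), and so continuous in the inductive limit topology (`continuous_ilt`).

*Pre-representations.* Here the operators are not known to be bounded. With `h = f* f` and
`d n = ⟨ξ, L(h ^ 2 ^ n) ξ⟩`, the Cauchy–Schwarz inequality gives `d n ^ 2 ≤ ‖ξ‖² d (n + 1)`, while
continuity in the inductive limit topology gives `d n ≤ C ‖h‖ ^ 2 ^ n`; taking roots,
`‖L(f) ξ‖ ≤ ‖f‖ ‖ξ‖` for `f` supported on a bisection (`norm_preRep_le`). The operators therefore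
extend to the Hilbert space (`exists_starHom_extension`).

*The `I`-norm.* Write `f = ∑ g_p` with `g_p` supported on bisections, and let `v_p`, `w_p` be
continuous functions on the units with `‖g_p(γ)‖ ≤ v_p(r(γ))` and `‖g_p(γ)‖ ≤ w_p(s(γ))`. If `∑ v_p ≤ c`
and `∑ w_p ≤ c`, the Schur test gives `‖π(f)‖ ≤ c` (`norm_map_le_of_schur`). The norm of an
upper semicontinuous bundle over a non-Hausdorff space does not supply such functions directly:
arrows in different bisections may fail to be separated. They are found locally, where the sections
that carry `f` near a unit are grouped by the arrow through which their bisections pass over it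
(`BanachBundle.exists_local_weights`), and put together by partitions of unity on the Hausdorff space
of units (`exists_majorants`). This yields `enorm_map_le_iNorm`.

*Faithfulness.* A positive functional on the C*-algebra of a unit fibre, composed with evaluation at
the unit, is a state of `C_c(G; A)`, because `(g* g)(x)` is a sum of positive elements. The GNS
construction, whose operators are bounded by the argument on pre-representations, gives enough
representations to separate points (`exists_rep_ne_zero`). The full norm is the norm in the direct sum
of a small family of representations (`universalHom`), and the closure of its range is a completion.

*Continuous sections on a compact set.* A compact set is covered by finitely many, say `n`, bisections,
so the `I`-norm of a section that vanishes outside it is at most `n` times its supremum norm.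
Every representation is thus also continuous in the topology of Muhly and Williams
(`repsContinuous_mwIlt_eq_univ`). The two completions are completions in the same norm.
-/

namespace EtaleFell

open ArrowGroupoid

/-! ### Continuous sections of Banach bundles -/

namespace BanachBundle

variable {X : Type u} {A : Type v} [TopologicalSpace X] [TopologicalSpace A] (B : BanachBundle X A)

/-- The norm of a point of the total space, taken in its fibre. -/
noncomputable def ptNorm (a : A) : ℝ := ‖(⟨a, rfl⟩ : Fibre B.proj (B.proj a))‖

@[simp] theorem ptNorm_pt {x : X} (a : Fibre B.proj x) : B.ptNorm a.pt = ‖a‖ := by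
  obtain ⟨a, rfl⟩ := a; rfl

theorem upperSemicontinuous_ptNorm : UpperSemicontinuous B.ptNorm := B.upperSemicontinuous_norm

theorem pt_add_congr {x y : X} (h : x = y) (a b : Fibre B.proj x) (a' b' : Fibre B.proj y)
    (ha : a.pt = a'.pt) (hb : b.pt = b'.pt) : (a + b).pt = (a' + b').pt := by
  subst h; rw [Fibre.ext ha, Fibre.ext hb]

theorem pt_smul_congr {x y : X} (h : x = y) (c : ℂ) (a : Fibre B.proj x) (a' : Fibre B.proj y)
    (ha : a.pt = a'.pt) : (c • a).pt = (c • a').pt := by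
  subst h; rw [Fibre.ext ha]

section Filter

variable {Y : Type w} {l : Filter Y} {p : Y → X}

/-- Addition is continuous along families of pairs in a common fibre. -/
theorem tendsto_add (a b : ∀ y, Fibre B.proj (p y)) {x : X} {a₀ b₀ : Fibre B.proj x}
    (ha : Tendsto (fun y => (a y).pt) l (𝓝 a₀.pt)) (hb : Tendsto (fun y => (b y).pt) l (𝓝 b₀.pt)) :
    Tendsto (fun y => (a y + b y).pt) l (𝓝 (a₀ + b₀).pt) := by
  let q : Y → {q : A × A // B.proj q.1 = B.proj q.2} :=
    fun y => ⟨((a y).pt, (b y).pt), (a y).2.trans (b y).2.symm⟩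
  let q₀ : {q : A × A // B.proj q.1 = B.proj q.2} := ⟨(a₀.pt, b₀.pt), a₀.2.trans b₀.2.symm⟩
  have hq : Tendsto q l (𝓝 q₀) := by
    rw [tendsto_subtype_rng]
    exact ha.prodMk_nhds hb
  have h := (B.continuous_add.tendsto q₀).comp hq
  have e1 := fun y => B.pt_add_congr (b y).2.symm (a y) (b y) ⟨(a y).pt, (q y).2⟩
    ⟨(b y).pt, rfl⟩ rfl rfl
  have e2 := B.pt_add_congr b₀.2.symm a₀ b₀ ⟨a₀.pt, q₀.2⟩ ⟨b₀.pt, rfl⟩ rfl rfl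
  rw [e2]
  exact h.congr fun y => (e1 y).symm

theorem tendsto_smul {c : Y → ℂ} {c₀ : ℂ} (a : ∀ y, Fibre B.proj (p y)) {x : X}
    {a₀ : Fibre B.proj x} (hc : Tendsto c l (𝓝 c₀))
    (ha : Tendsto (fun y => (a y).pt) l (𝓝 a₀.pt)) :
    Tendsto (fun y => (c y • a y).pt) l (𝓝 (c₀ • a₀).pt) := by
  have h := (B.continuous_smul.tendsto (c₀, a₀.pt)).comp (hc.prodMk_nhds ha)
  rw [B.pt_smul_congr a₀.2.symm c₀ a₀ ⟨a₀.pt, rfl⟩ rfl]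
  exact h.congr fun y => (B.pt_smul_congr (a y).2.symm _ (a y) ⟨(a y).pt, rfl⟩ rfl).symm

theorem tendsto_sub (a b : ∀ y, Fibre B.proj (p y)) {x : X} {a₀ b₀ : Fibre B.proj x}
    (ha : Tendsto (fun y => (a y).pt) l (𝓝 a₀.pt)) (hb : Tendsto (fun y => (b y).pt) l (𝓝 b₀.pt)) :
    Tendsto (fun y => (a y - b y).pt) l (𝓝 (a₀ - b₀).pt) := by
  have h := B.tendsto_add a (fun y => (-1 : ℂ) • b y) ha
    (B.tendsto_smul b (tendsto_const_nhds (x := (-1 : ℂ))) hb)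
  simpa [sub_eq_add_neg] using h

theorem tendsto_pt_zero (a : ∀ y, Fibre B.proj (p y)) {x : X} (hp : Tendsto p l (𝓝 x))
    (ha : Tendsto (fun y => ‖a y‖) l (𝓝 0)) :
    Tendsto (fun y => (a y).pt) l (𝓝 (0 : Fibre B.proj x).pt) := by
  refine Tendsto.mono_right ?_ (B.tendsto_zero x)
  refine tendsto_inf.2 ⟨tendsto_comap_iff.2 ?_, tendsto_comap_iff.2 ?_⟩
  · exact hp.congr fun y => (a y).2.symm
  · exact ha.congr fun y => (B.ptNorm_pt (a y)).symm

theorem eventually_norm_lt (a : ∀ y, Fibre B.proj (p y)) {x : X} {a₀ : Fibre B.proj x}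
    (ha : Tendsto (fun y => (a y).pt) l (𝓝 a₀.pt)) {r : ℝ} (hr : ‖a₀‖ < r) :
    ∀ᶠ y in l, ‖a y‖ < r := by
  have h : ∀ᶠ c in 𝓝 a₀.pt, B.ptNorm c < r :=
    B.upperSemicontinuous_ptNorm a₀.pt r ((B.ptNorm_pt a₀).trans_lt hr)
  exact (ha.eventually h).mono fun y hy => by rwa [B.ptNorm_pt] at hy

end Filter

variable {B} {s : Set X} {f g : ∀ x, Fibre B.proj x}

theorem continuousOn_zero : ContinuousOn (fun x => (0 : Fibre B.proj x).pt) s := fun x _ =>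
  B.tendsto_pt_zero (p := fun x => x) (fun x => 0) (tendsto_id.mono_left nhdsWithin_le_nhds)
    (by simpa using tendsto_const_nhds)

theorem continuousOn_add (hf : ContinuousOn (fun x => (f x).pt) s)
    (hg : ContinuousOn (fun x => (g x).pt) s) : ContinuousOn (fun x => (f x + g x).pt) s :=
  fun x hx => B.tendsto_add (p := fun x => x) f g (hf x hx) (hg x hx)

theorem continuousOn_smul {c : X → ℂ} (hc : ContinuousOn c s)
    (hf : ContinuousOn (fun x => (f x).pt) s) : ContinuousOn (fun x => (c x • f x).pt) s :=
  fun x hx => B.tendsto_smul (p := fun x => x) f (hc x hx) (hf x hx)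

theorem continuousOn_sum {ι : Type*} (t : Finset ι) (F : ι → ∀ x, Fibre B.proj x)
    (h : ∀ i ∈ t, ContinuousOn (fun x => (F i x).pt) s) :
    ContinuousOn (fun x => (∑ i ∈ t, F i x).pt) s := by
  classical
  induction t using Finset.induction_on with
  | empty => simpa using continuousOn_zero
  | insert i t hi ih =>
    simp only [Finset.sum_insert hi]
    exact continuousOn_add (h i (by simp)) (ih fun j hj => h j (by simp [hj]))

theorem bddAbove_norm {K : Set X} (hK : IsCompact K) (hf : ContinuousOn (fun x => (f x).pt) K) :
    BddAbove ((fun x => ‖f x‖) '' K) := by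
  refine UpperSemicontinuousOn.bddAbove_of_isCompact hK fun x hx r hr => ?_
  exact B.eventually_norm_lt (p := fun x => x) f (hf x hx) hr

/-- A section that is uniformly approximated, on an open set, by sections that are continuous there
is continuous there.  By openness of the bundle map it is enough to evaluate the section along
points `c` of the total space that tend to `f x`. -/
theorem continuousOn_of_uniform_approx (hs : IsOpen s)
    (h : ∀ ε > (0 : ℝ), ∃ g : ∀ x, Fibre B.proj x, ContinuousOn (fun x => (g x).pt) s ∧
      ∀ x ∈ s, ‖f x - g x‖ ≤ ε) : ContinuousOn (fun x => (f x).pt) s := by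
  intro x hx
  refine ContinuousAt.continuousWithinAt ?_
  have key : Tendsto (fun c : A => (f (B.proj c)).pt) (𝓝 (f x).pt) (𝓝 (f x).pt) := by
    have hproj : Tendsto B.proj (𝓝 (f x).pt) (𝓝 x) := by
      have := B.continuous_proj.tendsto (f x).pt
      rwa [(f x).2] at this
    have hsmall : Tendsto (fun c : A => ‖f (B.proj c) - ⟨c, rfl⟩‖) (𝓝 (f x).pt) (𝓝 0) := by
      rw [Metric.tendsto_nhds]
      intro ε hε
      obtain ⟨g, hg, hfg⟩ := h (ε / 4) (by positivity)
      have h1 : Tendsto (fun c : A => (g (B.proj c)).pt) (𝓝 (f x).pt) (𝓝 (g x).pt) :=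
        ((hg x hx).continuousAt (hs.mem_nhds hx)).tendsto.comp hproj
      have h2 := B.tendsto_sub (p := B.proj) (fun c => g (B.proj c)) (fun c => ⟨c, rfl⟩)
        (a₀ := g x) (b₀ := f x) h1 tendsto_id
      have h3 : ‖g x - f x‖ < ε / 2 := by
        rw [norm_sub_rev]; linarith [hfg x hx]
      filter_upwards [B.eventually_norm_lt (p := B.proj) _ h2 h3,
        hproj.eventually (hs.mem_nhds hx)] with c hc hcs
      have h4 := norm_sub_le_norm_sub_add_norm_sub (f (B.proj c)) (g (B.proj c)) ⟨c, rfl⟩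
      have h5 := hfg _ hcs
      rw [Real.dist_0_eq_abs, abs_of_nonneg (norm_nonneg _)]
      linarith
    have h6 := B.tendsto_add (p := B.proj) (fun c => f (B.proj c) - ⟨c, rfl⟩) (fun c => ⟨c, rfl⟩)
      (b₀ := f x) (B.tendsto_pt_zero _ hproj hsmall) tendsto_id
    simpa using h6
  have hle : 𝓝 x ≤ map B.proj (𝓝 (f x).pt) := by
    have := B.isOpenMap_proj.nhds_le (f x).pt
    rwa [(f x).2] at this
  exact Tendsto.mono_left (tendsto_map'_iff.2 key) hle

end BanachBundle

/-! ### The space of units -/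

section Units

variable {G : Type u}

section

variable [ArrowGroupoid G] {x : G}

theorem rng_eq_of_mem_unitSpace (h : x ∈ unitSpace G) : rng x = x := h

theorem src_eq_of_mem_unitSpace (h : x ∈ unitSpace G) : src x = x := by
  have h : rng x = x := h
  conv_lhs => rw [← h, src_rng]
  exact h

theorem mul_self_of_mem_unitSpace (h : x ∈ unitSpace G) : x * x = x := by
  have := rng_mul_self x
  rwa [rng_eq_of_mem_unitSpace h] at this

theorem inv_of_mem_unitSpace (h : x ∈ unitSpace G) : x⁻¹ = x := by
  have h1 := self_mul_src x⁻¹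
  rwa [src_inv, rng_eq_of_mem_unitSpace h, inv_mul_self, src_eq_of_mem_unitSpace h, eq_comm] at h1

theorem src_mem_unitSpace (a : G) : src a ∈ unitSpace G := rng_src a

theorem rng_mem_unitSpace (a : G) : rng a ∈ unitSpace G := rng_rng a

end

variable [TopologicalSpace G] [EtaleGroupoid G]

theorem isOpen_unitSpace : IsOpen (unitSpace G) := by
  rw [isOpen_iff_mem_nhds]
  intro x hx
  obtain ⟨e, hxe, he⟩ := EtaleGroupoid.isLocalHomeomorph_rng (G := G) x
  have h1 : e.source ∩ rng ⁻¹' e.source ∈ 𝓝 x :=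
    (e.open_source.inter (e.open_source.preimage EtaleGroupoid.continuous_rng)).mem_nhds
      ⟨hxe, by rwa [mem_preimage, rng_eq_of_mem_unitSpace hx]⟩
  refine Filter.mem_of_superset h1 fun y hy => e.injOn hy.2 hy.1 ?_
  rw [← he]
  exact Subtype.ext (rng_rng y)

theorem isBisection_of_subset_unitSpace {V : Set G} (hV : IsOpen V) (h : V ⊆ unitSpace G) :
    IsBisection V where
  isOpen := hV
  injOn_rng a ha b hb hab := by
    rwa [rng_eq_of_mem_unitSpace (h ha), rng_eq_of_mem_unitSpace (h hb)] at hab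
  injOn_src a ha b hb hab := by
    rwa [src_eq_of_mem_unitSpace (h ha), src_eq_of_mem_unitSpace (h hb)] at hab

theorem isOpenMap_toUnit : IsOpenMap (toUnit : G → unitSpace G) :=
  EtaleGroupoid.isLocalHomeomorph_rng.isOpenMap

end Units

namespace FellBundle

variable {G : Type u} {A : Type v} [TopologicalSpace G] [EtaleGroupoid G] [TopologicalSpace A]
  {B : FellBundle G A}

/-! ### Fibres, and the span of the sections supported on bisections -/

section Fibres

variable {γ η ζ : G}

theorem norm_fibMul_le (h : src γ = rng η) (hz : γ * η = ζ) (a : B.Fib γ) (b : B.Fib η) :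
    ‖B.fibMul h hz a b‖ ≤ ‖a‖ * ‖b‖ := by
  have h1 := B.norm_mul_le a.pt b.pt (by rwa [a.2, b.2])
  change B.ptNorm (B.fibMul h hz a b).pt ≤ B.ptNorm a.pt * B.ptNorm b.pt at h1
  simpa using h1

theorem norm_fibAdj (h : γ⁻¹ = η) (a : B.Fib γ) : ‖B.fibAdj h a‖ = ‖a‖ := by
  have h1 := B.norm_adj_mul_self (B.adj a.pt)
  have h2 := B.norm_self_mul_adj a.pt
  rw [B.adj_adj] at h1
  have h3 : B.ptNorm (B.fibAdj h a).pt ^ 2 = B.ptNorm a.pt ^ 2 := h1.symm.trans h2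
  rw [B.ptNorm_pt, B.ptNorm_pt] at h3
  exact (pow_left_inj₀ (norm_nonneg _) (norm_nonneg _) two_ne_zero).1 h3

theorem ptNorm_adj_mul_self (a : B.Fib γ) : B.ptNorm (B.mul (B.adj a.pt) a.pt) = ‖a‖ ^ 2 := by
  rw [← B.ptNorm_pt a]
  exact B.norm_adj_mul_self a.pt

end Fibres

namespace Cc

@[simp] theorem add_apply (f g : B.Cc) (γ : G) : (f + g) γ = f γ + g γ := rfl
@[simp] theorem zero_apply (γ : G) : (0 : B.Cc) γ = 0 := rfl
@[simp] theorem smul_apply (c : ℂ) (f : B.Cc) (γ : G) : (c • f) γ = c • f γ := rfl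
theorem mul_apply (f g : B.Cc) (γ : G) : (f * g) γ = B.conv f g γ := rfl
theorem star_apply (f : B.Cc) (γ : G) : (star f) γ = B.secAdj f γ := rfl

theorem sum_apply {ι : Type*} (t : Finset ι) (F : ι → B.Cc) (γ : G) :
    (∑ i ∈ t, F i) γ = ∑ i ∈ t, F i γ := by
  classical
  induction t using Finset.induction_on with
  | empty => simp
  | insert i t hi ih => simp [Finset.sum_insert hi, ih]

@[ext] theorem ext {f g : B.Cc} (h : ∀ γ, f γ = g γ) : f = g := Subtype.ext (funext h)

theorem norm_star_apply (f : B.Cc) (γ : G) : ‖(star f) γ‖ = ‖f γ⁻¹‖ := norm_fibAdj (inv_inv_arrow γ) _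

end Cc

theorem IsCompactlySupportedOn.mem {U : Set G} (hU : IsBisection U) {f : B.Sec}
    (hf : B.IsCompactlySupportedOn U f) : f ∈ B.ccSubmodule :=
  Submodule.subset_span ⟨U, hU.isOpen, t2Space_of_injOn_rng hU.injOn_rng, hf⟩

/-- Induction on `C_c(G; A)`: it is spanned by the sections supported on bisections. -/
theorem Cc.induction {P : B.Cc → Prop}
    (mem : ∀ (f : B.Cc) (U K : Set G), IsBisection U → IsCompact K → K ⊆ U →
      f ∈ B.sectionsIn U K → P f)
    (zero : P 0) (add : ∀ f g, P f → P g → P (f + g)) (smul : ∀ (c : ℂ) f, P f → P (c • f))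
    (f : B.Cc) : P f := by
  obtain ⟨f, hf⟩ := f
  have hf' := hf
  rw [ccSubmodule_eq_span] at hf'
  induction hf' using Submodule.span_induction with
  | mem f h =>
    obtain ⟨U, hU, hc, K, hKU, hK, h0⟩ := h
    exact mem _ U K hU hK hKU ⟨hc, h0⟩
  | zero => exact zero
  | add f g h h' h1 h2 =>
    rw [← ccSubmodule_eq_span] at h h'
    exact add _ _ (h1 h) (h2 h')
  | smul c f h h1 =>
    rw [← ccSubmodule_eq_span] at h
    exact smul c _ (h1 h)

/-- A member of `C_c(G; A)` is a finite sum of sections supported on bisections. -/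
theorem Cc.exists_sum (f : B.Cc) : ∃ (n : ℕ) (F : Fin n → B.Cc) (U K : Fin n → Set G),
    (∀ i, IsBisection (U i) ∧ IsCompact (K i) ∧ K i ⊆ U i ∧ F i ∈ B.sectionsIn (U i) (K i)) ∧
      f = ∑ i, F i := by
  induction f using Cc.induction with
  | mem f U K hU hK hKU hf =>
    exact ⟨1, fun _ => f, fun _ => U, fun _ => K, fun _ => ⟨hU, hK, hKU, hf⟩, by simp⟩
  | zero => exact ⟨0, Fin.elim0, Fin.elim0, Fin.elim0, fun i => i.elim0, by simp⟩
  | add f g hf hg =>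
    obtain ⟨n, F, U, K, h, rfl⟩ := hf
    obtain ⟨m, F', U', K', h', rfl⟩ := hg
    refine ⟨n + m, Fin.append F F', Fin.append U U', Fin.append K K', fun i => ?_, ?_⟩
    · induction i using Fin.addCases with
      | left i => simpa using h i
      | right i => simpa using h' i
    · simp [Fin.sum_univ_add]
  | smul c f hf =>
    obtain ⟨n, F, U, K, h, rfl⟩ := hf
    refine ⟨n, fun i => c • F i, U, K, fun i => ⟨(h i).1, (h i).2.1, (h i).2.2.1, ?_, ?_⟩, ?_⟩
    · exact BanachBundle.continuousOn_smul continuousOn_const (h i).2.2.2.1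
    · intro γ hγ
      rw [Cc.smul_apply, (h i).2.2.2.2 γ hγ, smul_zero]
    · rw [Finset.smul_sum]

/-- Sections supported on bisections are bounded. -/
theorem exists_norm_le {U K : Set G} (hK : IsCompact K) (hKU : K ⊆ U) {f : B.Cc}
    (hf : f ∈ B.sectionsIn U K) : ∃ C, 0 ≤ C ∧ ∀ γ, ‖f γ‖ ≤ C := by
  obtain ⟨C, hC⟩ := BanachBundle.bddAbove_norm hK (hf.1.mono hKU)
  refine ⟨max C 0, le_max_right _ _, fun γ => ?_⟩
  by_cases h : γ ∈ K
  · exact (hC ⟨γ, h, rfl⟩).trans (le_max_left _ _)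
  · rw [hf.2 γ h, norm_zero]; exact le_max_right _ _

/-! ### Continuity in inductive limit topologies -/

/-- A linear map that is bounded on each of the subspaces is continuous: the topology that it induces
is one of those whose infimum is the inductive limit topology. -/
theorem continuous_inductiveLimit_of_bound {E : Type*} [SeminormedAddCommGroup E] [NormedSpace ℂ E]
    {F : Set (Set B.Cc)} (T : B.Cc →ₗ[ℂ] E)
    (h : ∀ P ∈ F, ∃ C, ∀ f ∈ P, ∀ β, 0 ≤ β → (∀ γ, ‖f γ‖ ≤ β) → ‖T f‖ ≤ C * β) :
    @Continuous B.Cc E (B.inductiveLimit F) _ T := by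
  refine continuous_sInf_dom (t := TopologicalSpace.induced T inferInstance) ⟨?_, ?_, ?_, ?_⟩
    continuous_induced_dom
  · exact topologicalAddGroup_induced T
  · exact continuousSMul_induced T
  · let _ : NormedSpace ℝ E := NormedSpace.complexToReal
    exact @LocallyConvexSpace.induced ℝ B.Cc E _ _ _ _ _ _ _ _ (T.restrictScalars ℝ)
  · intro P hP W hW
    obtain ⟨C, hC⟩ := h P hP
    rw [nhds_induced, map_zero, mem_comap] at hW
    obtain ⟨W', hW', hsub⟩ := hW
    obtain ⟨ε, hε, hball⟩ := Metric.mem_nhds_iff.1 hW'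
    refine ⟨ε / (|C| + 1), by positivity, fun f hf hfε => hsub (hball ?_)⟩
    rw [mem_ball_zero_iff]
    calc ‖T f‖ ≤ C * (ε / (|C| + 1)) := hC f hf _ (by positivity) hfε
      _ ≤ |C| * (ε / (|C| + 1)) := by gcongr; exact le_abs_self C
      _ < (|C| + 1) * (ε / (|C| + 1)) := by gcongr; linarith
      _ = ε := by field_simp

/-- The neighbourhoods of zero of the inductive limit topology contain small balls of each of
the subspaces. -/
theorem exists_ball_subset_of_mem_nhds {F : Set (Set B.Cc)} {P : Set B.Cc} (hP : P ∈ F)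
    {W : Set B.Cc} (hW : W ∈ @nhds B.Cc (B.inductiveLimit F) 0) :
    ∃ ε > (0 : ℝ), ∀ f ∈ P, (∀ γ, ‖f γ‖ ≤ ε) → f ∈ W := by
  let l : Filter B.Cc :=
    { sets := {W | ∃ ε > (0 : ℝ), ∀ f ∈ P, (∀ γ, ‖f γ‖ ≤ ε) → f ∈ W}
      univ_sets := ⟨1, one_pos, fun _ _ _ => mem_univ _⟩
      sets_of_superset := fun ⟨ε, hε, h⟩ hsub => ⟨ε, hε, fun f hf hfε => hsub (h f hf hfε)⟩
      inter_sets := fun ⟨ε, hε, h⟩ ⟨δ, hδ, h'⟩ => ⟨min ε δ, lt_min hε hδ, fun f hf hfε =>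
        ⟨h f hf fun γ => (hfε γ).trans (min_le_left _ _),
          h' f hf fun γ => (hfε γ).trans (min_le_right _ _)⟩⟩ }
  have hl : l ≤ @nhds B.Cc (B.inductiveLimit F) 0 := by
    rw [nhds_sInf]
    exact le_iInf₂ fun t ht W hW => ht.2.2.2 P hP W hW
  exact hl hW

theorem exists_bound_of_continuous {F : Set (Set B.Cc)} {P : Set B.Cc} (hP : P ∈ F)
    (hsmul : ∀ (c : ℂ), ∀ f ∈ P, c • f ∈ P) (T : B.Cc →ₗ[ℂ] ℂ)
    (hT : @Continuous B.Cc ℂ (B.inductiveLimit F) _ T) :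
    ∃ C, 0 ≤ C ∧ ∀ f ∈ P, ∀ β, 0 ≤ β → (∀ γ, ‖f γ‖ ≤ β) → ‖T f‖ ≤ C * β := by
  have hW : T ⁻¹' Metric.ball 0 1 ∈ @nhds B.Cc (B.inductiveLimit F) 0 := by
    have := @Continuous.tendsto _ _ (B.inductiveLimit F) _ _ hT 0
    rw [map_zero] at this
    exact this (Metric.ball_mem_nhds _ one_pos)
  obtain ⟨ε, hε, h⟩ := exists_ball_subset_of_mem_nhds hP hW
  refine ⟨1 / ε, by positivity, fun f hf β hβ hfβ => ?_⟩
  rcases hβ.eq_or_lt with rfl | hβ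
  · have : f = 0 := Cc.ext fun γ => by simpa using hfβ γ
    simp [this]
  · have h1 := h (((ε / β : ℝ) : ℂ) • f) (hsmul _ f hf) fun γ => by
      rw [Cc.smul_apply, norm_smul, Complex.norm_real, Real.norm_of_nonneg (by positivity)]
      calc ε / β * ‖f γ‖ ≤ ε / β * β := by gcongr; exact hfβ γ
        _ = ε := by field_simp
    rw [mem_preimage, mem_ball_zero_iff, map_smul, norm_smul, Complex.norm_real,
      Real.norm_of_nonneg (by positivity)] at h1
    have h2 : ‖T f‖ = (ε / β * ‖T f‖) * (β / ε) := by field_simp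
    rw [h2]
    calc (ε / β * ‖T f‖) * (β / ε) ≤ 1 * (β / ε) := by gcongr
      _ = 1 / ε * β := by ring

theorem smul_mem_sectionsIn {U K : Set G} (c : ℂ) {f : B.Cc} (hf : f ∈ B.sectionsIn U K) :
    c • f ∈ B.sectionsIn U K :=
  ⟨BanachBundle.continuousOn_smul continuousOn_const hf.1, fun γ hγ => by
    rw [Cc.smul_apply, hf.2 γ hγ, smul_zero]⟩

theorem add_mem_sectionsIn {U K : Set G} {f g : B.Cc} (hf : f ∈ B.sectionsIn U K)
    (hg : g ∈ B.sectionsIn U K) : f + g ∈ B.sectionsIn U K :=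
  ⟨BanachBundle.continuousOn_add hf.1 hg.1, fun γ hγ => by
    rw [Cc.add_apply, hf.2 γ hγ, hg.2 γ hγ, add_zero]⟩

theorem zero_mem_sectionsIn {U K : Set G} : (0 : B.Cc) ∈ B.sectionsIn U K :=
  ⟨BanachBundle.continuousOn_zero, fun _ _ => rfl⟩

/-! ### Sections supported on the units -/

theorem isBisection_inv {U : Set G} (hU : IsBisection U) :
    IsBisection ((fun a : G => a⁻¹) ⁻¹' U) where
  isOpen := hU.isOpen.preimage EtaleGroupoid.continuous_inv
  injOn_rng a ha b hb hab := by
    have := hU.injOn_src ha hb (by rw [src_inv, src_inv, hab])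
    exact (inv_inv_arrow a).symm.trans ((congrArg _ this).trans (inv_inv_arrow b))
  injOn_src a ha b hb hab := by
    have := hU.injOn_rng ha hb (by rw [rng_inv, rng_inv, hab])
    exact (inv_inv_arrow a).symm.trans ((congrArg _ this).trans (inv_inv_arrow b))

theorem zero_pt_congr {γ η : G} (h : γ = η) : (0 : B.Fib γ).pt = (0 : B.Fib η).pt := by
  subst h; rfl

section

variable {V K : Set G} (hV : V ⊆ unitSpace G) (hKV : K ⊆ V)

include hV hKV

theorem mul_apply_pt_of_units {f g : B.Cc} (hf : f ∈ B.sectionsIn V K) {γ : G} (hγ : γ ∈ V) :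
    ((f * g) γ).pt = B.mul (f γ).pt (g γ).pt := by
  have hinj : InjOn (rng : G → G) V := fun a ha b hb hab => by
    rwa [rng_eq_of_mem_unitSpace (hV ha), rng_eq_of_mem_unitSpace (hV hb)] at hab
  have h := conv_eq_left (B := B) hinj (fun γ hγ => hf.2 γ fun h => hγ (hKV h)) g.1 hγ rfl
  rw [inv_of_mem_unitSpace (hV hγ), mul_self_of_mem_unitSpace (hV hγ)] at h
  exact h

theorem mul_mem_sectionsIn_of_units {f g : B.Cc} (hf : f ∈ B.sectionsIn V K)
    (hg : g ∈ B.sectionsIn V K) : f * g ∈ B.sectionsIn V K := by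
  refine ⟨?_, fun γ hγ => ?_⟩
  · refine (B.continuousOn_mul.comp (hf.1.prodMk hg.1) fun γ hγ => ?_).congr fun γ hγ =>
      mul_apply_pt_of_units hV hKV hf hγ
    simp only [mem_ofPred_eq, (f.1 γ).2, (g.1 γ).2]
    rw [rng_eq_of_mem_unitSpace (hV hγ), src_eq_of_mem_unitSpace (hV hγ)]
  · refine finsum_eq_zero_of_forall_eq_zero fun q => ?_
    by_cases h : q.1.1 ∈ K
    · by_cases h' : q.1.2 ∈ K
      · -- a composable pair of units with product `γ` is `(γ, γ)`
        have h1 : q.1.1 = q.1.2 := by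
          rw [← src_eq_of_mem_unitSpace (hV (hKV h)), q.2.1,
            rng_eq_of_mem_unitSpace (hV (hKV h'))]
        have h2 := q.2.2
        rw [← h1, mul_self_of_mem_unitSpace (hV (hKV h))] at h2
        exact (hγ (h2 ▸ h)).elim
      · rw [hg.2 _ h', fibMul_zero]
    · rw [hf.2 _ h, zero_fibMul]

theorem star_mem_sectionsIn_of_units {f : B.Cc} (hf : f ∈ B.sectionsIn V K) :
    star f ∈ B.sectionsIn V K := by
  refine ⟨?_, fun γ hγ => ?_⟩
  · refine (B.continuous_adj.comp_continuousOn hf.1).congr fun γ hγ => ?_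
    change B.adj (f γ⁻¹).pt = B.adj (f γ).pt
    rw [inv_of_mem_unitSpace (hV hγ)]
  · rw [Cc.star_apply, secAdj, hf.2 _ fun h => hγ ?_, fibAdj_zero]
    have := inv_of_mem_unitSpace (hV (hKV h))
    rw [inv_inv_arrow] at this
    rwa [this]

theorem norm_mul_apply_le_of_units {f g : B.Cc} (hf : f ∈ B.sectionsIn V K)
    (hg : g ∈ B.sectionsIn V K) (γ : G) : ‖(f * g) γ‖ ≤ ‖f γ‖ * ‖g γ‖ := by
  by_cases h : γ ∈ V
  · have h1 := B.norm_mul_le (f γ).pt (g γ).pt (by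
      rw [(f.1 γ).2, (g.1 γ).2, rng_eq_of_mem_unitSpace (hV h), src_eq_of_mem_unitSpace (hV h)])
    rw [← B.ptNorm_pt ((f * g) γ), mul_apply_pt_of_units hV hKV hf h,
      ← B.ptNorm_pt (f γ), ← B.ptNorm_pt (g γ)]
    exact h1
  · rw [(mul_mem_sectionsIn_of_units hV hKV hf hg).2 γ fun h' => h (hKV h'), norm_zero]
    positivity

end

/-- If `f` is supported on a bisection, then `f* f` is supported on the units, where its value at
`src α` is `f(α)* f(α)`. -/
theorem star_mul_self_mem_sectionsIn {U K : Set G} (hU : IsBisection U) (hK : IsCompact K)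
    (hKU : K ⊆ U) {f : B.Cc} (hf : f ∈ B.sectionsIn U K) :
    ∃ V L : Set G, IsOpen V ∧ V ⊆ unitSpace G ∧ IsCompact L ∧ L ⊆ V ∧
      star f * f ∈ B.sectionsIn V L ∧
      ∀ β, (∀ γ, ‖f γ‖ ≤ β) → ∀ γ, ‖(star f * f) γ‖ ≤ β ^ 2 := by
  have hU' := isBisection_inv hU
  obtain ⟨σ, hσ, hopen, hcont⟩ := exists_section hU'
  set U' := (fun a : G => a⁻¹) ⁻¹' U with hU'_def
  set D : Set G := {γ : G | ∃ α ∈ U', rng α = rng γ}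
  have hinv : ∀ {α}, α ∈ U → α⁻¹ ∈ U' := fun {α} h => by
    change α⁻¹⁻¹ ∈ U; rwa [inv_inv_arrow]
  have hf' : ∀ γ ∉ U', B.secAdj f γ = 0 := fun γ hγ => by
    rw [secAdj, hf.2 _ fun h => hγ (hKU h), fibAdj_zero]
  have hval : ∀ {α γ}, α ∈ U → src α = γ →
      ((star f * f) γ).pt = B.mul (B.adj (f α).pt) (f α).pt := by
    intro α γ hα hαγ
    have hγ : γ ∈ unitSpace G := hαγ ▸ src_mem_unitSpace α
    have h := conv_eq_left (B := B) hU'.injOn_rng hf' f.1 (hinv hα) (γ := γ)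
      (by rw [rng_inv, rng_eq_of_mem_unitSpace hγ, hαγ])
    rw [inv_inv_arrow, ← hαγ, self_mul_src, hαγ] at h
    refine h.trans ?_
    change B.mul (B.adj (f α⁻¹⁻¹).pt) _ = _
    rw [inv_inv_arrow]
  have hzero : ∀ {γ}, (∀ α ∈ U, src α ≠ γ) → (star f * f) γ = 0 := by
    intro γ hγ
    by_cases h : ∃ α ∈ U', rng α = rng γ
    · obtain ⟨α, hα, hαγ⟩ := h
      have h1 := conv_eq_left (B := B) hU'.injOn_rng hf' f.1 hα hαγ
      have h2 : f (α⁻¹ * γ) = 0 := by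
        refine hf.2 _ fun hm => hγ α⁻¹ hα ?_
        have hc : src α⁻¹ = rng γ := by rw [src_inv, hαγ]
        have h3 : α⁻¹ * γ = α⁻¹ := hU.injOn_rng (hKU hm) hα (rng_mul _ _ hc)
        have h4 := inv_mul_mul_cancel hc
        rw [h3, inv_mul_self] at h4
        exact h4
      rw [h2, mul_zero_pt (by rw [rng_mul _ _ (by rw [src_inv, hαγ]), rng_inv])] at h1
      exact Fibre.ext (h1.trans (zero_pt_congr (mul_inv_mul_cancel hαγ)))
    · exact conv_eq_zero_left hf' f.1 h
  refine ⟨D ∩ unitSpace G, src '' K, hopen.inter isOpen_unitSpace, inter_subset_right,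
    hK.image EtaleGroupoid.continuous_src, ?_, ⟨?_, ?_⟩, ?_⟩
  · rintro _ ⟨α, hα, rfl⟩
    exact ⟨⟨α⁻¹, hinv (hKU hα), by rw [rng_inv, rng_src]⟩, src_mem_unitSpace α⟩
  · have h1 : ContinuousOn (fun γ => (f (σ γ)⁻¹).pt) (D ∩ unitSpace G) :=
      hf.1.comp (EtaleGroupoid.continuous_inv.comp_continuousOn (hcont.mono inter_subset_left))
        fun γ hγ => (hσ γ hγ.1).1
    refine (B.continuousOn_mul.comp ((B.continuous_adj.comp_continuousOn h1).prodMk h1)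
      fun γ hγ => ?_).congr fun γ hγ => hval (hσ γ hγ.1).1 ?_
    · simp only [mem_ofPred_eq, Function.comp_apply, B.proj_adj, (f.1 _).2, src_inv]
    · rw [src_inv, (hσ γ hγ.1).2, rng_eq_of_mem_unitSpace hγ.2]
  · intro γ hγ
    by_cases h : ∃ α ∈ U, src α = γ
    · obtain ⟨α, hα, hαγ⟩ := h
      have h0 : f α = 0 := hf.2 α fun h => hγ ⟨α, h, hαγ⟩
      refine norm_eq_zero.1 ?_
      rw [← B.ptNorm_pt, hval hα hαγ, ptNorm_adj_mul_self, h0]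
      simp
    · exact hzero fun α hα hαγ => h ⟨α, hα, hαγ⟩
  · intro β hβ γ
    by_cases h : ∃ α ∈ U, src α = γ
    · obtain ⟨α, hα, hαγ⟩ := h
      rw [← B.ptNorm_pt, hval hα hαγ, ptNorm_adj_mul_self]
      exact pow_le_pow_left₀ (norm_nonneg _) (hβ α) 2
    · rw [hzero fun α hα hαγ => h ⟨α, hα, hαγ⟩, norm_zero]
      positivity

/-! ### Bounded extension of pre-representations -/

/-- A sequence with `d n ^ 2 ≤ s * d (n + 1)` grows at least like the powers `(d 0 / s) ^ 2 ^ n`, so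
that an upper bound by a multiple of `b ^ 2 ^ n` controls its first term. -/
theorem le_mul_of_sq_le_mul_succ {d : ℕ → ℝ} {s b C : ℝ} (hs : 0 ≤ s) (hb : 0 ≤ b)
    (hd : ∀ n, 0 ≤ d n) (hsq : ∀ n, d n ^ 2 ≤ s * d (n + 1)) (hC : ∀ n, d n ≤ C * b ^ 2 ^ n) :
    d 0 ≤ s * b := by
  rcases hs.eq_or_lt with rfl | hs
  · have := hsq 0
    nlinarith [hd 0]
  by_contra! hlt
  have hpow : ∀ n, (d 0 / s) ^ 2 ^ n ≤ d n / s := by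
    intro n
    induction n with
    | zero => simp
    | succ n ih =>
      calc (d 0 / s) ^ 2 ^ (n + 1) = ((d 0 / s) ^ 2 ^ n) ^ 2 := by rw [pow_succ, pow_mul]
        _ ≤ (d n / s) ^ 2 := pow_le_pow_left₀ (pow_nonneg (div_nonneg (hd 0) hs.le) _) ih 2
        _ = d n ^ 2 / s ^ 2 := by rw [div_pow]
        _ ≤ s * d (n + 1) / s ^ 2 := by gcongr; exact hsq n
        _ = d (n + 1) / s := by field_simp
  have hbe : b < d 0 / s := by rw [lt_div_iff₀ hs]; linarith
  rcases hb.eq_or_lt with rfl | hb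
  · have h1 := hC 0
    have h2 : 0 < d 0 / s := hbe
    have h3 : 0 < d 0 := by simpa [hs.le, not_le.2 hs] using (div_pos_iff_of_pos_right hs).1 h2
    simp at h1
    linarith
  · have h1 : 1 < d 0 / s / b := by rwa [one_lt_div hb]
    have h2 : Tendsto (fun n : ℕ => (d 0 / s / b) ^ 2 ^ n) atTop atTop :=
      (tendsto_pow_atTop_atTop_of_one_lt h1).comp (tendsto_pow_atTop_atTop_of_one_lt one_lt_two)
    obtain ⟨n, hn⟩ := (h2.eventually_gt_atTop (C / s)).exists
    have h3 := (hpow n).trans (div_le_div_of_nonneg_right (hC n) hs.le)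
    rw [div_pow, lt_div_iff₀ (by positivity)] at hn
    have h4 : C * b ^ 2 ^ n / s = C / s * b ^ 2 ^ n := by ring
    linarith

section Extension

variable {E : Type*} [AddCommGroup E] [Module ℂ E] {H : Type*} [NormedAddCommGroup H]
  [InnerProductSpace ℂ H] (q : E →ₗ[ℂ] H) (L : B.Cc →ₙₐ[ℂ] Module.End ℂ E)

/-- The coefficient functional `f ↦ ⟨η, L(f) ξ⟩`. -/
noncomputable def coefficient (ξ η : E) : B.Cc →ₗ[ℂ] ℂ where
  toFun f := inner ℂ (q η) (q (L f ξ))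
  map_add' f g := by simp
  map_smul' c f := by simp

variable (hcont : ∀ ξ η : E, @Continuous B.Cc ℂ B.ilt _ fun f => inner ℂ (q η) (q (L f ξ)))
  (hadj : ∀ (f : B.Cc) (ξ η : E),
    inner ℂ (q η) (q (L f ξ)) = inner ℂ (q (L (star f) η)) (q ξ))

include hcont hadj

/-- The operators of a pre-representation are contractive on sections supported on bisections.
With `h = f* f` and `d n = ⟨ξ, L(h ^ 2 ^ n) ξ⟩`, the Cauchy–Schwarz inequality says that
`d n ^ 2 ≤ ‖ξ‖ ^ 2 * d (n + 1)`; the sections `h ^ 2 ^ n` are supported on one compact set of units, so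
that continuity bounds `d n` by a multiple of the supremum norm of `h ^ 2 ^ n`. -/
theorem norm_preRep_le {U K : Set G} (hU : IsBisection U) (hK : IsCompact K) (hKU : K ⊆ U)
    {f : B.Cc} (hf : f ∈ B.sectionsIn U K) {β : ℝ} (hβ : 0 ≤ β) (hfβ : ∀ γ, ‖f γ‖ ≤ β) (ξ : E) :
    ‖q (L f ξ)‖ ≤ β * ‖q ξ‖ := by
  obtain ⟨V, K', hVo, hV, hK', hKV, hh, hbound⟩ := star_mul_self_mem_sectionsIn hU hK hKU hf
  let h : ℕ → B.Cc := fun n => (fun g => g * g)^[n] (star f * f)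
  have hsucc : ∀ n, h (n + 1) = h n * h n := fun n => Function.iterate_succ_apply' _ _ _
  have hself : ∀ n, star (h n) = h n := by
    intro n
    induction n with
    | zero => simp [h]
    | succ n ih => rw [hsucc, star_mul, ih]
  have hmem : ∀ n, h n ∈ B.sectionsIn V K' := by
    intro n
    induction n with
    | zero => exact hh
    | succ n ih => rw [hsucc]; exact mul_mem_sectionsIn_of_units hV hKV ih ih
  have hnorm : ∀ n γ, ‖h n γ‖ ≤ (β ^ 2) ^ 2 ^ n := by
    intro n
    induction n with
    | zero => simpa [h] using hbound β hfβ
    | succ n ih =>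
      intro γ
      rw [hsucc, pow_succ 2 n, pow_mul, sq ((β ^ 2) ^ 2 ^ n)]
      exact (norm_mul_apply_le_of_units hV hKV (hmem n) (hmem n) γ).trans
        (mul_le_mul (ih γ) (ih γ) (norm_nonneg _) (by positivity))
  obtain ⟨C, -, hC⟩ := exists_bound_of_continuous (P := B.sectionsIn V K')
    (F := {P | ∃ U K : Set G, IsBisection U ∧ IsCompact K ∧ K ⊆ U ∧ P = B.sectionsIn U K})
    ⟨V, K', isBisection_of_subset_unitSpace hVo hV, hK', hKV, rfl⟩
    (fun c f hf => smul_mem_sectionsIn c hf) (coefficient q L ξ ξ) (hcont ξ ξ)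
  let d : ℕ → ℝ := fun n => (inner ℂ (q ξ) (q (L (h n) ξ)) : ℂ).re
  have hd0 : d 0 = ‖q (L f ξ)‖ ^ 2 := by
    simp only [d, h, Function.iterate_zero, id]
    rw [map_mul, Module.End.mul_apply, hadj, star_star]
    exact inner_self_eq_norm_sq (𝕜 := ℂ) _
  have hds : ∀ n, d (n + 1) = ‖q (L (h n) ξ)‖ ^ 2 := by
    intro n
    simp only [d, hsucc]
    rw [map_mul, Module.End.mul_apply, hadj, hself]
    exact inner_self_eq_norm_sq (𝕜 := ℂ) _
  have hd : ∀ n, 0 ≤ d n := by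
    rintro (_ | n)
    · rw [hd0]; positivity
    · rw [hds]; positivity
  have key := le_mul_of_sq_le_mul_succ (d := d) (s := ‖q ξ‖ ^ 2) (b := β ^ 2) (C := C)
    (by positivity) (by positivity) hd (fun n => ?_) (fun n => ?_)
  · rw [hd0, ← mul_pow, mul_comm] at key
    exact (pow_le_pow_iff_left₀ (norm_nonneg _) (by positivity) two_ne_zero).1 key
  · rw [hds, ← mul_pow]
    exact pow_le_pow_left₀ (hd n)
      ((Complex.re_le_norm _).trans (norm_inner_le_norm (𝕜 := ℂ) _ _)) 2
  · exact (Complex.re_le_norm _).trans (hC _ (hmem n) _ (by positivity) (hnorm n))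

theorem exists_norm_preRep_le (f : B.Cc) : ∃ C, ∀ ξ, ‖q (L f ξ)‖ ≤ C * ‖q ξ‖ := by
  induction f using Cc.induction with
  | mem f U K hU hK hKU hf =>
    obtain ⟨C, hC, hfC⟩ := exists_norm_le hK hKU hf
    exact ⟨C, norm_preRep_le q L hcont hadj hU hK hKU hf hC hfC⟩
  | zero => exact ⟨0, fun ξ => by simp⟩
  | add f g hf hg =>
    obtain ⟨C, hC⟩ := hf
    obtain ⟨D, hD⟩ := hg
    refine ⟨C + D, fun ξ => ?_⟩
    rw [map_add, LinearMap.add_apply, map_add, _root_.add_mul]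
    exact (norm_add_le _ _).trans (add_le_add (hC ξ) (hD ξ))
  | smul c f hf =>
    obtain ⟨C, hC⟩ := hf
    refine ⟨‖c‖ * C, fun ξ => ?_⟩
    rw [map_smul, LinearMap.smul_apply, map_smul, norm_smul, _root_.mul_assoc]
    gcongr
    exact hC ξ

/-- A pre-representation, given on any space with a linear map of dense range to the Hilbert space,
extends to a `*`-homomorphism into the bounded operators. -/
theorem exists_starHom_extension [CompleteSpace H] (hq : DenseRange q) :
    ∃ M : B.Cc →⋆ₙₐ[ℂ] (H →L[ℂ] H), ∀ f ξ, M f (q ξ) = q (L f ξ) := by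
  let M₀ : B.Cc → H →L[ℂ] H := fun f => (q ∘ₗ L f).extendOfNorm q
  have hM : ∀ f ξ, M₀ f (q ξ) = q (L f ξ) := fun f ξ =>
    LinearMap.extendOfNorm_eq (f := q ∘ₗ L f) hq (exists_norm_preRep_le q L hcont hadj f) ξ
  have hext : ∀ {S T : H →L[ℂ] H}, (∀ ξ, S (q ξ) = T (q ξ)) → S = T := fun {S T} h =>
    ContinuousLinearMap.coeFn_injective (hq.equalizer S.continuous T.continuous (funext h))
  refine ⟨{ toFun := M₀
            map_smul' := fun c f => hext fun ξ => ?_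
            map_zero' := hext fun ξ => ?_
            map_add' := fun f g => hext fun ξ => ?_
            map_mul' := fun f g => hext fun ξ => ?_
            map_star' := fun f => ?_ }, hM⟩
  · simp [hM]
  · simp [hM]
  · simp [hM]
  · simp [hM]
  · refine (ContinuousLinearMap.eq_adjoint_iff _ _).2 fun x y => ?_
    refine hq.induction_on₂ (p := fun x y => inner ℂ (M₀ (star f) x) y = inner ℂ x (M₀ f y))
      (isClosed_eq (by fun_prop) (by fun_prop)) (fun a b => ?_) x y
    rw [hM, hM, hadj]

end Extension

/-! ### The C*-algebras of unit fibres and of sections over compact sets of units -/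

theorem src_eq_rng_of_unit (x : unitSpace G) : src x.1 = rng x.1 :=
  (src_eq_of_mem_unitSpace x.2).trans (rng_eq_of_mem_unitSpace x.2).symm

/-- The fibre over a unit is a C*-algebra. -/
noncomputable instance unitFibreCStarAlgebra (x : unitSpace G) :
    NonUnitalCStarAlgebra (B.Fib x.1) :=
  { (inferInstance : NormedAddCommGroup (B.Fib x.1)),
    (inferInstance : NormedSpace ℂ (B.Fib x.1)),
    (inferInstance : CompleteSpace (B.Fib x.1)) with
    mul := B.fibMul (src_eq_rng_of_unit x) (mul_self_of_mem_unitSpace x.2)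
    star := B.fibAdj (inv_of_mem_unitSpace x.2)
    left_distrib := B.fibMul_add _ _
    right_distrib := B.add_fibMul _ _
    zero_mul := B.zero_fibMul _ _
    mul_zero := B.fibMul_zero _ _
    mul_assoc := fun a b c => Fibre.ext (B.mul_assoc a.pt b.pt c.pt
      (by rw [a.2, b.2, src_eq_rng_of_unit]) (by rw [b.2, c.2, src_eq_rng_of_unit]))
    norm_mul_le := norm_fibMul_le _ _
    star_involutive := fun a => Fibre.ext (B.adj_adj a.pt)
    star_mul := fun a b => Fibre.ext (B.adj_mul a.pt b.pt (by
      rw [a.2, b.2, src_eq_rng_of_unit]))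
    star_add := B.fibAdj_add _
    norm_mul_self_le := fun a => by
      have h := ptNorm_adj_mul_self a
      change B.ptNorm (B.fibMul (src_eq_rng_of_unit x) (mul_self_of_mem_unitSpace x.2)
        (B.fibAdj (inv_of_mem_unitSpace x.2) a) a).pt = _ at h
      rw [B.ptNorm_pt, sq] at h
      exact h.ge
    smul_assoc := fun c a b => B.smul_fibMul _ _ c a b
    smul_comm := fun c a b => (B.fibMul_smul _ _ c a b).symm
    star_smul := fun c a => B.fibAdj_smul _ c a }

section

variable {V K : Set G} (hV : V ⊆ unitSpace G) (hKV : K ⊆ V)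

include hV hKV in
theorem mul_apply_unit {f g : B.Cc} (hf : f ∈ B.sectionsIn V K) (hg : g ∈ B.sectionsIn V K)
    (x : unitSpace G) : (f * g) x.1 = f x.1 * g x.1 := by
  by_cases h : x.1 ∈ V
  · exact Fibre.ext (mul_apply_pt_of_units hV hKV hf h)
  · rw [(mul_mem_sectionsIn_of_units hV hKV hf hg).2 _ fun h' => h (hKV h'),
      hf.2 _ fun h' => h (hKV h'), zero_mul]

theorem star_apply_unit (f : B.Cc) (x : unitSpace G) : (star f) x.1 = star (f x.1) := by
  refine Fibre.ext ?_
  change B.adj (f x.1⁻¹).pt = B.adj (f x.1).pt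
  rw [inv_of_mem_unitSpace x.2]

include hV hKV in
theorem ext_of_units {f g : B.Cc} (hf : f ∈ B.sectionsIn V K) (hg : g ∈ B.sectionsIn V K)
    (h : ∀ x : unitSpace G, f x.1 = g x.1) : f = g := by
  refine Cc.ext fun γ => ?_
  by_cases hγ : γ ∈ K
  · exact h ⟨γ, hV (hKV hγ)⟩
  · rw [hf.2 _ hγ, hg.2 _ hγ]

/-- The bounded families in the unit fibres that are given by continuous sections on `V` that vanish
outside `K`, as a `*`-subalgebra of the product C*-algebra of the unit fibres. -/
noncomputable def unitSections :
    NonUnitalStarSubalgebra ℂ (lp (fun x : unitSpace G => B.Fib x.1) ∞) where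
  carrier := {a | ∃ f ∈ B.sectionsIn V K, ∀ x : unitSpace G, a x = f x.1}
  add_mem' := by
    rintro a b ⟨f, hf, haf⟩ ⟨g, hg, hbg⟩
    exact ⟨f + g, add_mem_sectionsIn hf hg, fun x => by
      rw [lp.coeFn_add, Pi.add_apply, haf, hbg, Cc.add_apply]⟩
  zero_mem' := ⟨0, zero_mem_sectionsIn, fun x => rfl⟩
  mul_mem' := by
    rintro a b ⟨f, hf, haf⟩ ⟨g, hg, hbg⟩
    exact ⟨f * g, mul_mem_sectionsIn_of_units hV hKV hf hg, fun x => by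
      rw [lp.infty_coeFn_mul, Pi.mul_apply, haf, hbg, mul_apply_unit hV hKV hf hg]⟩
  smul_mem' := by
    rintro c a ⟨f, hf, haf⟩
    exact ⟨c • f, smul_mem_sectionsIn c hf, fun x => by
      rw [lp.coeFn_smul, Pi.smul_apply, haf, Cc.smul_apply]⟩
  star_mem' := by
    rintro a ⟨f, hf, haf⟩
    exact ⟨star f, star_mem_sectionsIn_of_units hV hKV hf, fun x => by
      rw [lp.coeFn_star, Pi.star_apply, haf, star_apply_unit]⟩

theorem isClosed_unitSections (hVo : IsOpen V) (hK : IsCompact K) :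
    IsClosed (unitSections (B := B) hV hKV : Set (lp (fun x : unitSpace G => B.Fib x.1) ∞)) := by
  classical
  refine isClosed_of_closure_subset fun a ha => ?_
  let s : B.Sec := fun γ => if h : γ ∈ unitSpace G then a ⟨γ, h⟩ else 0
  have happ : ∀ ε > (0 : ℝ), ∃ f ∈ B.sectionsIn V K, ∀ x : unitSpace G, ‖s x.1 - f x.1‖ ≤ ε := by
    intro ε hε
    obtain ⟨b, ⟨f, hf, hbf⟩, hab⟩ := Metric.mem_closure_iff.1 ha ε hε
    refine ⟨f, hf, fun x => ?_⟩
    have : s x.1 - f x.1 = (a - b) x := by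
      rw [lp.coeFn_sub, Pi.sub_apply, hbf]
      simp only [s, dif_pos x.2]
    rw [this]
    exact (lp.norm_apply_le_norm ENNReal.top_ne_zero _ _).trans (by rw [← dist_eq_norm]; exact hab.le)
  have hcont : ContinuousOn (fun γ => (s γ).pt) V := by
    refine BanachBundle.continuousOn_of_uniform_approx hVo fun ε hε => ?_
    obtain ⟨f, hf, h⟩ := happ ε hε
    exact ⟨f.1, hf.1, fun γ hγ => h ⟨γ, hV hγ⟩⟩
  have hzero : ∀ γ ∉ K, s γ = 0 := by
    intro γ hγ
    by_cases h : γ ∈ unitSpace G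
    · refine norm_le_zero_iff.1 (le_of_forall_pos_le_add fun ε hε => ?_)
      obtain ⟨f, hf, h'⟩ := happ ε hε
      have := h' ⟨γ, h⟩
      rw [hf.2 γ hγ, sub_zero] at this
      linarith
    · exact dif_neg h
  have hs : B.IsCompactlySupportedOn V s := ⟨hcont, K, hKV, hK, hzero⟩
  exact ⟨⟨s, hs.mem (isBisection_of_subset_unitSpace hVo hV)⟩, ⟨hcont, hzero⟩, fun x => by
    simp only [s, dif_pos x.2]⟩

/-- The inclusion of the C*-algebra of sections over a set of units in `C_c(G; A)`. -/
noncomputable def unitSectionsHom : unitSections (B := B) hV hKV →⋆ₙₐ[ℂ] B.Cc where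
  toFun a := a.2.choose
  map_smul' c a := ext_of_units hV hKV (c • a).2.choose_spec.1
    (smul_mem_sectionsIn c a.2.choose_spec.1) fun x => by
      rw [← (c • a).2.choose_spec.2, MonoidHom.id_apply, Cc.smul_apply, ← a.2.choose_spec.2]; rfl
  map_zero' := ext_of_units hV hKV (0 : unitSections (B := B) hV hKV).2.choose_spec.1
    zero_mem_sectionsIn fun x => by
      rw [← (0 : unitSections (B := B) hV hKV).2.choose_spec.2]; rfl
  map_add' a b := ext_of_units hV hKV (a + b).2.choose_spec.1
    (add_mem_sectionsIn a.2.choose_spec.1 b.2.choose_spec.1) fun x => by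
      rw [← (a + b).2.choose_spec.2, Cc.add_apply, ← a.2.choose_spec.2, ← b.2.choose_spec.2]; rfl
  map_mul' a b := ext_of_units hV hKV (a * b).2.choose_spec.1
    (mul_mem_sectionsIn_of_units hV hKV a.2.choose_spec.1 b.2.choose_spec.1) fun x => by
      rw [← (a * b).2.choose_spec.2, mul_apply_unit hV hKV a.2.choose_spec.1 b.2.choose_spec.1,
        ← a.2.choose_spec.2, ← b.2.choose_spec.2]; rfl
  map_star' a := ext_of_units hV hKV (star a).2.choose_spec.1
    (star_mem_sectionsIn_of_units hV hKV a.2.choose_spec.1) fun x => by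
      rw [← (star a).2.choose_spec.2, star_apply_unit, ← a.2.choose_spec.2]; rfl

include hV hKV in
theorem norm_map_le_of_units (hVo : IsOpen V) (hK : IsCompact K) {C : Type*}
    [NonUnitalCStarAlgebra C] (π : B.Cc →⋆ₙₐ[ℂ] C) {f : B.Cc} (hf : f ∈ B.sectionsIn V K) {β : ℝ}
    (hβ : 0 ≤ β) (hfβ : ∀ γ, ‖f γ‖ ≤ β) : ‖π f‖ ≤ β := by
  have hcl := isClosed_unitSections (B := B) hV hKV hVo hK
  let a₀ : lp (fun x : unitSpace G => B.Fib x.1) ∞ :=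
    ⟨fun x => f x.1, memℓp_infty ⟨β, by rintro _ ⟨x, rfl⟩; exact hfβ x.1⟩⟩
  let a : unitSections (B := B) hV hKV := ⟨a₀, f, hf, fun x => rfl⟩
  have ha : unitSectionsHom hV hKV a = f :=
    ext_of_units hV hKV a.2.choose_spec.1 hf fun x => (a.2.choose_spec.2 x).symm
  have h1 : ‖(π.comp (unitSectionsHom hV hKV)) a‖ ≤ ‖a‖ := NonUnitalStarAlgHom.norm_apply_le _ a
  rw [NonUnitalStarAlgHom.comp_apply, ha] at h1
  exact h1.trans (lp.norm_le_of_forall_le hβ fun x => hfβ x.1)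

end

/-- Every `*`-homomorphism to a C*-algebra is contractive on sections supported on bisections. -/
theorem norm_map_le {C : Type*} [NonUnitalCStarAlgebra C] (π : B.Cc →⋆ₙₐ[ℂ] C) {U K : Set G}
    (hU : IsBisection U) (hK : IsCompact K) (hKU : K ⊆ U) {f : B.Cc} (hf : f ∈ B.sectionsIn U K)
    {β : ℝ} (hβ : 0 ≤ β) (hfβ : ∀ γ, ‖f γ‖ ≤ β) : ‖π f‖ ≤ β := by
  obtain ⟨V, L, hVo, hV, hL, hLV, hh, hbound⟩ := star_mul_self_mem_sectionsIn hU hK hKU hf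
  have h := norm_map_le_of_units hV hLV hVo hL π hh (sq_nonneg β) (hbound β hfβ)
  rw [map_mul, map_star, CStarRing.norm_star_mul_self, ← sq] at h
  exact (pow_le_pow_iff_left₀ (norm_nonneg _) hβ two_ne_zero).1 h

/-- No continuity has to be assumed of a `*`-homomorphism to a C*-algebra. -/
theorem continuous_ilt {C : Type*} [NonUnitalCStarAlgebra C] (π : B.Cc →⋆ₙₐ[ℂ] C) :
    @Continuous B.Cc C B.ilt _ π := by
  refine continuous_inductiveLimit_of_bound (π : B.Cc →ₗ[ℂ] C) ?_
  rintro _ ⟨U, K, hU, hK, hKU, rfl⟩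
  exact ⟨1, fun f hf β hβ hfβ => by rw [one_mul]; exact norm_map_le π hU hK hKU hf hβ hfβ⟩

/-! ### Functions on the units as multipliers -/

theorem continuous_toUnit_inv : Continuous fun γ : G => (toUnit γ⁻¹ : unitSpace G) :=
  continuous_toUnit.comp EtaleGroupoid.continuous_inv

theorem toUnit_inv_eq {γ η : G} (h : src γ = rng η) : (toUnit γ⁻¹ : unitSpace G) = toUnit η :=
  Subtype.ext ((rng_inv γ).trans h)

theorem smul_mem_ccSubmodule (ψ : C(G, ℝ)) (f : B.Cc) :
    (fun γ => (ψ γ : ℂ) • f γ : B.Sec) ∈ B.ccSubmodule := by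
  induction f using Cc.induction with
  | mem f U K hU hK hKU hf =>
    refine IsCompactlySupportedOn.mem hU ⟨?_, K, hKU, hK, fun γ hγ => ?_⟩
    · exact BanachBundle.continuousOn_smul
        (Complex.continuous_ofReal.comp ψ.continuous).continuousOn hf.1
    · rw [hf.2 γ hγ, smul_zero]
  | zero =>
    convert B.ccSubmodule.zero_mem using 1
    funext γ
    exact smul_zero _
  | add f g hf hg => simpa using! B.ccSubmodule.add_mem hf hg
  | smul c f hf =>
    have h := B.ccSubmodule.smul_mem c hf
    convert h using 1
    funext γ
    exact smul_comm _ _ _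

/-- Pointwise multiplication of sections by a continuous function. -/
noncomputable def funMul (ψ : C(G, ℝ)) : B.Cc →ₗ[ℂ] B.Cc where
  toFun f := ⟨_, smul_mem_ccSubmodule ψ f⟩
  map_add' _ _ := Cc.ext fun _ => smul_add _ _ _
  map_smul' _ _ := Cc.ext fun _ => smul_comm _ _ _

theorem funMul_apply (ψ : C(G, ℝ)) (f : B.Cc) (γ : G) : (funMul ψ f) γ = (ψ γ : ℂ) • f γ := rfl

/-- The left multiplication of sections by functions on the units, `(φ f)(γ) = φ(r(γ)) f(γ)`. -/
noncomputable def leftMul (φ : C(unitSpace G, ℝ)) : B.Cc →ₗ[ℂ] B.Cc :=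
  funMul (φ.comp ⟨toUnit, continuous_toUnit⟩)

/-- The right multiplication of sections by functions on the units, `(f φ)(γ) = φ(s(γ)) f(γ)`. -/
noncomputable def rightMul (φ : C(unitSpace G, ℝ)) : B.Cc →ₗ[ℂ] B.Cc :=
  funMul (φ.comp ⟨fun γ => toUnit γ⁻¹, continuous_toUnit_inv⟩)

theorem leftMul_apply (φ : C(unitSpace G, ℝ)) (f : B.Cc) (γ : G) :
    (leftMul φ f) γ = (φ (toUnit γ) : ℂ) • f γ := rfl

theorem rightMul_apply (φ : C(unitSpace G, ℝ)) (f : B.Cc) (γ : G) :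
    (rightMul φ f) γ = (φ (toUnit γ⁻¹) : ℂ) • f γ := rfl

theorem rightMul_mul (φ : C(unitSpace G, ℝ)) (f g : B.Cc) :
    rightMul φ f * g = f * leftMul φ g := by
  refine Cc.ext fun γ => ?_
  rw [Cc.mul_apply, Cc.mul_apply, conv, conv]
  refine finsum_congr fun q => ?_
  rw [leftMul_apply, rightMul_apply, smul_fibMul, fibMul_smul, toUnit_inv_eq q.2.1]

theorem star_leftMul (φ : C(unitSpace G, ℝ)) (f : B.Cc) :
    star (leftMul φ f) = rightMul φ (star f) := by
  refine Cc.ext fun γ => ?_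
  rw [rightMul_apply, Cc.star_apply, Cc.star_apply, secAdj, secAdj, leftMul_apply, fibAdj_smul,
    Complex.conj_ofReal]

theorem leftMul_leftMul (φ ψ : C(unitSpace G, ℝ)) (f : B.Cc) :
    leftMul φ (leftMul ψ f) = leftMul (φ * ψ) f := by
  refine Cc.ext fun γ => ?_
  simp only [leftMul_apply, smul_smul, ContinuousMap.mul_apply, Complex.ofReal_mul]

theorem leftMul_add (φ ψ : C(unitSpace G, ℝ)) :
    (leftMul (φ + ψ) : B.Cc →ₗ[ℂ] B.Cc) = leftMul φ + leftMul ψ := by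
  refine LinearMap.ext fun f => Cc.ext fun γ => ?_
  rw [LinearMap.add_apply, Cc.add_apply]
  simp only [leftMul_apply, ContinuousMap.add_apply, Complex.ofReal_add, add_smul]

theorem leftMul_const (c : ℝ) :
    (leftMul (ContinuousMap.const _ c) : B.Cc →ₗ[ℂ] B.Cc) = (c : ℂ) • LinearMap.id := rfl

/-! ### A Schur test for representations -/

open TensorProduct

section Schur

variable {H : Type*} [NormedAddCommGroup H] [InnerProductSpace ℂ H] [CompleteSpace H]
  (π : B.Cc →⋆ₙₐ[ℂ] (H →L[ℂ] H))

/-- The evaluation `a ⊗ ζ ↦ π(a) ζ`.  Multiplication by functions acts on the first tensor factor,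
so that no operators on `H` that implement it are needed. -/
noncomputable def evalTensor : B.Cc ⊗[ℂ] H →ₗ[ℂ] H :=
  TensorProduct.lift ((ContinuousLinearMap.coeLM ℂ) ∘ₗ (π : B.Cc →ₗ[ℂ] (H →L[ℂ] H)))

theorem evalTensor_tmul (a : B.Cc) (ζ : H) : evalTensor π (a ⊗ₜ ζ) = π a ζ := rfl

/-- The action of a function on the units on the tensor product. -/
noncomputable def tensorMul (φ : C(unitSpace G, ℝ)) : B.Cc ⊗[ℂ] H →ₗ[ℂ] B.Cc ⊗[ℂ] H :=
  LinearMap.rTensor H (leftMul φ)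

omit [CompleteSpace H] in
theorem tensorMul_tmul (φ : C(unitSpace G, ℝ)) (a : B.Cc) (ζ : H) :
    tensorMul φ (a ⊗ₜ ζ) = leftMul φ a ⊗ₜ[ℂ] ζ := rfl

theorem map_rightMul_evalTensor (φ : C(unitSpace G, ℝ)) (g : B.Cc) (e : B.Cc ⊗[ℂ] H) :
    π (rightMul φ g) (evalTensor π e) = π g (evalTensor π (tensorMul φ e)) := by
  induction e with
  | zero => simp
  | tmul a ζ =>
    rw [tensorMul_tmul, evalTensor_tmul, evalTensor_tmul, ← mul_apply_eq_comp,
      ← mul_apply_eq_comp, ← map_mul, ← map_mul, rightMul_mul]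
  | add x y hx hy => simp only [map_add, hx, hy]

theorem inner_map_left (a g : B.Cc) (ζ ξ : H) :
    inner ℂ (π a ζ) (π g ξ) = inner ℂ ζ (π (star a * g) ξ) := by
  rw [map_mul, map_star, mul_apply_eq_comp, ContinuousLinearMap.star_eq_adjoint,
    ContinuousLinearMap.adjoint_inner_right]

theorem inner_evalTensor_leftMul (φ : C(unitSpace G, ℝ)) (g : B.Cc) (e : B.Cc ⊗[ℂ] H) (ξ : H) :
    inner ℂ (evalTensor π e) (π (leftMul φ g) ξ) =
      inner ℂ (evalTensor π (tensorMul φ e)) (π g ξ) := by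
  induction e with
  | zero => simp
  | tmul a ζ =>
    rw [tensorMul_tmul, evalTensor_tmul, evalTensor_tmul, inner_map_left, inner_map_left,
      star_leftMul, rightMul_mul]
  | add x y hx hy => simp only [map_add, inner_add_left, hx, hy]

theorem inner_evalTensor_tensorMul (φ : C(unitSpace G, ℝ)) (e e' : B.Cc ⊗[ℂ] H) :
    inner ℂ (evalTensor π e) (evalTensor π (tensorMul φ e')) =
      inner ℂ (evalTensor π (tensorMul φ e)) (evalTensor π e') := by
  induction e' with
  | zero => simp
  | tmul a ζ => exact inner_evalTensor_leftMul π φ a e ζ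
  | add x y hx hy => simp only [map_add, inner_add_right, hx, hy]

/-- The quadratic form `φ ↦ ⟨e, φ e⟩` of functions on the units. -/
noncomputable def quadForm (e : B.Cc ⊗[ℂ] H) : C(unitSpace G, ℝ) →+ ℝ :=
  AddMonoidHom.mk' (fun φ => (inner ℂ (evalTensor π e) (evalTensor π (tensorMul φ e)) : ℂ).re)
    fun φ ψ => by
      simp only [tensorMul, leftMul_add, LinearMap.rTensor_add, LinearMap.add_apply, map_add,
        inner_add_right, Complex.add_re]

theorem quadForm_apply (e : B.Cc ⊗[ℂ] H) (φ : C(unitSpace G, ℝ)) : quadForm π e φ =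
    (inner ℂ (evalTensor π e) (evalTensor π (tensorMul φ e)) : ℂ).re := rfl

theorem quadForm_const (e : B.Cc ⊗[ℂ] H) (c : ℝ) :
    quadForm π e (ContinuousMap.const _ c) = c * ‖evalTensor π e‖ ^ 2 := by
  rw [quadForm_apply, tensorMul, leftMul_const, LinearMap.rTensor_smul, LinearMap.rTensor_id,
    LinearMap.smul_apply, LinearMap.id_apply, map_smul, inner_smul_right, Complex.re_ofReal_mul]
  congr 1
  exact inner_self_eq_norm_sq (𝕜 := ℂ) _

/-- The square root of a continuous function. -/
noncomputable def sqrtMap {X : Type*} [TopologicalSpace X] (φ : C(X, ℝ)) : C(X, ℝ) :=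
  ⟨fun x => √(φ x), by fun_prop⟩

theorem quadForm_eq_norm_sq (e : B.Cc ⊗[ℂ] H) {φ : C(unitSpace G, ℝ)} (hφ : ∀ x, 0 ≤ φ x) :
    quadForm π e φ = ‖evalTensor π (tensorMul (sqrtMap φ) e)‖ ^ 2 := by
  have h1 : φ = sqrtMap φ * sqrtMap φ := by
    ext x
    simp [sqrtMap, Real.mul_self_sqrt (hφ x)]
  have h2 : tensorMul φ e = tensorMul (sqrtMap φ) (tensorMul (sqrtMap φ) e) := by
    conv_lhs => rw [h1]
    induction e with
    | zero => simp
    | tmul a ζ => rw [tensorMul_tmul, tensorMul_tmul, tensorMul_tmul, leftMul_leftMul]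
    | add x y hx hy => simp only [map_add, hx, hy]
  rw [quadForm_apply, h2, inner_evalTensor_tensorMul]
  exact inner_self_eq_norm_sq (𝕜 := ℂ) _

theorem quadForm_nonneg (e : B.Cc ⊗[ℂ] H) {φ : C(unitSpace G, ℝ)} (hφ : ∀ x, 0 ≤ φ x) :
    0 ≤ quadForm π e φ := by
  rw [quadForm_eq_norm_sq π e hφ]
  positivity

theorem quadForm_le (e : B.Cc ⊗[ℂ] H) {φ : C(unitSpace G, ℝ)} {c : ℝ} (hφ : ∀ x, φ x ≤ c) :
    quadForm π e φ ≤ c * ‖evalTensor π e‖ ^ 2 := by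
  have h := quadForm_nonneg π e (φ := ContinuousMap.const _ c - φ) fun x => by
    simpa using hφ x
  rw [map_sub, quadForm_const] at h
  linarith

/-- The estimate behind the Schur test.  If `‖g‖ ≤ v ∘ r` and `‖g‖ ≤ w ∘ s`, then
`g = (v + δ)^½ g' (w + δ)^½` with `‖g'‖ ≤ 1`. -/
theorem norm_inner_map_le {U K : Set G} (hU : IsBisection U) (hK : IsCompact K) (hKU : K ⊆ U)
    {g : B.Cc} (hg : g ∈ B.sectionsIn U K) {v w : C(unitSpace G, ℝ)}
    (hv : ∀ γ, ‖g γ‖ ≤ v (toUnit γ)) (hw : ∀ γ, ‖g γ‖ ≤ w (toUnit γ⁻¹))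
    (hv0 : ∀ x, 0 ≤ v x) (hw0 : ∀ x, 0 ≤ w x) {δ : ℝ} (hδ : 0 < δ) (e e' : B.Cc ⊗[ℂ] H) :
    ‖(inner ℂ (evalTensor π e') (π g (evalTensor π e)) : ℂ)‖ ≤
      (quadForm π e' (v + ContinuousMap.const _ δ) +
        quadForm π e (w + ContinuousMap.const _ δ)) / 2 := by
  set v' := v + ContinuousMap.const _ δ with hv'
  set w' := w + ContinuousMap.const _ δ with hw'
  have hv'x : ∀ x, 0 < v' x := fun x => by
    simpa [hv'] using add_pos_of_nonneg_of_pos (hv0 x) hδ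
  have hw'x : ∀ x, 0 < w' x := fun x => by
    simpa [hw'] using add_pos_of_nonneg_of_pos (hw0 x) hδ
  have hpos : ∀ γ : G, 0 < √(v' (toUnit γ)) * √(w' (toUnit γ⁻¹)) := fun γ =>
    mul_pos (Real.sqrt_pos.2 (hv'x _)) (Real.sqrt_pos.2 (hw'x _))
  let ψ : C(G, ℝ) := ⟨fun γ => (√(v' (toUnit γ)) * √(w' (toUnit γ⁻¹)))⁻¹, by
    refine Continuous.inv₀ ?_ fun γ => (hpos γ).ne'
    exact ((v'.continuous.comp continuous_toUnit).sqrt).mul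
      ((w'.continuous.comp continuous_toUnit_inv).sqrt)⟩
  let g' : B.Cc := funMul ψ g
  have hg' : g' ∈ B.sectionsIn U K :=
    ⟨BanachBundle.continuousOn_smul
      (Complex.continuous_ofReal.comp ψ.continuous).continuousOn hg.1, fun γ hγ => by
        rw [funMul_apply, hg.2 γ hγ, smul_zero]⟩
  have hg'1 : ∀ γ, ‖g' γ‖ ≤ 1 := by
    intro γ
    have hψ : ‖ψ γ‖ = (√(v' (toUnit γ)) * √(w' (toUnit γ⁻¹)))⁻¹ :=
      Real.norm_of_nonneg (inv_nonneg.2 (hpos γ).le)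
    rw [funMul_apply, norm_smul, Complex.norm_real, hψ, inv_mul_le_one₀ (hpos γ), ← Real.sqrt_mul (hv'x _).le]
    refine Real.le_sqrt_of_sq_le ?_
    rw [sq]
    refine mul_le_mul ((hv γ).trans ?_) ((hw γ).trans ?_) (norm_nonneg _) (hv'x _).le
    · simpa [hv'] using hδ.le
    · simpa [hw'] using hδ.le
  have hgg' : g = leftMul (sqrtMap v') (rightMul (sqrtMap w') g') := by
    refine Cc.ext fun γ => ?_
    rw [leftMul_apply, rightMul_apply, funMul_apply, smul_smul, smul_smul, ← Complex.ofReal_mul,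
      ← Complex.ofReal_mul]
    have : sqrtMap v' (toUnit γ) * sqrtMap w' (toUnit γ⁻¹) * ψ γ = 1 :=
      mul_inv_cancel₀ (hpos γ).ne'
    rw [this]
    simp
  have hle : ‖π g'‖ ≤ 1 := norm_map_le π hU hK hKU hg' zero_le_one hg'1
  rw [quadForm_eq_norm_sq π e' fun x => (hv'x x).le, quadForm_eq_norm_sq π e fun x => (hw'x x).le,
    hgg', inner_evalTensor_leftMul, map_rightMul_evalTensor]
  refine (norm_inner_le_norm _ _).trans ?_
  have h1 := (π g').le_of_opNorm_le hle (evalTensor π (tensorMul (sqrtMap w') e))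
  have h2 := mul_le_mul_of_nonneg_left h1
    (norm_nonneg (evalTensor π (tensorMul (sqrtMap v') e')))
  nlinarith [sq_nonneg (‖evalTensor π (tensorMul (sqrtMap v') e')‖ -
    ‖evalTensor π (tensorMul (sqrtMap w') e)‖)]

omit [CompleteSpace H] in
theorem opNorm_le_of_norm_inner_le {S : H →L[ℂ] H} {c : ℝ} (hc : 0 ≤ c)
    (h : ∀ ξ η, ‖(inner ℂ η (S ξ) : ℂ)‖ ≤ c * (‖η‖ ^ 2 + ‖ξ‖ ^ 2) / 2) : ‖S‖ ≤ c := by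
  refine S.opNorm_le_bound hc fun ξ => ?_
  rcases eq_or_ne (S ξ) 0 with h0 | h0
  · rw [h0, norm_zero]; positivity
  have hS : 0 < ‖S ξ‖ := norm_pos_iff.2 h0
  have hξ : 0 < ‖ξ‖ := norm_pos_iff.2 fun h' => h0 (by rw [h', map_zero])
  -- test against the multiple of `S ξ` that has the norm of `ξ`
  have h1 := h ξ (((‖ξ‖ / ‖S ξ‖ : ℝ) : ℂ) • S ξ)
  rw [inner_smul_left, norm_mul, norm_smul, Complex.conj_ofReal, Complex.norm_real,
    Real.norm_of_nonneg (by positivity), div_mul_cancel₀ _ hS.ne', inner_self_eq_norm_sq_to_K] at h1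
  have h2 : ‖((‖S ξ‖ : ℂ)) ^ 2‖ = ‖S ξ‖ ^ 2 := by simp
  erw [h2] at h1
  have h3 : ‖ξ‖ / ‖S ξ‖ * ‖S ξ‖ ^ 2 = ‖ξ‖ * ‖S ξ‖ := by field_simp
  rw [h3] at h1
  have h4 : ‖ξ‖ * ‖S ξ‖ ≤ ‖ξ‖ * (c * ‖ξ‖) := by nlinarith
  exact le_of_mul_le_mul_left h4 hξ

/-- Schur test: a section that is a sum of sections `g p` supported on bisections, with
`‖g p‖ ≤ v p ∘ r` and `‖g p‖ ≤ w p ∘ s`, where the functions `v p` and `w p` sum up to at most `c`, acts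
with norm at most `c`. -/
theorem norm_map_le_of_schur (hπ : B.IsNondegenerate π) {ι : Type*} (t : Finset ι) {g : ι → B.Cc}
    {U K : ι → Set G} (hU : ∀ p ∈ t, IsBisection (U p)) (hK : ∀ p ∈ t, IsCompact (K p))
    (hKU : ∀ p ∈ t, K p ⊆ U p) (hg : ∀ p ∈ t, g p ∈ B.sectionsIn (U p) (K p))
    {v w : ι → C(unitSpace G, ℝ)}
    (hv : ∀ p ∈ t, ∀ γ, ‖g p γ‖ ≤ v p (toUnit γ))
    (hw : ∀ p ∈ t, ∀ γ, ‖g p γ‖ ≤ w p (toUnit γ⁻¹))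
    (hv0 : ∀ p ∈ t, ∀ x, 0 ≤ v p x) (hw0 : ∀ p ∈ t, ∀ x, 0 ≤ w p x) {c : ℝ} (hc : 0 ≤ c)
    (hvc : ∀ x, ∑ p ∈ t, v p x ≤ c) (hwc : ∀ x, ∑ p ∈ t, w p x ≤ c) :
    ‖π (∑ p ∈ t, g p)‖ ≤ c := by
  have key : ∀ e e' : B.Cc ⊗[ℂ] H,
      ‖(inner ℂ (evalTensor π e') (π (∑ p ∈ t, g p) (evalTensor π e)) : ℂ)‖ ≤
        c * (‖evalTensor π e'‖ ^ 2 + ‖evalTensor π e‖ ^ 2) / 2 := by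
    intro e e'
    have hδ : ∀ δ > (0 : ℝ),
        ‖(inner ℂ (evalTensor π e') (π (∑ p ∈ t, g p) (evalTensor π e)) : ℂ)‖ ≤
        (c + δ * t.card) * (‖evalTensor π e'‖ ^ 2 + ‖evalTensor π e‖ ^ 2) / 2 := by
      intro δ hδ
      rw [map_sum, sum_apply, inner_sum]
      have h1 : ∀ (e : B.Cc ⊗[ℂ] H) (v : ι → C(unitSpace G, ℝ)), (∀ x, ∑ p ∈ t, v p x ≤ c) →
          ∑ p ∈ t, quadForm π e (v p + ContinuousMap.const _ δ) ≤
            (c + δ * t.card) * ‖evalTensor π e‖ ^ 2 := by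
        intro e v hvc
        rw [← map_sum]
        refine quadForm_le π e fun x => ?_
        rw [ContinuousMap.sum_apply]
        simp only [ContinuousMap.add_apply, ContinuousMap.const_apply, Finset.sum_add_distrib,
          Finset.sum_const, nsmul_eq_mul]
        linarith [hvc x]
      refine (norm_sum_le _ _).trans ((Finset.sum_le_sum fun p hp =>
        norm_inner_map_le π (hU p hp) (hK p hp) (hKU p hp) (hg p hp) (hv p hp) (hw p hp)
          (hv0 p hp) (hw0 p hp) hδ e e').trans ?_)
      rw [← Finset.sum_div, Finset.sum_add_distrib]
      linarith [h1 e' v hvc, h1 e w hwc]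
    have hlim : Tendsto (fun δ : ℝ =>
        (c + δ * t.card) * (‖evalTensor π e'‖ ^ 2 + ‖evalTensor π e‖ ^ 2) / 2) (𝓝[>] 0)
        (𝓝 ((c + 0 * t.card) * (‖evalTensor π e'‖ ^ 2 + ‖evalTensor π e‖ ^ 2) / 2)) := by
      refine Tendsto.mono_left (Continuous.tendsto ?_ 0) nhdsWithin_le_nhds
      fun_prop
    have := ge_of_tendsto hlim (eventually_mem_nhdsWithin.mono fun δ hδ' => hδ δ hδ')
    simpa using this
  have hdense : DenseRange (evalTensor π) := by
    refine Dense.mono ?_ hπ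
    rw [← LinearMap.coe_range]
    refine Submodule.span_le.2 ?_
    rintro _ ⟨f, ξ, rfl⟩
    exact ⟨f ⊗ₜ ξ, rfl⟩
  refine opNorm_le_of_norm_inner_le hc fun ξ η => ?_
  refine hdense.induction_on₂
    (p := fun ξ η => ‖(inner ℂ η (π (∑ p ∈ t, g p) ξ) : ℂ)‖ ≤ c * (‖η‖ ^ 2 + ‖ξ‖ ^ 2) / 2)
    (isClosed_le (by fun_prop) (by fun_prop)) (fun e e' => key e e') ξ η

end Schur

end FellBundle

/-! ### Local decompositions of sections -/

/-- Let `f = ∑ F i`, where `F i` is supported on an open set `U i` on which `π` is injective, and let the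
norms of the values of `f` over each point have sum at most `c₀ < c`.  Near `x`, the summands that do not
vanish are grouped according to the point of `U i` over `x`.  Summands in the same group live on the
same set, and by upper semicontinuity their sum is nearly bounded by the norm of the value of `f` at
that point.  The weights `τ` distribute this bound evenly over the group. -/
theorem BanachBundle.exists_local_weights {G : Type u} {A : Type v} [TopologicalSpace G]
    [TopologicalSpace A] {B : BanachBundle G A} {X : Type*} [TopologicalSpace X] [T2Space X] [Nonempty G]
    {π : G → X} (hπ : Continuous π) (hπo : IsOpenMap π) {ι : Type*} [Fintype ι]
    {F : ι → ∀ γ, Fibre B.proj γ} {U K : ι → Set G} (hU : ∀ i, IsOpen (U i))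
    (hinj : ∀ i, InjOn π (U i)) (hK : ∀ i, IsCompact (K i)) (hKU : ∀ i, K i ⊆ U i)
    (hcont : ∀ i, ContinuousOn (fun γ => (F i γ).pt) (U i)) (hzero : ∀ i, ∀ γ ∉ K i, F i γ = 0)
    {c₀ c : ℝ} (hc : c₀ < c)
    (hsum : ∀ (x : X) (t : Finset G), (∀ γ ∈ t, π γ = x) → ∑ γ ∈ t, ‖∑ i, F i γ‖ ≤ c₀) (x : X) :
    ∃ (W : Set X) (I : Finset ι) (τ : ι → ℝ), IsOpen W ∧ x ∈ W ∧ (∀ i, 0 ≤ τ i) ∧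
      ∑ i ∈ I, τ i ≤ c ∧ (∀ i ∉ I, ∀ γ, π γ ∈ W → F i γ = 0) ∧ (∀ i ∈ I, W ⊆ π '' U i) ∧
      ∀ J ⊆ I, (∀ i ∈ J, ∀ j ∈ I, U i ∩ π ⁻¹' W = U j ∩ π ⁻¹' W → j ∈ J) →
        ∀ γ, π γ ∈ W → ‖∑ i ∈ J, F i γ‖ ≤ ∑ i ∈ J, τ i := by
  classical
  let I : Finset ι := Finset.univ.filter fun i => x ∈ π '' K i
  have hI : ∀ i, i ∈ I ↔ x ∈ π '' K i := fun i => by simp [I]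
  have hex : ∀ i, i ∈ I → ∃ γ ∈ K i, π γ = x := fun i hi => (hI i).1 hi
  choose! p hpK hpx using hex
  let f : ∀ γ, Fibre B.proj γ := fun γ => ∑ i, F i γ
  let ε : ℝ := (c - c₀) / (Fintype.card ι + 1)
  have hε : 0 < ε := div_pos (by linarith) (by positivity)
  let cls : G → Finset ι := fun y => I.filter fun i => p i = y
  let τ : ι → ℝ := fun i => (‖f (p i)‖ + ε) / (cls (p i)).card
  have hτ : ∀ i ∈ I, ∑ j ∈ cls (p i), τ j = ‖f (p i)‖ + ε := by
    intro i hi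
    have h1 : ∀ j ∈ cls (p i), τ j = (‖f (p i)‖ + ε) / (cls (p i)).card := by
      intro j hj
      have : p j = p i := (Finset.mem_filter.1 hj).2
      simp only [τ]
      rw [this]
    have h2 : ((cls (p i)).card : ℝ) ≠ 0 := by
      have : i ∈ cls (p i) := Finset.mem_filter.2 ⟨hi, rfl⟩
      exact_mod_cast (Finset.card_pos.2 ⟨i, this⟩).ne'
    rw [Finset.sum_congr rfl h1, Finset.sum_const, nsmul_eq_mul, mul_div_cancel₀ _ h2]
  -- the group of `i` accounts for the whole value of `f` at `p i`
  have hval : ∀ i ∈ I, ∑ j ∈ cls (p i), F j (p i) = f (p i) := by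
    intro i hi
    refine Finset.sum_subset (Finset.subset_univ _) fun j _ hj => hzero j _ fun hm => hj ?_
    have hjI : j ∈ I := (hI j).2 ⟨p i, hm, hpx i hi⟩
    refine Finset.mem_filter.2 ⟨hjI, ?_⟩
    exact hinj j (hKU j (hpK j hjI)) (hKU j hm) ((hpx j hjI).trans (hpx i hi).symm)
  have hnear : ∀ i ∈ I, ∃ N : Set G, IsOpen N ∧ p i ∈ N ∧ (∀ j ∈ cls (p i), N ⊆ U j) ∧
      ∀ γ ∈ N, ‖∑ j ∈ cls (p i), F j γ‖ < ‖f (p i)‖ + ε := by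
    intro i hi
    have hmem : ∀ j ∈ cls (p i), p i ∈ U j := fun j hj => by
      have h := Finset.mem_filter.1 hj
      rw [← h.2]; exact hKU j (hpK j h.1)
    have h1 : ∀ᶠ γ in 𝓝 (p i), ∀ j ∈ cls (p i), γ ∈ U j :=
      (Filter.eventually_all_finset _).2 fun j hj => (hU j).mem_nhds (hmem j hj)
    have h2 : ContinuousOn (fun γ => (∑ j ∈ cls (p i), F j γ).pt) (⋂ j ∈ cls (p i), U j) :=
      continuousOn_sum _ F fun j hj => (hcont j).mono (biInter_subset_of_mem hj)
    have h3 : (⋂ j ∈ cls (p i), U j) ∈ 𝓝 (p i) :=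
      (isOpen_biInter_finset fun j _ => hU j).mem_nhds (mem_iInter₂.2 hmem)
    have h4 := B.eventually_norm_lt (p := fun γ => γ) (fun γ => ∑ j ∈ cls (p i), F j γ)
      (a₀ := ∑ j ∈ cls (p i), F j (p i)) (h2.continuousAt h3) (r := ‖f (p i)‖ + ε) (by
        rw [hval i hi]; linarith)
    obtain ⟨N, hN, hNo, hpN⟩ := eventually_nhds_iff.1 (h1.and h4)
    exact ⟨N, hNo, hpN, fun j hj γ hγ => (hN γ hγ).1 j hj, fun γ hγ => (hN γ hγ).2⟩
  choose! N hNo hpN hNU hNlt using hnear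
  let W : Set X := ⋂ i, if i ∈ I then π '' N i else (π '' K i)ᶜ
  have hWI : ∀ i ∈ I, W ⊆ π '' N i := fun i hi =>
    (iInter_subset _ i).trans (by rw [if_pos hi])
  have hWI' : ∀ i ∉ I, W ⊆ (π '' K i)ᶜ := fun i hi =>
    (iInter_subset _ i).trans (by rw [if_neg hi])
  have hself : ∀ i ∈ I, i ∈ cls (p i) := fun i hi => Finset.mem_filter.2 ⟨hi, rfl⟩
  have hmemN : ∀ i ∈ I, ∀ j ∈ cls (p i), ∀ γ ∈ U j, π γ ∈ W → γ ∈ N i := by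
    intro i hi j hj γ hγ hW
    obtain ⟨γ', hγ', h⟩ := hWI i hi hW
    rwa [← hinj j (hNU i hi j hj hγ') hγ h]
  have hcls : ∀ i ∈ I, ∀ γ, π γ ∈ W → ‖∑ j ∈ cls (p i), F j γ‖ ≤ ‖f (p i)‖ + ε := by
    intro i hi γ hγ
    by_cases h : γ ∈ N i
    · exact (hNlt i hi γ h).le
    · rw [Finset.sum_eq_zero fun j hj => hzero j γ fun hm =>
        h (hmemN i hi j hj γ (hKU j hm) hγ), norm_zero]
      positivity
  refine ⟨W, I, τ, isOpen_iInter_of_finite fun i => ?_, mem_iInter.2 fun i => ?_, fun i => ?_, ?_,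
    fun i hi γ hγ => hzero i γ fun hm => hWI' i hi hγ ⟨γ, hm, rfl⟩, fun i hi => ?_, ?_⟩
  · split_ifs with hi
    · exact hπo _ (hNo i hi)
    · exact ((hK i).image hπ).isClosed.isOpen_compl
  · split_ifs with hi
    · exact ⟨p i, hpN i hi, hpx i hi⟩
    · exact fun h => hi ((hI i).2 h)
  · positivity
  · have h1 : ∑ i ∈ I, τ i = ∑ y ∈ I.image p, (‖f y‖ + ε) := by
      rw [← Finset.sum_fiberwise_of_maps_to (g := p) (t := I.image p)
        fun i hi => Finset.mem_image_of_mem p hi]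
      refine Finset.sum_congr rfl fun y hy => ?_
      obtain ⟨i, hi, rfl⟩ := Finset.mem_image.1 hy
      exact hτ i hi
    have h2 : ∑ y ∈ I.image p, ‖f y‖ ≤ c₀ := hsum x _ fun y hy => by
      obtain ⟨i, hi, rfl⟩ := Finset.mem_image.1 hy
      exact hpx i hi
    have h3 : ((I.image p).card : ℝ) ≤ Fintype.card ι + 1 := by
      have := Finset.card_image_le (s := I) (f := p)
      have := Finset.card_le_univ I
      exact_mod_cast (by omega : (I.image p).card ≤ Fintype.card ι + 1)
    have h4 : (Fintype.card ι + 1 : ℝ) * ε = c - c₀ := by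
      simp only [ε]; field_simp
    rw [h1, Finset.sum_add_distrib, Finset.sum_const, nsmul_eq_mul]
    nlinarith
  · exact (hWI i hi).trans (image_mono (hNU i hi i (hself i hi)))
  · intro J hJ hsat γ hγ
    have hset : ∀ i ∈ I, ∀ j ∈ I, p i = p j → U i ∩ π ⁻¹' W ⊆ U j ∩ π ⁻¹' W := by
      rintro i hi j hj hij γ ⟨h, hW⟩
      exact ⟨hNU i hi j (Finset.mem_filter.2 ⟨hj, hij.symm⟩)
        (hmemN i hi i (hself i hi) γ h hW), hW⟩
    have hfib : ∀ i ∈ J, J.filter (fun j => p j = p i) = cls (p i) := by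
      intro i hi
      ext j
      simp only [Finset.mem_filter, cls]
      refine ⟨fun h => ⟨hJ h.1, h.2⟩, fun h => ⟨hsat i hi j h.1 ?_, h.2⟩⟩
      exact (hset i (hJ hi) j h.1 h.2.symm).antisymm (hset j h.1 i (hJ hi) h.2)
    rw [← Finset.sum_fiberwise_of_maps_to (g := p) (t := J.image p)
        fun i hi => Finset.mem_image_of_mem p hi,
      ← Finset.sum_fiberwise_of_maps_to (g := p) (t := J.image p)
        fun i hi => Finset.mem_image_of_mem p hi]
    refine norm_sum_le_of_le _ fun y hy => ?_
    obtain ⟨i, hi, rfl⟩ := Finset.mem_image.1 hy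
    rw [hfib i hi, hτ i (hJ hi)]
    exact hcls i (hJ hi) γ hγ

/-- A partition of unity on a compact set, subordinate to a choice of neighbourhoods. -/
theorem exists_partition {X : Type*} [TopologicalSpace X] [T2Space X] [LocallyCompactSpace X]
    {R : Set X} (hR : IsCompact R) {W : X → Set X} (hW : ∀ x, IsOpen (W x)) (hxW : ∀ x, x ∈ W x) :
    ∃ (t : Finset X) (φ : t → C(X, ℝ)), (∀ a, tsupport (φ a) ⊆ W a) ∧ (∀ a x, 0 ≤ φ a x) ∧
      (∀ x, ∑ a, φ a x ≤ 1) ∧ ∀ x ∈ R, ∑ a, φ a x = 1 := by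
  obtain ⟨t, -, ht⟩ := hR.elim_nhds_subcover W fun x _ => (hW x).mem_nhds (hxW x)
  obtain ⟨f, hf, -⟩ := PartitionOfUnity.exists_isSubordinate_of_locallyFinite_t2space hR
    (fun a : t => W a) (fun a => hW a) (locallyFinite_of_finite _) (by
      intro x hx
      obtain ⟨a, ha, hxa⟩ := mem_iUnion₂.1 (ht hx)
      exact mem_iUnion.2 ⟨⟨a, ha⟩, hxa⟩)
  refine ⟨t, fun a => f a, hf, fun a x => f.nonneg a x, fun x => ?_, fun x hx => ?_⟩
  · rw [← finsum_eq_sum_of_fintype]; exact f.sum_le_one x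
  · rw [← finsum_eq_sum_of_fintype]; exact f.sum_eq_one hx

/-- An open map is a homeomorphism from each open set on which it is injective to its image. -/
theorem exists_continuousOn_inverse {Y X : Type*} [TopologicalSpace Y] [TopologicalSpace X]
    [Nonempty Y] {π : Y → X} (hπo : IsOpenMap π) {U : Set Y} (hU : IsOpen U) (hinj : InjOn π U) :
    ∃ σ : X → Y, (∀ x ∈ π '' U, σ x ∈ U ∧ π (σ x) = x) ∧ ContinuousOn σ (π '' U) := by
  refine ⟨Function.invFunOn π U, fun x hx =>
    ⟨Function.invFunOn_mem hx, Function.invFunOn_eq hx⟩, ?_⟩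
  rw [continuousOn_iff']
  intro t ht
  refine ⟨π '' (U ∩ t), hπo _ (hU.inter ht), ?_⟩
  ext x
  constructor
  · rintro ⟨hx, hxU⟩
    exact ⟨⟨_, ⟨Function.invFunOn_mem hxU, hx⟩, Function.invFunOn_eq hxU⟩, hxU⟩
  · rintro ⟨⟨y, ⟨hyU, hyt⟩, rfl⟩, hxU⟩
    refine ⟨?_, hxU⟩
    change Function.invFunOn π U (π y) ∈ t
    rwa [hinj (Function.invFunOn_mem hxU) hyU (Function.invFunOn_eq hxU)]

/-- A continuous function times a function that is continuous on a neighbourhood of its support. -/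
theorem continuous_mul_of_tsupport_subset {X : Type*} [TopologicalSpace X] (φ : C(X, ℝ)) {W : Set X}
    (hW : IsOpen W) (hφ : tsupport φ ⊆ W) {h : X → ℝ} (hh : ContinuousOn h W) :
    Continuous fun x => φ x * h x := by
  rw [continuous_iff_continuousAt]
  intro x
  by_cases hx : x ∈ W
  · exact φ.continuous.continuousAt.mul (hh.continuousAt (hW.mem_nhds hx))
  · have h1 : (tsupport φ)ᶜ ∈ 𝓝 x :=
      (isClosed_tsupport _).isOpen_compl.mem_nhds fun h' => hx (hφ h')
    refine (continuousAt_const (y := (0 : ℝ))).congr ?_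
    filter_upwards [h1] with y hy
    rw [image_eq_zero_of_notMem_tsupport hy, zero_mul]

/-- The weights `τ i` are transported along the inverses of `π` on the sets `U i` and cut down by a
function `φ` in the base point and by the members `φ' b` of a partition of unity in the image under
`π'`.  Summed over `b` and over the labels `P b i`, the resulting functions are bounded by `c φ`. -/
theorem exists_majorants {Y X : Type*} [TopologicalSpace Y] [TopologicalSpace X]
    [Nonempty Y] {π π' : Y → X} (hπo : IsOpenMap π) (hπ' : Continuous π') {ι β κ : Type*}
    [Fintype β] [DecidableEq κ] {U : ι → Set Y} (hU : ∀ i, IsOpen (U i))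
    (hinj : ∀ i, InjOn π (U i)) {W : Set X} (hW : IsOpen W) {I : Finset ι}
    (hWU : ∀ i ∈ I, W ⊆ π '' U i) {τ : ι → ℝ} (hτ : ∀ i, 0 ≤ τ i) {c : ℝ}
    (hτc : ∑ i ∈ I, τ i ≤ c) {φ : C(X, ℝ)} (hφW : tsupport φ ⊆ W) (hφ : ∀ x, 0 ≤ φ x)
    {φ' : β → C(X, ℝ)} (hφ' : ∀ b x, 0 ≤ φ' b x) (hφ'1 : ∀ x, ∑ b, φ' b x ≤ 1)
    (P : β → ι → κ) (S : Finset κ) (hPS : ∀ b i, P b i ∈ S) :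
    ∃ v : β → κ → C(X, ℝ), (∀ b y x, 0 ≤ v b y x) ∧ (∀ x, ∑ b, ∑ y ∈ S, v b y x ≤ c * φ x) ∧
      ∀ b y γ, π γ ∈ W → (∀ i ∈ I, P b i = y → γ ∈ U i) →
        φ (π γ) * φ' b (π' γ) * ∑ i ∈ I with P b i = y, τ i ≤ v b y (π γ) := by
  classical
  choose σ hσ hσc using fun i => exists_continuousOn_inverse hπo (hU i) (hinj i)
  let k : β → ι → C(X, ℝ) := fun b i =>
    if hi : i ∈ I then ⟨fun x => φ x * φ' b (π' (σ i x)),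
      continuous_mul_of_tsupport_subset φ hW hφW ((φ' b).continuous.comp_continuousOn
        (hπ'.comp_continuousOn ((hσc i).mono (hWU i hi))))⟩ else 0
  have hk : ∀ b, ∀ i ∈ I, ∀ x, k b i x = φ x * φ' b (π' (σ i x)) := fun b i hi x => by
    simp only [k, dif_pos hi]; rfl
  have hk0 : ∀ b, ∀ i ∈ I, ∀ x, 0 ≤ k b i x := fun b i hi x => by
    rw [hk b i hi]; exact mul_nonneg (hφ _) (hφ' _ _)
  refine ⟨fun b y => ∑ i ∈ I with P b i = y, τ i • k b i, fun b y x => ?_, fun x => ?_,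
    fun b y γ hγ hU => ?_⟩
  · rw [ContinuousMap.sum_apply]
    refine Finset.sum_nonneg fun i hi => ?_
    exact mul_nonneg (hτ i) (hk0 b i (Finset.mem_filter.1 hi).1 x)
  · simp only [ContinuousMap.sum_apply, ContinuousMap.smul_apply, smul_eq_mul]
    have h1 : ∀ b, ∑ y ∈ S, ∑ i ∈ I with P b i = y, τ i * k b i x = ∑ i ∈ I, τ i * k b i x :=
      fun b => Finset.sum_fiberwise_of_maps_to (fun i _ => hPS b i) _
    rw [Finset.sum_congr rfl fun b _ => h1 b, Finset.sum_comm]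
    have h2 : ∀ i ∈ I, ∑ b, τ i * k b i x ≤ τ i * φ x := by
      intro i hi
      rw [← Finset.mul_sum, Finset.sum_congr rfl fun b _ => hk b i hi x, ← Finset.mul_sum]
      exact mul_le_mul_of_nonneg_left (mul_le_of_le_one_right (hφ x) (hφ'1 _)) (hτ i)
    refine (Finset.sum_le_sum h2).trans ?_
    rw [← Finset.sum_mul]
    exact mul_le_mul_of_nonneg_right hτc (hφ x)
  · rw [ContinuousMap.sum_apply, Finset.mul_sum]
    refine le_of_eq (Finset.sum_congr rfl fun i hi => ?_)
    obtain ⟨hi, hiy⟩ := Finset.mem_filter.1 hi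
    have h3 := hσ i _ (hWU i hi hγ)
    rw [ContinuousMap.smul_apply, hk b i hi, hinj i h3.1 (hU i hi hiy) h3.2, smul_eq_mul]
    ring

namespace FellBundle

variable {G : Type u} {A : Type v} [TopologicalSpace G] [EtaleGroupoid G] [TopologicalSpace A]
  {B : FellBundle G A}

/-! ### The bound by the `I`-norm -/

theorem isOpenMap_toUnit_inv : IsOpenMap fun γ : G => (toUnit γ⁻¹ : unitSpace G) :=
  isOpenMap_toUnit.comp (IsOpenMap.of_inverse EtaleGroupoid.continuous_inv inv_inv_arrow
    inv_inv_arrow)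

section

variable {H : Type*} [NormedAddCommGroup H] [InnerProductSpace ℂ H] [CompleteSpace H]
  (π : B.Cc →⋆ₙₐ[ℂ] (H →L[ℂ] H))

/-- The estimate by the `I`-norm.  Two covers of the units, adapted to `f` through the range and the
source map, cut the arrows into the sets `r⁻¹(Wr a) ∩ s⁻¹(Ws b)`.  On each of them the bisections that
carry `f` are sorted by their trace, and the summands with the same trace are added up.  Sorting by
trace is coarser than both local groupings, so that the weights of either of them bound the pieces. -/
theorem norm_map_le_of_sum_le (hπ : B.IsNondegenerate π) (f : B.Cc) {c₀ : ℝ} (hc₀ : 0 ≤ c₀)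
    (hr : ∀ (x : G) (t : Finset G), (∀ γ ∈ t, rng γ = x) → ∑ γ ∈ t, ‖f γ‖ ≤ c₀)
    (hs : ∀ (x : G) (t : Finset G), (∀ γ ∈ t, src γ = x) → ∑ γ ∈ t, ‖f γ‖ ≤ c₀) :
    ‖π f‖ ≤ c₀ := by
  classical
  rcases isEmpty_or_nonempty G with hG | hG
  · have h0 : f = 0 := Cc.ext fun γ => (hG.false γ).elim
    rwa [h0, map_zero, norm_zero]
  have hT2 := EtaleGroupoid.t2Space_units (G := G)
  have hLC := EtaleGroupoid.locallyCompactSpace_units (G := G)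
  refine le_of_forall_gt_imp_ge_of_dense fun c hc => ?_
  have hc0 : 0 ≤ c := hc₀.trans hc.le
  obtain ⟨n, F, U, K, hF, rfl⟩ := f.exists_sum
  have hU : ∀ i, IsOpen (U i) := fun i => (hF i).1.isOpen
  have hr_inj : ∀ i, InjOn (toUnit : G → unitSpace G) (U i) := fun i a ha b hb h =>
    (hF i).1.injOn_rng ha hb (congrArg Subtype.val h)
  have hs_inj : ∀ i, InjOn (fun γ : G => (toUnit γ⁻¹ : unitSpace G)) (U i) :=
    fun i a ha b hb h => (hF i).1.injOn_src ha hb (by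
      simpa [toUnit, rng_inv, Subtype.ext_iff] using h)
  have hKU : ∀ i, K i ⊆ U i := fun i => (hF i).2.2.1
  have hF0 : ∀ i, ∀ γ ∉ K i, F i γ = 0 := fun i => (hF i).2.2.2.2
  have hFU : ∀ i γ, γ ∉ U i → F i γ = 0 := fun i γ hγ => hF0 i γ fun h => hγ (hKU i h)
  choose Wr Ir τr hWro hxWr hτr hτrc hrI hrW hrJ using
    BanachBundle.exists_local_weights (B := B.toBanachBundle) (F := fun i => (F i).1)
      continuous_toUnit isOpenMap_toUnit hU hr_inj
      (fun i => (hF i).2.1) hKU (fun i => (hF i).2.2.2.1) hF0 hc (fun x t ht => by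
        have := hr x.1 t fun γ hγ => congrArg Subtype.val (ht γ hγ)
        simpa only [Cc.sum_apply] using this)
  choose Ws Is τs hWso hxWs hτs hτsc hsI hsW hsJ using
    BanachBundle.exists_local_weights (B := B.toBanachBundle) (F := fun i => (F i).1)
      continuous_toUnit_inv isOpenMap_toUnit_inv hU hs_inj
      (fun i => (hF i).2.1) hKU (fun i => (hF i).2.2.2.1) hF0 hc (fun x t ht => by
        have := hs x.1 t fun γ hγ => (rng_inv γ).symm.trans (congrArg Subtype.val (ht γ hγ))
        simpa only [Cc.sum_apply] using this)
  obtain ⟨tr, φ, hφW, hφ0, hφ1, hφ⟩ := exists_partition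
    (isCompact_iUnion fun i => (hF i).2.1.image continuous_toUnit) hWro hxWr
  obtain ⟨ts, ψ, hψW, hψ0, hψ1, hψ⟩ := exists_partition
    (isCompact_iUnion fun i => (hF i).2.1.image continuous_toUnit_inv) hWso hxWs
  let P : tr → ts → Fin n → Set G := fun a b i =>
    U i ∩ toUnit ⁻¹' Wr a ∩ (fun γ : G => (toUnit γ⁻¹ : unitSpace G)) ⁻¹' Ws b
  let S : Finset (Set G) := Finset.univ.image fun q : tr × ts × Fin n => P q.1 q.2.1 q.2.2
  have hPS : ∀ a b i, P a b i ∈ S := fun a b i =>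
    Finset.mem_image.2 ⟨(a, b, i), Finset.mem_univ _, rfl⟩
  have hφmem : ∀ a γ, φ a (toUnit γ) ≠ 0 → toUnit γ ∈ Wr a := fun a γ h =>
    hφW a (subset_tsupport _ h)
  have hψmem : ∀ b (γ : G), ψ b (toUnit γ⁻¹) ≠ 0 → toUnit γ⁻¹ ∈ Ws b := fun b γ h =>
    hψW b (subset_tsupport _ h)
  choose v hv0 hvc hv using fun a : tr => exists_majorants (c := c) isOpenMap_toUnit
    continuous_toUnit_inv hU hr_inj (hWro a) (hrW a) (hτr a) (hτrc a) (hφW a) (hφ0 a) hψ0 hψ1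
    (P a) S (hPS a)
  choose w hw0 hwc hw using fun b : ts => exists_majorants (c := c) isOpenMap_toUnit_inv
    continuous_toUnit hU hs_inj (hWso b) (hsW b) (hτs b) (hτsc b) (hψW b) (hψ0 b) hφ0 hφ1
    (fun a => P a b) S (fun a => hPS a b)
  let J : tr → ts → Set G → Finset (Fin n) := fun a b Y =>
    (Ir a ∩ Is b).filter fun i => P a b i = Y
  let g : tr × ts × Set G → B.Cc := fun p =>
    leftMul (φ p.1) (rightMul (ψ p.2.1) (∑ i ∈ J p.1 p.2.1 p.2.2, F i))
  have hgapp : ∀ a b Y γ, (g (a, b, Y)) γ =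
      ((φ a (toUnit γ) * ψ b (toUnit γ⁻¹) : ℝ) : ℂ) • ∑ i ∈ J a b Y, F i γ := by
    intro a b Y γ
    rw [leftMul_apply, rightMul_apply, Cc.sum_apply, smul_smul, Complex.ofReal_mul]
  -- the value of a piece off its trace vanishes
  have hoff : ∀ (a : tr) (b : ts) Y γ, toUnit γ ∈ Wr a → toUnit γ⁻¹ ∈ Ws b → γ ∉ Y →
      ∀ i, P a b i = Y → F i γ = 0 := by
    rintro a b _ γ hγr hγs hγ i rfl
    exact hFU i γ fun h => hγ ⟨⟨h, hγr⟩, hγs⟩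
  have hsum : ∑ p ∈ Finset.univ ×ˢ Finset.univ ×ˢ S, g p = ∑ i, F i := by
    refine Cc.ext fun γ => ?_
    have h1 : ∀ a b, ∑ Y ∈ S, (g (a, b, Y)) γ =
        ((φ a (toUnit γ) * ψ b (toUnit γ⁻¹) : ℝ) : ℂ) • ∑ i, F i γ := by
      intro a b
      simp only [hgapp]
      rw [← Finset.smul_sum,
        Finset.sum_fiberwise_of_maps_to (fun i _ => hPS a b i) fun i => F i γ]
      by_cases hz : φ a (toUnit γ) * ψ b (toUnit γ⁻¹) = 0
      · rw [hz, Complex.ofReal_zero, zero_smul, zero_smul]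
      · congr 1
        refine Finset.sum_subset (Finset.subset_univ _) fun i _ hi => ?_
        rw [Finset.mem_inter, not_and_or] at hi
        rcases hi with hi | hi
        · exact hrI a i hi γ (hφmem a γ (left_ne_zero_of_mul hz))
        · exact hsI b i hi γ (hψmem b γ (right_ne_zero_of_mul hz))
    rw [Cc.sum_apply, Cc.sum_apply, Finset.sum_product]
    simp only [Finset.sum_product, h1, ← Finset.sum_smul, ← Complex.ofReal_sum, ← Finset.mul_sum]
    rw [← Finset.sum_mul]
    by_cases hγ : ∃ i, γ ∈ K i
    · obtain ⟨i, hi⟩ := hγ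
      rw [hφ _ (mem_iUnion.2 ⟨i, γ, hi, rfl⟩), hψ _ (mem_iUnion.2 ⟨i, γ, hi, rfl⟩)]
      simp
    · push Not at hγ
      rw [Finset.sum_eq_zero fun i _ => hF0 i γ (hγ i), smul_zero]
  have hle : ∀ a b Y γ, ‖(g (a, b, Y)) γ‖ ≤ v a b Y (toUnit γ) ∧
      ‖(g (a, b, Y)) γ‖ ≤ w b a Y (toUnit γ⁻¹) := by
    intro a b Y γ
    have hnn : 0 ≤ φ a (toUnit γ) * ψ b (toUnit γ⁻¹) := mul_nonneg (hφ0 _ _) (hψ0 _ _)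
    rw [hgapp, norm_smul, Complex.norm_real, Real.norm_of_nonneg hnn]
    by_cases hz : φ a (toUnit γ) * ψ b (toUnit γ⁻¹) = 0
    · rw [hz, zero_mul]
      exact ⟨hv0 _ _ _ _, hw0 _ _ _ _⟩
    have hγr := hφmem a γ (left_ne_zero_of_mul hz)
    have hγs := hψmem b γ (right_ne_zero_of_mul hz)
    by_cases hγ : γ ∈ Y
    · have hUY : ∀ i, P a b i = Y → γ ∈ U i := by
        rintro i rfl
        exact hγ.1.1
      constructor
      · refine le_trans ?_ (hv a b Y γ hγr fun i _ => hUY i)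
        refine mul_le_mul_of_nonneg_left ?_ hnn
        have h1 : ∑ i ∈ J a b Y, F i γ = ∑ i ∈ Ir a with P a b i = Y, F i γ := by
          refine Finset.sum_subset (Finset.filter_subset_filter _ Finset.inter_subset_left)
            fun i hi hi' => hsI b i (fun h => hi' ?_) γ hγs
          rw [Finset.mem_filter] at hi ⊢
          exact ⟨Finset.mem_inter.2 ⟨hi.1, h⟩, hi.2⟩
        rw [h1]
        refine hrJ a _ (Finset.filter_subset _ _) (fun i hi j hj hij => ?_) γ hγr
        rw [Finset.mem_filter] at hi ⊢
        refine ⟨hj, ?_⟩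
        rw [← hi.2]
        simp only [P, hij]
      · refine le_trans ?_ (hw b a Y γ hγs fun i _ => hUY i)
        rw [mul_comm (ψ b _)]
        refine mul_le_mul_of_nonneg_left ?_ hnn
        have h1 : ∑ i ∈ J a b Y, F i γ = ∑ i ∈ Is b with P a b i = Y, F i γ := by
          refine Finset.sum_subset (Finset.filter_subset_filter _ Finset.inter_subset_right)
            fun i hi hi' => hrI a i (fun h => hi' ?_) γ hγr
          rw [Finset.mem_filter] at hi ⊢
          exact ⟨Finset.mem_inter.2 ⟨h, hi.1⟩, hi.2⟩
        rw [h1]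
        refine hsJ b _ (Finset.filter_subset _ _) (fun i hi j hj hij => ?_) γ hγs
        rw [Finset.mem_filter] at hi ⊢
        refine ⟨hj, ?_⟩
        rw [← hi.2]
        simp only [P, inter_right_comm _ _ ((fun γ : G => (toUnit γ⁻¹ : unitSpace G)) ⁻¹' Ws b), hij]
    · rw [Finset.sum_eq_zero fun i hi => hoff a b Y γ hγr hγs hγ i (Finset.mem_filter.1 hi).2,
        norm_zero, mul_zero]
      exact ⟨hv0 _ _ _ _, hw0 _ _ _ _⟩
  let L : tr × ts × Set G → Set G := fun p => ⋃ i ∈ J p.1 p.2.1 p.2.2,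
    K i ∩ (toUnit ⁻¹' tsupport (φ p.1) ∩
      (fun γ : G => (toUnit γ⁻¹ : unitSpace G)) ⁻¹' tsupport (ψ p.2.1))
  rw [← hsum]
  refine norm_map_le_of_schur π hπ _ (U := fun p => p.2.2) (K := L) (v := fun p => v p.1 p.2.1 p.2.2)
    (w := fun p => w p.2.1 p.1 p.2.2) ?_ ?_ ?_ ?_ (fun p _ γ => (hle _ _ _ γ).1)
    (fun p _ γ => (hle _ _ _ γ).2) (fun p _ => hv0 _ _ _) (fun p _ => hw0 _ _ _) hc0 ?_ ?_
  · rintro ⟨a, b, Y⟩ hp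
    obtain ⟨⟨a', b', i⟩, -, rfl⟩ := Finset.mem_image.1
      (Finset.mem_product.1 (Finset.mem_product.1 hp).2).2
    have hsub : P a' b' i ⊆ U i := fun γ hγ => hγ.1.1
    exact ⟨((hU i).inter ((hWro _).preimage continuous_toUnit)).inter
      ((hWso _).preimage continuous_toUnit_inv), (hF i).1.injOn_rng.mono hsub,
      (hF i).1.injOn_src.mono hsub⟩
  · rintro ⟨a, b, Y⟩ -
    exact Finset.isCompact_biUnion _ fun i _ => (hF i).2.1.inter_right
      (((isClosed_tsupport _).preimage continuous_toUnit).inter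
        ((isClosed_tsupport _).preimage continuous_toUnit_inv))
  · rintro ⟨a, b, Y⟩ - γ hγ
    obtain ⟨i, hi, hγK, hγr, hγs⟩ := mem_iUnion₂.1 hγ
    change γ ∈ Y
    have hi' : i ∈ J a b Y := hi
    rw [← (Finset.mem_filter.1 hi').2]
    exact ⟨⟨hKU i hγK, hφW a hγr⟩, hψW b hγs⟩
  · rintro ⟨a, b, Y⟩ -
    refine ⟨?_, fun γ hγ => ?_⟩
    · have h1 : ContinuousOn (fun γ => (∑ i ∈ J a b Y, F i γ).pt) Y :=
        BanachBundle.continuousOn_sum _ (fun i => (F i).1) fun i hi => (hF i).2.2.2.1.mono (by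
          rw [← (Finset.mem_filter.1 hi).2]
          exact fun γ hγ => hγ.1.1)
      refine (BanachBundle.continuousOn_smul (c := fun γ =>
        ((φ a (toUnit γ) * ψ b (toUnit γ⁻¹) : ℝ) : ℂ)) (Continuous.continuousOn ?_) h1).congr
          fun γ _ => by rw [hgapp]
      exact Complex.continuous_ofReal.comp (((φ a).continuous.comp continuous_toUnit).mul
        ((ψ b).continuous.comp continuous_toUnit_inv))
    · rw [hgapp]
      by_cases hz : φ a (toUnit γ) * ψ b (toUnit γ⁻¹) = 0
      · rw [hz, Complex.ofReal_zero, zero_smul]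
      · rw [Finset.sum_eq_zero fun i hi => hF0 i γ fun hm => hγ (mem_iUnion₂.2 ⟨i, hi, hm,
          subset_tsupport _ (left_ne_zero_of_mul hz), subset_tsupport _ (right_ne_zero_of_mul hz)⟩),
          smul_zero]
  · intro x
    simp only [Finset.sum_product]
    refine (Finset.sum_le_sum fun a _ => hvc a x).trans ?_
    rw [← Finset.mul_sum]
    exact mul_le_of_le_one_right hc0 (hφ1 x)
  · intro x
    simp only [Finset.sum_product]
    rw [Finset.sum_comm]
    refine (Finset.sum_le_sum fun b _ => hwc b x).trans ?_
    rw [← Finset.mul_sum]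
    exact mul_le_of_le_one_right hc0 (hψ1 x)

/-- Every nondegenerate representation is bounded by the `I`-norm. -/
theorem enorm_map_le_iNorm (hπ : B.IsNondegenerate π) (f : B.Cc) : ‖π f‖ₑ ≤ B.iNorm f := by
  rcases eq_or_ne (B.iNorm f) ⊤ with htop | htop
  · rw [htop]; exact le_top
  have key : ∀ (d : G → G) (x : unitSpace G) (t : Finset G), (∀ γ ∈ t, d γ = x) →
      ∑' γ : {γ : G // d γ = x}, ‖f γ‖ₑ ≤ B.iNorm f → ∑ γ ∈ t, ‖f γ‖ ≤ (B.iNorm f).toReal := by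
    intro d x t ht hle
    have h1 : ∑ γ ∈ t, ‖f γ‖ₑ ≤ B.iNorm f := by
      refine le_trans ?_ hle
      rw [← Finset.sum_coe_sort]
      refine le_trans ?_ (ENNReal.tsum_comp_le_tsum_of_injective
        (f := fun γ : t => (⟨γ.1, ht γ.1 γ.2⟩ : {γ : G // d γ = x})) ?_ _)
      · rw [tsum_fintype]
      · intro a b hab
        exact Subtype.ext (congrArg (fun z => z.1) hab)
    have h2 := ENNReal.toReal_mono htop h1
    rw [ENNReal.toReal_sum fun γ _ => enorm_ne_top] at h2
    simpa using h2
  have h := norm_map_le_of_sum_le π hπ f (c₀ := (B.iNorm f).toReal) ENNReal.toReal_nonneg ?_ ?_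
  · rw [← ofReal_norm]
    exact (ENNReal.ofReal_le_ofReal h).trans ENNReal.ofReal_toReal_le
  · intro x t ht
    rcases t.eq_empty_or_nonempty with rfl | ⟨γ, hγ⟩
    · simp
    · have hx : x ∈ unitSpace G := ht γ hγ ▸ rng_mem_unitSpace γ
      exact key rng ⟨x, hx⟩ t ht (le_trans (le_iSup (fun x : unitSpace G =>
        ∑' γ : {γ : G // rng γ = x}, ‖f γ‖ₑ) ⟨x, hx⟩) (le_max_left _ _))
  · intro x t ht
    rcases t.eq_empty_or_nonempty with rfl | ⟨γ, hγ⟩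
    · simp
    · have hx : x ∈ unitSpace G := ht γ hγ ▸ src_mem_unitSpace γ
      exact key src ⟨x, hx⟩ t ht (le_trans (le_iSup (fun x : unitSpace G =>
        ∑' γ : {γ : G // src γ = x}, ‖f γ‖ₑ) ⟨x, hx⟩) (le_max_right _ _))

end

end FellBundle

/-! ### Positive functionals on C*-algebras -/

/-- The positive functionals on a C*-algebra separate its positive elements from zero: the
closed cone of the positive elements does not contain `-b* b`, and a real functional that separates
the two is made hermitian and complexified. -/
theorem exists_positive_functional {C : Type*} [NonUnitalCStarAlgebra C] {b : C} (hb : b ≠ 0) :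
    ∃ φ : C →L[ℂ] ℂ, (∀ c, 0 ≤ (φ (star c * c)).re) ∧
      (∀ c, φ (star c) = starRingEnd ℂ (φ c)) ∧ 0 < (φ (star b * b)).re := by
  let _ := CStarAlgebra.spectralOrder C
  let _ := CStarAlgebra.spectralOrderedRing C
  let P : ProperCone ℝ C :=
    { carrier := {c | 0 ≤ c}
      add_mem' := fun {c d} h h' => show (0 : C) ≤ c + d from add_nonneg h h'
      zero_mem' := show (0 : C) ≤ 0 from le_rfl
      smul_mem' := fun r c h => show (0 : C) ≤ (r : ℝ) • c from smul_nonneg r.2 h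
      isClosed' := CStarAlgebra.isClosed_nonneg }
  have hP : -(star b * b) ∉ P := fun h => hb <| by
    have h1 : (0 : C) ≤ -(star b * b) := h
    exact CStarRing.star_mul_self_eq_zero_iff b |>.1
      (le_antisymm (neg_nonneg.1 h1) (star_mul_self_nonneg b))
  obtain ⟨ψ, hψ, hψb⟩ := P.hyperplane_separation_point hP
  let θ : C →L[ℝ] ℝ := ψ + ψ.comp (starL' ℝ : C ≃L[ℝ] C).toContinuousLinearMap
  have hθ : ∀ c, θ c = ψ c + ψ (star c) := fun c => rfl
  have hθs : ∀ c, θ (star c) = θ c := fun c => by rw [hθ, hθ, star_star, add_comm]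
  let φ : C →L[ℂ] ℂ := StrongDual.extendRCLike (𝕜 := ℂ) θ
  have hφ : ∀ c, φ c = θ c - Complex.I * θ (Complex.I • c) :=
    fun c => StrongDual.extendRCLike_apply θ c
  have hre : ∀ c, (φ c).re = θ c := fun c => by simp [hφ]
  have him : ∀ c, (φ c).im = -θ (Complex.I • c) := fun c => by simp [hφ]
  refine ⟨φ, fun c => ?_, fun c => ?_, ?_⟩
  · rw [hre, hθ, star_mul, star_star]
    have := hψ _ (show star c * c ∈ P from star_mul_self_nonneg c)
    linarith
  · refine Complex.ext ?_ ?_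
    · rw [Complex.conj_re, hre, hre, hθs]
    · rw [Complex.conj_im, him, him]
      have h : Complex.I • star c = -star (Complex.I • c) := by
        rw [star_smul, ← neg_smul]; simp
      rw [h, map_neg, hθs]
  · rw [hre, hθ, star_mul, star_star]
    rw [map_neg] at hψb
    linarith

namespace FellBundle

variable {G : Type u} {A : Type v} [TopologicalSpace G] [EtaleGroupoid G] [TopologicalSpace A]
  {B : FellBundle G A}

/-! ### Vector states at a unit -/

/-- For `a` over `β` the element `a* a` of the fibre over `src β`. -/
def adjMulSelf {β x : G} (h : src β = x) (a : B.Fib β) : B.Fib x :=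
  B.fibMul (src_inv β) ((inv_mul_self β).trans h) (B.fibAdj rfl a) a

theorem exists_adjMulSelf_eq {β : G} {x : unitSpace G} (h : src β = x) (a : B.Fib β) :
    ∃ c : B.Fib x.1, B.adjMulSelf h a = star c * c := by
  obtain ⟨c, hc, hac⟩ := B.adj_mul_self_nonneg a.pt
  exact ⟨⟨c, by rw [hc, a.2, h]⟩, Fibre.ext hac⟩

theorem norm_adjMulSelf {β x : G} (h : src β = x) (a : B.Fib β) :
    ‖B.adjMulSelf h a‖ = ‖a‖ ^ 2 := by
  rw [← ptNorm_adj_mul_self, ← B.ptNorm_pt]; rfl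

/-- The value at a unit `x` of `g* g` is the sum of the positive elements `g(β)* g(β)` with
`src β = x`, so that a positive functional is at least as large on it as on each of them. -/
theorem re_map_adjMulSelf_le {x : unitSpace G} (φ : B.Fib x.1 →ₗ[ℂ] ℂ)
    (hφ : ∀ c, 0 ≤ (φ (star c * c)).re) (g : B.Cc) {β : G} (hβ : src β = x) :
    (φ (B.adjMulSelf hβ (g β))).re ≤ (φ ((star g * g) x.1)).re := by
  classical
  let F : Pairs x.1 → B.Fib x.1 := fun q => B.fibMul q.2.1 q.2.2 ((star g) q.1.1) (g q.1.2)
  have hfin : F.support.Finite := finite_pairs (star g).2 g.1 x.1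
  have hsrc : ∀ q : Pairs x.1, src q.1.2 = x := fun q =>
    (src_pairs q).trans (src_eq_of_mem_unitSpace x.2)
  have hinv : ∀ q : Pairs x.1, q.1.1⁻¹ = q.1.2 := fun q => by
    have h1 := inv_mul_mul_cancel q.2.1
    have h2 : src q.1.1⁻¹ = x.1 := by
      rw [src_inv, rng_pairs q, rng_eq_of_mem_unitSpace x.2]
    rw [q.2.2] at h1
    rw [← h1]
    conv_lhs => rw [← self_mul_src q.1.1⁻¹, h2]
  have hF : ∀ q, F q = B.adjMulSelf (hsrc q) (g q.1.2) := fun q => by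
    refine Fibre.ext ?_
    change B.mul (B.adj (g q.1.1⁻¹).pt) (g q.1.2).pt = B.mul (B.adj (g q.1.2).pt) (g q.1.2).pt
    rw [hinv q]
  have hsum : (φ ((star g * g) x.1)).re = ∑ q ∈ hfin.toFinset, (φ (F q)).re := by
    have h1 : (star g * g) x.1 = ∑ q ∈ hfin.toFinset, F q := finsum_eq_sum F hfin
    rw [h1, map_sum, Complex.re_sum]
  have hnn : ∀ q, 0 ≤ (φ (F q)).re := fun q => by
    obtain ⟨c, hc⟩ := exists_adjMulSelf_eq (hsrc q) (g q.1.2)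
    rw [hF, hc]; exact hφ c
  have hx : rng x.1 = x.1 := rng_eq_of_mem_unitSpace x.2
  let q₀ : Pairs x.1 := ⟨(β⁻¹, β), src_inv β, (inv_mul_self β).trans hβ⟩
  rw [hsum, show B.adjMulSelf hβ (g β) = F q₀ from (hF q₀).symm]
  by_cases h : F q₀ = 0
  · rw [h, map_zero]
    exact Finset.sum_nonneg fun q _ => hnn q
  · exact Finset.single_le_sum (f := fun q => (φ (F q)).re) (fun q _ => hnn q)
      (hfin.mem_toFinset.2 h)

/-- For a nonzero `f` there is a positive functional `φ` on a unit fibre such that the state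
`g ↦ φ (g(x))` does not vanish at `k* k` where `k = f f*`. -/
theorem exists_positive_functional_of_ne_zero {f : B.Cc} (hf : f ≠ 0) :
    ∃ (x : unitSpace G) (φ : B.Fib x.1 →L[ℂ] ℂ), (∀ c, 0 ≤ (φ (star c * c)).re) ∧
      (∀ c, φ (star c) = starRingEnd ℂ (φ c)) ∧
      0 < (φ ((star (f * star f) * (f * star f)) x.1)).re := by
  obtain ⟨γ, hγ⟩ : ∃ γ, f γ ≠ 0 := by
    by_contra! h
    exact hf (Cc.ext h)
  obtain ⟨x, hβ⟩ : ∃ x : unitSpace G, src γ⁻¹ = x.1 := ⟨⟨rng γ, rng_mem_unitSpace γ⟩, src_inv γ⟩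
  have hpos : ∀ (φ : B.Fib x.1 →L[ℂ] ℂ) (h : ∀ c, 0 ≤ (φ (star c * c)).re) (g : B.Cc) {β : G}
      (hβ : src β = x), (φ (B.adjMulSelf hβ (g β))).re ≤ (φ ((star g * g) x.1)).re :=
    fun φ h g β hβ => re_map_adjMulSelf_le (φ : B.Fib x.1 →ₗ[ℂ] ℂ) h g hβ
  have hk : (f * star f) x.1 ≠ 0 := by
    obtain ⟨c, hc⟩ := exists_adjMulSelf_eq (x := x) hβ ((star f) γ⁻¹)
    have hc0 : c ≠ 0 := by
      rintro rfl
      have h1 := norm_adjMulSelf (B := B) hβ ((star f) γ⁻¹)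
      rw [hc, Cc.norm_star_apply, inv_inv_arrow, mul_zero, norm_zero, eq_comm,
        sq_eq_zero_iff, norm_eq_zero] at h1
      exact hγ h1
    obtain ⟨φ, hφ, -, hφc⟩ := exists_positive_functional (C := B.Fib x.1) hc0
    have h1 := hpos φ hφ (star f) hβ
    rw [star_star, hc] at h1
    intro h
    rw [h, map_zero] at h1
    exact absurd (hφc.trans_le h1) (lt_irrefl _)
  -- a second functional, positive at the square of the nonzero element `k(x)`
  obtain ⟨φ, hφ, hs, hφk⟩ := exists_positive_functional (C := B.Fib x.1) hk
  refine ⟨x, φ, hφ, hs, hφk.trans_le ?_⟩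
  have hx : src x.1 = x.1 := src_eq_of_mem_unitSpace x.2
  refine le_trans (le_of_eq ?_) (hpos φ hφ (f * star f) hx)
  congr 2

/-! ### The GNS construction -/

/-- Right multiplication by a fixed element is bounded for the supremum norms. -/
theorem exists_norm_mul_right_le (h : B.Cc) : ∃ C, 0 ≤ C ∧ ∀ (f : B.Cc) (β : ℝ), 0 ≤ β →
    (∀ γ, ‖f γ‖ ≤ β) → ∀ γ, ‖(f * h) γ‖ ≤ C * β := by
  induction h using Cc.induction with
  | mem h U K hU hK hKU hh =>
    obtain ⟨C, hC, hhC⟩ := exists_norm_le hK hKU hh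
    refine ⟨C, hC, fun f β hβ hf γ => ?_⟩
    have h0 : ∀ γ ∉ U, h γ = 0 := fun γ hγ => hh.2 γ fun hm => hγ (hKU hm)
    by_cases hex : ∃ η ∈ U, src η = src γ
    · obtain ⟨η, hη, hηγ⟩ := hex
      have h1 := conv_eq_right (B := B) hU.injOn_src f.1 h0 hη hηγ
      have h2 := B.norm_mul_le (f (γ * η⁻¹)).pt (h η).pt (by
        rw [(f.1 _).2, (h.1 _).2, src_mul _ _ (by rw [rng_inv, hηγ]), src_inv])
      rw [← B.ptNorm_pt, Cc.mul_apply, h1, mul_comm C β]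
      refine h2.trans ?_
      change B.ptNorm _ * B.ptNorm _ ≤ _
      rw [B.ptNorm_pt, B.ptNorm_pt]
      exact mul_le_mul (hf _) (hhC _) (norm_nonneg _) hβ
    · rw [Cc.mul_apply, conv_eq_zero_right _ h0 hex, norm_zero]
      positivity
  | zero => exact ⟨0, le_rfl, fun f β _ _ γ => by simp⟩
  | add g h hg hh =>
    obtain ⟨C, hC, hgC⟩ := hg
    obtain ⟨D, hD, hhD⟩ := hh
    refine ⟨C + D, by positivity, fun f β hβ hf γ => ?_⟩
    rw [_root_.mul_add, Cc.add_apply, _root_.add_mul]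
    exact (norm_add_le _ _).trans (add_le_add (hgC f β hβ hf γ) (hhD f β hβ hf γ))
  | smul c h hh =>
    obtain ⟨C, hC, hhC⟩ := hh
    refine ⟨‖c‖ * C, by positivity, fun f β hβ hf γ => ?_⟩
    rw [mul_smul_comm, Cc.smul_apply, norm_smul, _root_.mul_assoc]
    gcongr
    exact hhC f β hβ hf γ

theorem exists_norm_mul_left_le (h : B.Cc) : ∃ C, 0 ≤ C ∧ ∀ (f : B.Cc) (β : ℝ), 0 ≤ β →
    (∀ γ, ‖f γ‖ ≤ β) → ∀ γ, ‖(h * f) γ‖ ≤ C * β := by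
  obtain ⟨C, hC, h'⟩ := exists_norm_mul_right_le (star h)
  refine ⟨C, hC, fun f β hβ hf γ => ?_⟩
  have h1 := h' (star f) β hβ (fun γ => by rw [Cc.norm_star_apply]; exact hf _) γ⁻¹
  rw [← star_mul] at h1
  rwa [Cc.norm_star_apply, inv_inv_arrow] at h1

/-- A positive hermitian functional that is bounded for the supremum norm is a vector state of a
`*`-homomorphism into the bounded operators on a Hilbert space. -/
theorem exists_gns (ω : B.Cc →ₗ[ℂ] ℂ) (hpos : ∀ g, 0 ≤ (ω (star g * g)).re)
    (hstar : ∀ g, ω (star g) = starRingEnd ℂ (ω g))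
    (hbd : ∃ C, 0 ≤ C ∧ ∀ (g : B.Cc) (β : ℝ), 0 ≤ β → (∀ γ, ‖g γ‖ ≤ β) → ‖ω g‖ ≤ C * β) :
    ∃ (H : Type max u v) (_ : NormedAddCommGroup H) (_ : InnerProductSpace ℂ H)
      (_ : CompleteSpace H) (M : B.Cc →⋆ₙₐ[ℂ] (H →L[ℂ] H)) (q : B.Cc → H),
      (∀ f g, M f (q g) = q (f * g)) ∧ ∀ g, ‖q g‖ ^ 2 = (ω (star g * g)).re := by
  let core : PreInnerProductSpace.Core ℂ B.Cc :=
    { inner := fun f g => ω (star f * g)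
      conj_inner_symm := fun f g => by rw [← hstar, star_mul, star_star]
      re_inner_nonneg := fun f => hpos f
      add_left := fun f g h => by rw [star_add, _root_.add_mul, map_add]
      smul_left := fun f g c => by
        rw [star_smul, smul_mul_assoc, map_smul, smul_eq_mul]; rfl }
  let _ : SeminormedAddCommGroup B.Cc := InnerProductSpace.Core.toSeminormedAddCommGroup (𝕜 := ℂ)
  let _ : InnerProductSpace ℂ B.Cc := InnerProductSpace.ofCore core
  have hinner : ∀ f g : B.Cc, inner ℂ f g = ω (star f * g) := fun f g => rfl
  let q : B.Cc →ₗ[ℂ] UniformSpace.Completion B.Cc :=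
    (UniformSpace.Completion.toComplₗᵢ : B.Cc →ₗᵢ[ℂ] UniformSpace.Completion B.Cc).toLinearMap
  have hq : ∀ f g, inner ℂ (q f) (q g) = ω (star f * g) := fun f g =>
    UniformSpace.Completion.inner_coe f g
  let L : B.Cc →ₙₐ[ℂ] Module.End ℂ B.Cc := NonUnitalAlgHom.lmul ℂ B.Cc
  have hL : ∀ f g, L f g = f * g := fun f g => rfl
  have hcont : ∀ ξ η, @Continuous B.Cc ℂ B.ilt _ fun f => inner ℂ (q η) (q (L f ξ)) := by
    intro ξ η
    refine continuous_inductiveLimit_of_bound (coefficient q L ξ η) ?_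
    rintro P -
    obtain ⟨C, hC, hω⟩ := hbd
    obtain ⟨D, hD, hξ⟩ := exists_norm_mul_right_le ξ
    obtain ⟨D', hD', hη⟩ := exists_norm_mul_left_le (star η)
    refine ⟨C * (D' * D), fun f _ β hβ hf => ?_⟩
    change ‖inner ℂ (q η) (q (L f ξ))‖ ≤ _
    rw [hq, hL, _root_.mul_assoc, _root_.mul_assoc]
    exact hω _ _ (by positivity) (hη _ _ (by positivity) (hξ f β hβ hf))
  obtain ⟨M, hM⟩ := exists_starHom_extension q L hcont
    (fun f ξ η => by rw [hq, hq, hL, hL, star_mul, star_star, _root_.mul_assoc])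
    UniformSpace.Completion.denseRange_coe
  refine ⟨UniformSpace.Completion B.Cc, inferInstance, inferInstance, inferInstance, M, q,
    fun f g => hM f g, fun g => ?_⟩
  rw [← hq g g]
  exact (inner_self_eq_norm_sq (𝕜 := ℂ) (q g)).symm

/-! ### The nondegenerate part -/

/-- A `*`-homomorphism restricts to a representation on the closed span of its range. -/
theorem exists_rep_of_starHom {H : Type max u v} [NormedAddCommGroup H] [InnerProductSpace ℂ H]
    [CompleteSpace H] (M : B.Cc →⋆ₙₐ[ℂ] (H →L[ℂ] H)) {f : B.Cc} (hf : M f ≠ 0) :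
    ∃ ρ : B.Rep, ρ.π f ≠ 0 := by
  let S : Submodule ℂ H := Submodule.span ℂ {v : H | ∃ f ξ, v = M f ξ}
  let K : Submodule ℂ H := S.topologicalClosure
  have hS : ∀ f ξ, M f ξ ∈ S := fun f ξ => Submodule.subset_span ⟨f, ξ, rfl⟩
  have hK : ∀ f ξ, M f ξ ∈ K := fun f ξ => S.le_topologicalClosure (hS f ξ)
  have : CompleteSpace K := S.isClosed_topologicalClosure.completeSpace_coe
  -- `M f` vanishes on the orthogonal complement of `K`
  have hproj : ∀ ξ, ∃ k : K, ∀ f, M f ξ = M f k := by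
    intro ξ
    obtain ⟨k, hk, z, hz, rfl⟩ := K.exists_add_mem_mem_orthogonal ξ
    refine ⟨⟨k, hk⟩, fun f => ?_⟩
    have h0 : M f z = 0 := by
      refine ext_inner_left ℂ fun η => ?_
      have h1 := hz _ (hK (star f) η)
      rw [map_star, ContinuousLinearMap.star_eq_adjoint,
        ContinuousLinearMap.adjoint_inner_left] at h1
      rw [h1, inner_zero_right]
    rw [map_add, h0, add_zero]
  let π₀ : B.Cc → K →L[ℂ] K := fun f => ((M f).comp K.subtypeL).codRestrict K fun ξ => hK f ξ
  have hπ₀ : ∀ f (ξ : K), (π₀ f ξ : H) = M f ξ := fun f ξ => rfl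
  let π : B.Cc →⋆ₙₐ[ℂ] (K →L[ℂ] K) :=
    { toFun := π₀
      map_smul' := fun c f => by ext ξ; simp [hπ₀]
      map_zero' := by ext ξ; simp [hπ₀]
      map_add' := fun f g => by ext ξ; simp [hπ₀]
      map_mul' := fun f g => by ext ξ; simp [hπ₀]
      map_star' := fun f => by
        refine (ContinuousLinearMap.eq_adjoint_iff _ _).2 fun x y => ?_
        rw [Submodule.coe_inner, Submodule.coe_inner, hπ₀, hπ₀, map_star,
          ContinuousLinearMap.star_eq_adjoint, ContinuousLinearMap.adjoint_inner_left] }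
  have hπ : ∀ f (ξ : K), (π f ξ : H) = M f ξ := fun f ξ => rfl
  refine ⟨{ H := K, π := π, nondegenerate := ?_ }, fun h0 => hf ?_⟩
  · refine Subtype.dense_iff.2 fun x hx => ?_
    refine closure_mono (s := (S : Set H)) ?_ hx
    have h1 : S ≤ (Submodule.span ℂ {v : K | ∃ f ξ, v = π f ξ}).map K.subtype := by
      refine Submodule.span_le.2 ?_
      rintro _ ⟨f, ξ, rfl⟩
      obtain ⟨k, hk⟩ := hproj ξ
      exact ⟨π f k, Submodule.subset_span ⟨f, k, rfl⟩, (hk f).symm⟩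
    exact h1
  · ext ξ
    obtain ⟨k, hk⟩ := hproj ξ
    have h1 : π f k = 0 := by
      have h0 : π f = 0 := h0
      rw [h0]; rfl
    rw [hk f, ← hπ, h1]; rfl

/-- The representations separate the points of `C_c(G; A)`. -/
theorem exists_rep_ne_zero {f : B.Cc} (hf : f ≠ 0) : ∃ ρ : B.Rep, ρ.π f ≠ 0 := by
  obtain ⟨x, φ, hφ, hφs, hk⟩ := exists_positive_functional_of_ne_zero hf
  let ω : B.Cc →ₗ[ℂ] ℂ :=
    { toFun := fun g => φ (g x.1)
      map_add' := fun g h => by rw [Cc.add_apply, map_add]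
      map_smul' := fun c g => by rw [Cc.smul_apply, map_smul]; rfl }
  obtain ⟨H, _, _, _, M, q, hMq, hq⟩ := exists_gns ω
    (fun g => by
      have hx : src x.1 = x.1 := src_eq_of_mem_unitSpace x.2
      obtain ⟨c, hc⟩ := exists_adjMulSelf_eq hx (g x.1)
      have h1 := re_map_adjMulSelf_le (φ : B.Fib x.1 →ₗ[ℂ] ℂ) hφ g hx
      rw [hc] at h1
      exact (hφ c).trans h1)
    (fun g => by
      change φ ((star g) x.1) = _
      rw [star_apply_unit]; exact hφs _)
    ⟨‖φ‖, norm_nonneg _, fun g β hβ hg => (φ.le_opNorm _).trans (by gcongr; exact hg _)⟩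
  refine exists_rep_of_starHom M fun h0 => hk.ne' ?_
  change (ω _).re = 0
  rw [← hq, ← hMq, h0]
  simp

/-! ### Representations and pre-representations -/

/-- A pre-representation induces exactly one `*`-homomorphism. -/
theorem PreRep.existsUnique_induces {H : Type w} [NormedAddCommGroup H] [InnerProductSpace ℂ H]
    [CompleteSpace H] (P : B.PreRep B.ilt H) :
    ∃ M : B.Cc →⋆ₙₐ[ℂ] (H →L[ℂ] H), B.IsNondegenerate M ∧
      @Continuous B.Cc (H →L[ℂ] H) B.ilt _ M ∧ ∀ M', P.Induces M' ↔ M' = M := by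
  have hsub : Submodule.span ℂ {v : H | ∃ f ξ, v = P.L f ξ} ≤ P.H₀ := by
    refine Submodule.span_le.2 ?_
    rintro _ ⟨f, ξ, rfl⟩
    exact (P.L f ξ).2
  have hq : DenseRange P.H₀.subtype := by
    refine P.nondegenerate.mono fun v hv => ?_
    exact ⟨⟨v, hsub hv⟩, rfl⟩
  obtain ⟨M, hM⟩ := exists_starHom_extension P.H₀.subtype P.L P.continuous_inner P.adjointable hq
  refine ⟨M, P.nondegenerate.mono (Submodule.span_mono ?_), continuous_ilt M, fun M' =>
    ⟨fun hM' => ?_, ?_⟩⟩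
  · rintro _ ⟨f, ξ, rfl⟩
    exact ⟨f, ξ, (hM f ξ).symm⟩
  · refine NonUnitalStarAlgHom.ext fun f => ContinuousLinearMap.coeFn_injective
      (hq.equalizer (M' f).continuous (M f).continuous (funext fun ξ => ?_))
    exact (hM' f ξ).trans (hM f ξ).symm
  · rintro rfl f ξ
    exact hM f ξ

/-- A representation that is continuous for a topology is induced from a pre-representation with
respect to it, on the whole Hilbert space. -/
theorem repsContinuous_subset_repsInduced (τ : TopologicalSpace B.Cc) :
    B.repsContinuous τ ⊆ B.repsInduced τ := by
  intro ρ hρ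
  let L : B.Cc →ₙₐ[ℂ] Module.End ℂ (⊤ : Submodule ℂ ρ.H) :=
    { toFun := fun f => (ρ.π f : ρ.H →ₗ[ℂ] ρ.H).restrict fun _ _ => Submodule.mem_top
      map_smul' := fun c f => by ext ξ; simp
      map_zero' := by ext ξ; simp
      map_add' := fun f g => by ext ξ; simp
      map_mul' := fun f g => by ext ξ; simp }
  have hL : ∀ f ξ, (L f ξ : ρ.H) = ρ.π f ξ := fun f ξ => rfl
  refine ⟨{ H₀ := ⊤, L := L, continuous_inner := ?_, adjointable := ?_, nondegenerate := ?_ },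
    fun f ξ => rfl⟩
  · intro ξ η
    have h : Continuous fun T : ρ.H →L[ℂ] ρ.H => inner ℂ (η : ρ.H) (T (ξ : ρ.H)) := by fun_prop
    exact h.comp hρ
  · intro f ξ η
    rw [hL, hL, map_star, ContinuousLinearMap.star_eq_adjoint,
      ContinuousLinearMap.adjoint_inner_left]
  · refine ρ.nondegenerate.mono (Submodule.span_mono ?_)
    rintro _ ⟨f, ξ, rfl⟩
    exact ⟨f, ⟨ξ, Submodule.mem_top⟩, rfl⟩

theorem repsContinuous_ilt_eq_univ : B.repsContinuous B.ilt = univ :=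
  eq_univ_of_forall fun ρ => continuous_ilt ρ.π

theorem repsINormBounded_eq_univ : B.repsINormBounded = univ :=
  eq_univ_of_forall fun ρ => enorm_map_le_iNorm ρ.π ρ.nondegenerate

/-- On the sections that vanish outside a compact set every representation is bounded by a multiple
of the supremum norm: if the set is covered by `n` bisections, then the sums in the `I`-norm have at
most `n` nonzero terms. -/
theorem repsContinuous_mwIlt_eq_univ : B.repsContinuous B.mwIlt = univ := by
  classical
  refine eq_univ_of_forall fun ρ => ?_
  refine continuous_inductiveLimit_of_bound (ρ.π : B.Cc →ₗ[ℂ] (ρ.H →L[ℂ] ρ.H)) ?_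
  rintro _ ⟨K, hK, rfl⟩
  choose U hU hxU _ using fun x : G => exists_isBisection isOpen_univ (mem_univ x)
  obtain ⟨s, hs⟩ := hK.elim_nhds_subcover U fun x _ => (hU x).isOpen.mem_nhds (hxU x)
  refine ⟨s.card, fun f hf β hβ hfβ => ?_⟩
  have key : ∀ (d : G → G), (∀ x, InjOn d (U x)) → ∀ (x : G) (t : Finset G),
      (∀ γ ∈ t, d γ = x) → ∑ γ ∈ t, ‖f γ‖ ≤ s.card * β := by
    intro d hd x t ht
    calc ∑ γ ∈ t, ‖f γ‖ ≤ ∑ γ ∈ t, ∑ y ∈ s, if γ ∈ U y then ‖f γ‖ else 0 := by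
          refine Finset.sum_le_sum fun γ _ => ?_
          have hnn : ∀ y ∈ s, 0 ≤ if γ ∈ U y then ‖f γ‖ else 0 := fun y _ => by
            split_ifs <;> simp
          by_cases hγ : γ ∈ K
          · obtain ⟨y, hy, hγy⟩ := mem_iUnion₂.1 (hs.2 hγ)
            refine le_trans ?_ (Finset.single_le_sum hnn hy)
            rw [if_pos hγy]
          · rw [hf.2 γ hγ, norm_zero]
            exact Finset.sum_nonneg fun y _ => by simp
      _ = ∑ y ∈ s, ∑ γ ∈ t with γ ∈ U y, ‖f γ‖ := by
          rw [Finset.sum_comm]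
          simp only [Finset.sum_filter]
      _ ≤ ∑ y ∈ s, β := by
          refine Finset.sum_le_sum fun y _ => ?_
          have hcard : (t.filter (· ∈ U y)).card ≤ 1 := by
            refine Finset.card_le_one.2 fun a ha b hb => ?_
            rw [Finset.mem_filter] at ha hb
            exact hd y ha.2 hb.2 ((ht a ha.1).trans (ht b hb.1).symm)
          refine (Finset.sum_le_card_nsmul _ _ β fun γ _ => hfβ γ).trans ?_
          rw [nsmul_eq_mul]
          exact mul_le_of_le_one_left hβ (by exact_mod_cast hcard)
      _ = s.card * β := by rw [Finset.sum_const, nsmul_eq_mul]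
  exact norm_map_le_of_sum_le ρ.π ρ.nondegenerate f (by positivity)
    (key rng fun x => (hU x).injOn_rng) (key src fun x => (hU x).injOn_src)

theorem repsInduced_ilt_eq_univ : B.repsInduced B.ilt = univ :=
  univ_subset_iff.1 (repsContinuous_ilt_eq_univ.symm.subset.trans
    (repsContinuous_subset_repsInduced _))

theorem repsInduced_mwIlt_eq_univ : B.repsInduced B.mwIlt = univ :=
  univ_subset_iff.1 (repsContinuous_mwIlt_eq_univ.symm.subset.trans
    (repsContinuous_subset_repsInduced _))

/-! ### The full norm -/

theorem exists_norm_rep_le (f : B.Cc) : ∃ C, ∀ ρ : B.Rep, ‖ρ.π f‖ ≤ C := by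
  induction f using Cc.induction with
  | mem f U K hU hK hKU hf =>
    obtain ⟨C, hC, hfC⟩ := exists_norm_le hK hKU hf
    exact ⟨C, fun ρ => norm_map_le ρ.π hU hK hKU hf hC hfC⟩
  | zero => exact ⟨0, fun ρ => by simp⟩
  | add f g hf hg =>
    obtain ⟨C, hC⟩ := hf
    obtain ⟨D, hD⟩ := hg
    refine ⟨C + D, fun ρ => ?_⟩
    rw [map_add]
    exact (norm_add_le _ _).trans (add_le_add (hC ρ) (hD ρ))
  | smul c f hf =>
    obtain ⟨C, hC⟩ := hf
    refine ⟨‖c‖ * C, fun ρ => ?_⟩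
    rw [map_smul, norm_smul]
    gcongr
    exact hC ρ

theorem supNorm_univ_lt_top (f : B.Cc) : B.supNorm univ f < ⊤ := by
  obtain ⟨C, hC⟩ := exists_norm_rep_le f
  refine lt_of_le_of_lt (iSup₂_le fun ρ _ => ?_) (ENNReal.ofReal_lt_top (r := C))
  rw [← ofReal_norm]
  exact ENNReal.ofReal_le_ofReal (hC ρ)

theorem norm_le_fullNorm (ρ : B.Rep) (f : B.Cc) : ‖ρ.π f‖ ≤ B.fullNorm f := by
  rw [← toReal_enorm]
  exact ENNReal.toReal_mono (supNorm_univ_lt_top f).ne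
    (le_iSup₂ (f := fun (ρ : B.Rep) (_ : ρ ∈ univ) => ‖ρ.π f‖ₑ) ρ (mem_univ ρ))

theorem exists_lt_norm_rep {f : B.Cc} {r : ℝ} (hr : 0 ≤ r) (h : r < B.fullNorm f) :
    ∃ ρ : B.Rep, r < ‖ρ.π f‖ := by
  by_contra! h'
  refine h.not_ge ?_
  refine ENNReal.toReal_le_of_le_ofReal hr (iSup₂_le fun ρ _ => ?_)
  rw [← ofReal_norm]
  exact ENNReal.ofReal_le_ofReal (h' ρ)

/-- A pair of `f` and a number below the norm of `f` in some representation.  These pairs index a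
small family of representations that computes the full norm. -/
def NormWitness (B : FellBundle G A) : Type max u v :=
  {i : B.Cc × ℝ // ∃ ρ : B.Rep, i.2 < ‖ρ.π i.1‖}

/-- A representation as promised by the witness. -/
noncomputable def NormWitness.rep (i : B.NormWitness) : B.Rep := i.2.choose

/-- The direct sum of a small family of representations that computes the full norm. -/
noncomputable def universalHom (B : FellBundle G A) :
    B.Cc →⋆ₙₐ[ℂ] lp (fun i : B.NormWitness => i.rep.H →L[ℂ] i.rep.H) ∞ where
  toFun f := ⟨fun i => i.rep.π f, memℓp_infty ⟨B.fullNorm f, by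
    rintro _ ⟨i, rfl⟩
    exact norm_le_fullNorm i.rep f⟩⟩
  map_smul' c f := lp.ext (funext fun i => map_smul i.rep.π c f)
  map_zero' := lp.ext (funext fun i => map_zero i.rep.π)
  map_add' f g := lp.ext (funext fun i => map_add i.rep.π f g)
  map_mul' f g := lp.ext (funext fun i => map_mul i.rep.π f g)
  map_star' f := lp.ext (funext fun i => map_star i.rep.π f)

theorem fullNorm_nonneg (f : B.Cc) : 0 ≤ B.fullNorm f := ENNReal.toReal_nonneg

theorem norm_universalHom (f : B.Cc) : ‖B.universalHom f‖ = B.fullNorm f := by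
  refine le_antisymm (lp.norm_le_of_forall_le (fullNorm_nonneg f) fun i =>
    norm_le_fullNorm i.rep f) (le_of_forall_lt fun r hr => ?_)
  rcases lt_or_ge r 0 with h | h
  · exact h.trans_le (norm_nonneg _)
  · let i : B.NormWitness := ⟨(f, r), exists_lt_norm_rep h hr⟩
    exact i.2.choose_spec.trans_le
      (lp.norm_apply_le_norm ENNReal.top_ne_zero (B.universalHom f) i)

/-- The norm of a C*-algebra, pulled back along an injective `*`-homomorphism, is a C*-norm. -/
theorem isCStarNorm_of_starHom {C : Type*} [NonUnitalCStarAlgebra C] {N : B.Cc → ℝ}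
    (ι : B.Cc →⋆ₙₐ[ℂ] C) (hι : ∀ f, ‖ι f‖ = N f) (h0 : ∀ f, N f = 0 → f = 0) :
    B.IsCStarNorm N where
  eq_zero_iff f := ⟨h0 f, fun h => by rw [h, ← hι, map_zero, norm_zero]⟩
  add_le f g := by
    simp only [← hι, map_add]
    exact norm_add_le _ _
  smul c f := by
    simp only [← hι, map_smul]
    exact norm_smul _ _
  mul_le f g := by
    simp only [← hι, map_mul]
    exact _root_.norm_mul_le _ _
  star_mul_self f := by
    simp only [← hι, map_mul, map_star]
    rw [CStarRing.norm_star_mul_self, sq]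

theorem isCStarNorm_fullNorm : B.IsCStarNorm B.fullNorm := by
  refine isCStarNorm_of_starHom B.universalHom norm_universalHom fun f h => ?_
  by_contra hf
  obtain ⟨ρ, hρ⟩ := exists_rep_ne_zero hf
  have h1 := norm_le_fullNorm ρ f
  rw [h] at h1
  exact hρ (norm_le_zero_iff.1 h1)

/-- The full norm has a completion. -/
theorem exists_isCompletion_fullNorm (B : FellBundle G A) :
    ∃ (C : Type max u v) (_ : NonUnitalCStarAlgebra C) (ι : B.Cc →⋆ₙₐ[ℂ] C),
      B.IsCompletion B.fullNorm ι := by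
  let R := NonUnitalStarAlgHom.range B.universalHom
  let S := R.topologicalClosure
  have : IsClosed (S : Set (lp (fun i : B.NormWitness => i.rep.H →L[ℂ] i.rep.H) ∞)) :=
    R.isClosed_topologicalClosure
  let ι : B.Cc →⋆ₙₐ[ℂ] S := NonUnitalStarAlgHom.codRestrict B.universalHom S fun f =>
    R.le_topologicalClosure ⟨f, rfl⟩
  refine ⟨S, inferInstance, ι, norm_universalHom, Subtype.dense_iff.2 fun x hx => ?_⟩
  refine closure_mono ?_ hx
  rintro _ ⟨f, rfl⟩
  exact ⟨ι f, ⟨f, rfl⟩, rfl⟩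

/-! ### Uniqueness of completions -/

/-- Two completions in the same norm are uniquely isomorphic. -/
theorem IsCompletion.existsUnique_starAlgEquiv {N : B.Cc → ℝ} {C D : Type*}
    [NonUnitalCStarAlgebra C] [NonUnitalCStarAlgebra D] {ι : B.Cc →⋆ₙₐ[ℂ] C}
    {κ : B.Cc →⋆ₙₐ[ℂ] D} (hι : B.IsCompletion N ι) (hκ : B.IsCompletion N κ) :
    ∃! Φ : C ≃⋆ₐ[ℂ] D, ∀ f, Φ (ι f) = κ f := by
  let Ψ : C ≃ₗᵢ[ℂ] D := (LinearEquiv.refl ℂ B.Cc).extendOfIsometry (ι : B.Cc →ₗ[ℂ] C)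
    (κ : B.Cc →ₗ[ℂ] D) hι.dense hκ.dense fun f => (hκ.norm_map f).trans (hι.norm_map f).symm
  have hΨ : ∀ f, Ψ (ι f) = κ f := fun f => LinearEquiv.extendOfIsometry_eq _ _ _ _ _ _ f
  have hc : Continuous Ψ := Ψ.continuous
  refine ⟨{ toFun := Ψ
            invFun := Ψ.symm
            left_inv := Ψ.symm_apply_apply
            right_inv := Ψ.apply_symm_apply
            map_add' := map_add Ψ
            map_smul' := map_smul Ψ
            map_mul' := fun x y => ?_
            map_star' := fun x => ?_ }, hΨ, fun Φ hΦ => ?_⟩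
  · refine hι.dense.induction_on₂ (p := fun x y => Ψ (x * y) = Ψ x * Ψ y)
      (isClosed_eq (by fun_prop) (by fun_prop)) (fun f g => ?_) x y
    rw [← map_mul, hΨ, hΨ, hΨ, map_mul]
  · refine hι.dense.induction_on (p := fun x => Ψ (star x) = star (Ψ x)) x
      (isClosed_eq (by fun_prop) (by fun_prop)) fun f => ?_
    rw [← map_star, hΨ, hΨ, map_star]
  · have hcΦ : Continuous Φ := AddMonoidHomClass.continuous_of_bound Φ 1 fun x => by
      rw [one_mul]; exact NonUnitalStarAlgHom.norm_apply_le Φ x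
    refine DFunLike.coe_injective (hι.dense.equalizer hcΦ hc (funext fun f => ?_))
    exact (hΦ f).trans (hΨ f).symm

/-! ### Continuous sections over a Hausdorff groupoid -/

/-- Over a Hausdorff groupoid, a section that is continuous on an open set `V` and vanishes outside
a compact subset of `V` is continuous everywhere, as the compact set is closed. -/
theorem IsCompactlySupportedOn.continuousSections [T2Space G] {V : Set G} (hV : IsOpen V)
    {f : B.Sec} (hf : B.IsCompactlySupportedOn V f) : f ∈ B.continuousSections := by
  obtain ⟨K, hKV, hK, h0⟩ := hf.compact
  refine ⟨fun γ _ => ContinuousAt.continuousWithinAt ?_, K, subset_univ K, hK, h0⟩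
  by_cases hγ : γ ∈ V
  · exact (hf.continuousOn γ hγ).continuousAt (hV.mem_nhds hγ)
  · have h1 : ContinuousOn (fun γ => (f γ).pt) Kᶜ :=
      BanachBundle.continuousOn_zero.congr fun γ hγ => by rw [h0 γ hγ]
    exact (h1 γ fun h => hγ (hKV h)).continuousAt
      (hK.isClosed.isOpen_compl.mem_nhds fun h => hγ (hKV h))

theorem ccSubmodule_eq_continuousSections [T2Space G] :
    (B.ccSubmodule : Set B.Sec) = B.continuousSections := by
  refine Subset.antisymm (fun f hf => ?_) fun f hf =>
    Submodule.subset_span ⟨univ, isOpen_univ, inferInstance, hf⟩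
  replace hf : f ∈ B.ccSubmodule := hf
  unfold ccSubmodule at hf
  induction hf using Submodule.span_induction with
  | mem f hf =>
    obtain ⟨V, hV, -, hf⟩ := hf
    exact hf.continuousSections hV
  | zero => exact ⟨BanachBundle.continuousOn_zero, ∅, empty_subset _, isCompact_empty,
      fun _ _ => rfl⟩
  | add f g _ _ hf hg =>
    obtain ⟨hfc, K, -, hK, hfK⟩ := hf
    obtain ⟨hgc, L, -, hL, hgL⟩ := hg
    refine ⟨BanachBundle.continuousOn_add hfc hgc, K ∪ L, subset_univ _, hK.union hL,
      fun γ hγ => ?_⟩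
    rw [mem_union, not_or] at hγ
    rw [Pi.add_apply, hfK γ hγ.1, hgL γ hγ.2, add_zero]
  | smul c f _ hf =>
    obtain ⟨hfc, K, -, hK, hfK⟩ := hf
    exact ⟨BanachBundle.continuousOn_smul continuousOn_const hfc, K, subset_univ _, hK,
      fun γ hγ => by rw [Pi.smul_apply, hfK γ hγ, smul_zero]⟩

end FellBundle
end EtaleFell

open EtaleFell in
/-- The four norms on `C_c(G; A)` agree, they are a C*-norm, and the completion is the classical
full C*-algebra in the saturated, Hausdorff and second countable case. -/
theorem theorem2p7 {G : Type u} {A : Type v} [TopologicalSpace G] [EtaleGroupoid G]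
    [TopologicalSpace A] (B : FellBundle G A) :
    -- each pre-representation induces exactly one representation
    (∀ (H : Type max u v) [NormedAddCommGroup H] [InnerProductSpace ℂ H] [CompleteSpace H]
      (P : B.PreRep B.ilt H), ∃ M : B.Cc →⋆ₙₐ[ℂ] (H →L[ℂ] H),
        B.IsNondegenerate M ∧ @Continuous B.Cc (H →L[ℂ] H) B.ilt _ M ∧
        ∀ M' : B.Cc →⋆ₙₐ[ℂ] (H →L[ℂ] H), P.Induces M' ↔ M' = M) ∧
    -- the four suprema agree
    (∀ f : B.Cc, B.supNorm univ f = B.supNorm B.repsINormBounded f ∧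
      B.supNorm univ f = B.supNorm (B.repsContinuous B.ilt) f ∧
      B.supNorm univ f = B.supNorm (B.repsInduced B.ilt) f) ∧
    -- they are finite and define a C*-norm, which has a completion
    (∀ f : B.Cc, B.supNorm univ f < ⊤) ∧
    B.IsCStarNorm B.fullNorm ∧
    (∃ (C : Type max u v) (_ : NonUnitalCStarAlgebra C) (ι : B.Cc →⋆ₙₐ[ℂ] C),
      B.IsCompletion B.fullNorm ι) ∧
    -- comparison with the construction of Muhly and Williams
    (T2Space G → SecondCountableTopology G → B.IsSaturated →
      (B.ccSubmodule : Set B.Sec) = B.continuousSections ∧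
      (∀ f : B.Cc,
        B.supNorm (B.repsContinuous B.mwIlt) f = B.supNorm univ f ∧
        B.supNorm (B.repsInduced B.mwIlt) f = B.supNorm univ f) ∧
      ∀ (C D : Type max u v) [NonUnitalCStarAlgebra C] [NonUnitalCStarAlgebra D]
        (ι : B.Cc →⋆ₙₐ[ℂ] C) (κ : B.Cc →⋆ₙₐ[ℂ] D),
        B.IsCompletion B.fullNorm ι → B.IsCompletion B.mwNorm κ →
          ∃! Φ : C ≃⋆ₐ[ℂ] D, ∀ f, Φ (ι f) = κ f) := by
  refine ⟨fun H _ _ _ P => P.existsUnique_induces, fun f => ?_, FellBundle.supNorm_univ_lt_top,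
    FellBundle.isCStarNorm_fullNorm, FellBundle.exists_isCompletion_fullNorm B,
    fun _ _ _ => ⟨FellBundle.ccSubmodule_eq_continuousSections, fun f => ?_,
      fun C D _ _ ι κ hι hκ => ?_⟩⟩
  · rw [FellBundle.repsINormBounded_eq_univ, FellBundle.repsContinuous_ilt_eq_univ,
      FellBundle.repsInduced_ilt_eq_univ]
    exact ⟨rfl, rfl, rfl⟩
  · rw [FellBundle.repsContinuous_mwIlt_eq_univ, FellBundle.repsInduced_mwIlt_eq_univ]
    exact ⟨rfl, rfl⟩
  · have h : B.mwNorm = B.fullNorm := by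
      funext f
      rw [FellBundle.mwNorm, FellBundle.repsContinuous_mwIlt_eq_univ, FellBundle.fullNorm]
    rw [h] at hκ
    exact hι.existsUnique_starAlgEquiv hκ
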